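/- Let $\Delta$ be a finite simplicial poset, i.e. a finite poset with least element $\hat 0$ in which every interval $[\hat 0,x]$ is a Boolean lattice. Its geometric realization $|\Delta|$ is the regular CW complex obtained by taking one closed simplex for each element $x$ (whose vertices are the atoms below $x$; the empty simplex for $\hat 0$) and gluing them along the inclusions $x\le y$. Let $f_i$ be the number of $i$-dimensional faces of $\Delta$. Suppose that $|\Delta|$ is a closed (compact, without boundary, not necessarily connected) topological $3$-manifold. For a simplicial $1$-cocycle $\psi$ of $\Delta$ with coefficients in $\mathbb Z/2$, let $S_\psi\subset|\Delta|$ be the associated discrete normal surface: its intersection with each closed simplex is the convex hull of the midpoints of those edges $e$ of the simplex with $\psi(e)=1$ (so in each tetrahedron it is empty, a triangle or a quadrilateral). Its Euler characteristic $\chi(S_\psi)$ is the number of vertices minus the number of edges plus the number of $2$-cells in the cell decomposition of $S_\psi$ by its intersections with the open simplices; in particular $\chi(S_0)=\chi(\emptyset)=0$. Then for every cohomology class $c\in H^1(\Delta;\mathbb Z/2)$ the average of $\chi(S_\psi)$ over all cocycles $\psi$ that represent $c$ is $$\frac{1}{\#\{\psi : [\psi]=c\}}\sum_{\psi:\,[\psi]=c}\chi(S_\psi)=\frac{5f_0-f_1}{8}=\frac{4f_0-f_3}{8}.$$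 -/

import Mathlib

/-- A simplicial poset: a poset with a least element (the empty face) all of whose lower intervals
`[⊥, x]` are Boolean lattices.  (Finiteness is the separate assumption `[Finite P]`.) -/
structure IsSimplicialPoset (P : Type*) [PartialOrder P] [OrderBot P] : Prop where
  boolean : ∀ x : P, ∃ n : ℕ, Nonempty (Set.Iic x ≃o Finset (Fin n))

/-- A closed 3-manifold: a compact (not necessarily connected) Hausdorff second countable space in
which every point has an open neighbourhood homeomorphic to an open subset of `ℝ³`. -/
structure IsClosedThreeManifold (X : Type*) [TopologicalSpace X] : Prop where
  compact : CompactSpace X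
  hausdorff : T2Space X
  secondCountable : SecondCountableTopology X
  charts : Nonempty (ChartedSpace (EuclideanSpace ℝ (Fin 3)) X)

namespace SimplicialPoset

section Faces

variable {P : Type*} [PartialOrder P] [OrderBot P]

/-- The vertices of the face `x`: the atoms below it. -/
def Vert (x : P) : Type _ := {v : P // IsAtom v ∧ v ≤ x}

instance [Finite P] (x : P) : Finite (Vert x) := by unfold Vert; infer_instance

noncomputable instance [Finite P] (x : P) : Fintype (Vert x) := Fintype.ofFinite _

/-- For faces `x ≤ y`, the inclusion of the vertices of `x` in those of `y`. -/
def Vert.incl {x y : P} (h : x ≤ y) (v : Vert x) : Vert y := ⟨v.1, v.2.1, v.2.2.trans h⟩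

variable (P)

/-- The `i`-dimensional faces: those with exactly `i + 1` vertices. -/
def Face (i : ℕ) : Type _ := {x : P // Nat.card (Vert x) = i + 1}

instance [Finite P] (i : ℕ) : Finite (Face P i) := by unfold Face; infer_instance

noncomputable instance [Finite P] (i : ℕ) : Fintype (Face P i) := Fintype.ofFinite _

/-- The face numbers `f_i`. -/
noncomputable def faceNumber (i : ℕ) : ℕ := Nat.card (Face P i)

end Faces

section Realization

variable (P : Type*) [PartialOrder P] [OrderBot P] [Finite P]

/-- The gluing: a point of the closed simplex `x` is identified with its image in the closed
simplex `y` under the inclusion of simplices given by `x ≤ y`. -/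
def Glue (p q : Σ x : P, stdSimplex ℝ (Vert x)) : Prop :=
  ∃ h : p.1 ≤ q.1, q.2 = stdSimplex.map (Vert.incl h) p.2

/-- The geometric realization: one closed simplex for each face (the empty one for `⊥`), glued
along the inclusions of faces, with the quotient topology. -/
def Realization : Type _ := Quot (Glue P)

instance : TopologicalSpace (Realization P) :=
  inferInstanceAs (TopologicalSpace (Quot (Glue P)))

variable {P}

/-- The characteristic map of the closed simplex `x`. -/
def toRealization (x : P) (t : stdSimplex ℝ (Vert x)) : Realization P := Quot.mk _ ⟨x, t⟩

end Realization

section Cohomology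

variable (P : Type*) [PartialOrder P] [OrderBot P] [Finite P]

open Classical in
/-- The simplicial coboundary `C^i → C^{i+1}` with coefficients in `ℤ/2`. -/
noncomputable def coboundary (i : ℕ) : (Face P i → ZMod 2) →ₗ[ZMod 2] (Face P (i + 1) → ZMod 2) where
  toFun φ t := ∑ e : Face P i with e.1 ≤ t.1, φ e
  map_add' φ ψ := by
    funext t
    simp [Finset.sum_add_distrib]
  map_smul' a φ := by
    funext t
    simp [Finset.mul_sum]

/-- The `1`-cocycles with coefficients in `ℤ/2`. -/
noncomputable abbrev Cocycle : Submodule (ZMod 2) (Face P 1 → ZMod 2) :=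
  LinearMap.ker (coboundary P 1)

/-- `H^1(Δ; ℤ/2)`: cocycles modulo coboundaries. -/
abbrev Cohomology : Type _ :=
  Cocycle P ⧸ (LinearMap.range (coboundary P 0)).submoduleOf (Cocycle P)

variable {P}

/-- The set of the cocycles in a given cohomology class. -/
noncomputable def cocyclesIn (c : Cohomology P) : Finset (Cocycle P) :=
  (Set.toFinite {ψ : Cocycle P | (Submodule.Quotient.mk ψ : Cohomology P) = c}).toFinset

end Cohomology

section Surface

variable {P : Type*} [PartialOrder P] [OrderBot P] [Finite P]

open Classical in
/-- The midpoint of the edge `e` of the face `x`, in the barycentric coordinates of `x`. -/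
noncomputable def edgeMidpoint (x : P) (e : Face P 1) : Vert x → ℝ :=
  fun v => if v.1 ≤ e.1 then 1 / 2 else 0

/-- The normal piece in the closed simplex `x`: the convex hull of the midpoints of its
`ψ`-odd edges.  For a cocycle `ψ` and a tetrahedron this is empty, a triangle (cutting one vertex
off the other three) or a quadrilateral (separating two vertices from the other two); for a triangle
it is empty or a segment that joins the midpoints of two edges. -/
def normalPiece (ψ : Face P 1 → ZMod 2) (x : P) : Set (Vert x → ℝ) :=
  convexHull ℝ {m | ∃ e : Face P 1, e.1 ≤ x ∧ ψ e = 1 ∧ m = edgeMidpoint x e}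

/-- The discrete normal surface `S_ψ`, a subset of the geometric realization: the union of the
normal pieces in all the simplices. -/
def normalSurface (ψ : Face P 1 → ZMod 2) : Set (Realization P) :=
  ⋃ x : P, toRealization x '' {t | (t : Vert x → ℝ) ∈ normalPiece ψ x}

/-- The part of `S` in the open simplex `x`, in the barycentric coordinates of `x`. -/
def openCell (S : Set (Realization P)) (x : P) : Set (Vert x → ℝ) :=
  {t | ∃ ht : t ∈ stdSimplex ℝ (Vert x), (∀ v, 0 < t v) ∧ toRealization x ⟨t, ht⟩ ∈ S}

/-- The Euler characteristic (number of cells of even dimension minus number of cells of odd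
dimension) of a compact subset `S` of the realization that meets each open simplex in the empty set
or in an open convex cell.  These intersections are then the open cells of a finite cell
decomposition of `S`.  For `S = S_ψ` the vertices lie on the odd edges of the complex, the edges in
its triangles and the triangular and quadrilateral `2`-cells in its tetrahedra. -/
noncomputable def eulerChar (S : Set (Realization P)) : ℤ :=
  ∑ x ∈ (Set.toFinite {x : P | (openCell S x).Nonempty}).toFinset,
    (-1) ^ Module.finrank ℝ (vectorSpan ℝ (openCell S x))

end Surface

end SimplicialPoset

/-!
The formula reduces to face numbers of `P`, and these are controlled by the links of the faces.

*The surface.* On a closed face `x` a cocycle `ψ` is the coboundary of a function `g` on the vertices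
(`exists_isPotential`), and the normal piece is cut out of the simplex by the condition that the
vertices with `g = 1` have total weight `1 / 2` (`mem_normalPiece_iff`). Hence the normal surface has
exactly one open cell, of dimension `dim x - 1`, in every face `x` on which `ψ` does not vanish, and
no other cell (`eulerChar_normalSurface`).

*The average.* The cocycles of a class are `ψ + δφ`, each for equally many `0`-cochains `φ`. For a
face with `r ≥ 1` vertices, `ψ + δφ` vanishes on it if and only if `φ` is a translate of a fixed
function by a constant on its vertices, so it vanishes with probability `2 / 2 ^ r` (`card_odd`). The
average of the Euler characteristic is therefore `f₁ / 2 - 3 f₂ / 4 + 7 f₃ / 8`, once it is known that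
no face has more than four vertices.

*The face numbers.* It remains to show `f₂ = 2 f₃` and `f₀ - f₁ + f₃ = 0`. Both follow by counting from
`sum_link`: for `x ≠ ⊥` the alternating sum of `(-1) ^ #vertices` over the faces above `x` is `1`, i.e.
the link of `x` has the reduced Euler characteristic of a `2`-sphere. A triangle then lies in two
tetrahedra, and the sum over all vertices gives the second equation. The realization is not assumed
to be a combinatorial manifold, so the link need not be a sphere; but it has the cohomology of one, as
follows. The barycentre of `x` has a conical neighbourhood, its open star, and another one given by a
chart, a ball. Conical neighbourhoods of one point can be shrunk into each other, which interleaves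
the two links up to homotopy, so their cohomology agrees (`ConeNhd.betti_link_eq`).

*The cohomology theory.* The theory used is Alexander-Spanier cohomology mod 2 of compact subsets of
metric spaces: cochains are functions on finite lists of points, modulo those that vanish on all
sufficiently small lists. A homotopy is divided into steps so small that a prism operator compares
consecutive maps, which gives homotopy invariance (`Cohomologous.of_homotopy_eqOn`). The excision
that Mayer-Vietoris needs follows from compactness, by means of maps that are discontinuous but move
points only little (`exists_coarse_retraction`). The link of `x` in the open face `x` is the boundary
of a simplex, and in each closed face properly containing `x` it is star-shaped; so Mayer-Vietoris
computes the Euler characteristic of the link face by face (`hasEuler_linkPart`).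
-/

/-! ### The rank count of the Mayer-Vietoris sequence -/

namespace SubquotientCohomology

variable {K V W : Type*} [Field K] [AddCommGroup V] [Module K V] [AddCommGroup W] [Module K W]

/-- The subquotient `Z / (B ∩ Z)` of a vector space. -/
abbrev Subquot (Z B : Submodule K V) : Type _ := ↥Z ⧸ B.submoduleOf Z

/-- The map of subquotients induced by a linear map. -/
def subquotMap {Z B : Submodule K V} {Z' B' : Submodule K W} (f : V →ₗ[K] W)
    (hZ : ∀ z ∈ Z, f z ∈ Z') (hB : ∀ b ∈ B, f b ∈ B') : Subquot Z B →ₗ[K] Subquot Z' B' :=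
  Submodule.mapQ _ _ (f.restrict hZ) (fun x hx => hB x.1 hx)

lemma subquot_mk_eq_zero {Z B : Submodule K V} (z : Z) :
    (Submodule.Quotient.mk z : Subquot Z B) = 0 ↔ z.1 ∈ B := by
  rw [Submodule.Quotient.mk_eq_zero]; rfl

lemma subquot_mk_eq {Z B : Submodule K V} (z w : Z) :
    (Submodule.Quotient.mk z : Subquot Z B) = Submodule.Quotient.mk w ↔ z.1 - w.1 ∈ B := by
  rw [Submodule.Quotient.eq]; rfl

lemma subquotMap_mk {Z B : Submodule K V} {Z' B' : Submodule K W} (f : V →ₗ[K] W)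
    (hZ : ∀ z ∈ Z, f z ∈ Z') (hB : ∀ b ∈ B, f b ∈ B') (z : Z) :
    subquotMap f hZ hB (Submodule.Quotient.mk z) =
      Submodule.Quotient.mk ⟨f z.1, hZ _ z.2⟩ := rfl

/-- Two subquotients are isomorphic if there are maps between them that are mutually inverse
modulo the denominators. -/
lemma nonempty_subquot_equiv {Z B : Submodule K V} {Z' B' : Submodule K W} (f : V →ₗ[K] W)
    (hZ : ∀ z ∈ Z, f z ∈ Z') (hB : ∀ b ∈ B, f b ∈ B') (g : W →ₗ[K] V)
    (gZ : ∀ z ∈ Z', g z ∈ Z) (gB : ∀ b ∈ B', g b ∈ B)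
    (hgf : ∀ z ∈ Z, g (f z) - z ∈ B) (hfg : ∀ z ∈ Z', f (g z) - z ∈ B') :
    Nonempty (Subquot Z B ≃ₗ[K] Subquot Z' B') := by
  refine ⟨LinearEquiv.ofLinearMap (subquotMap f hZ hB) (subquotMap g gZ gB) ?_ ?_⟩
  · ext z
    simp only [LinearMap.comp_apply, Submodule.mkQ_apply, LinearMap.id_apply, subquotMap_mk]
    rw [subquot_mk_eq]; exact hfg _ z.2
  · ext z
    simp only [LinearMap.comp_apply, Submodule.mkQ_apply, LinearMap.id_apply, subquotMap_mk]
    rw [subquot_mk_eq]; exact hgf _ z.2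

/-- The cohomology in degree `p + 1` of the graded subspace `S` of a vector space with
differential `d : S p → S (p + 1)`. -/
abbrev Coh (d : V →ₗ[K] V) (S : ℕ → Submodule K V) (p : ℕ) : Type _ :=
  Subquot (S (p + 1) ⊓ LinearMap.ker d) ((S p).map d)

section MayerVietoris

variable {d : V →ₗ[K] V} {S T : ℕ → Submodule K V}

/-- The map on cohomology induced by an inclusion of graded subspaces. -/
def inclMap (d : V →ₗ[K] V) {S T : ℕ → Submodule K V} (h : ∀ p, S p ≤ T p) (p : ℕ) :
    Coh d S p →ₗ[K] Coh d T p :=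
  subquotMap LinearMap.id (fun _ hz => ⟨h _ hz.1, hz.2⟩) (fun _ hb => Submodule.map_mono (h p) hb)

/-- The numerical content of the Mayer-Vietoris sequence of `0 → S ⊓ T → S × T → J → 0`, where `J`
is the sum of the graded subspaces `S` and `T` and `c` is a linear choice of the `S`-part of an
element of `J`.  The number `r p` is the rank of the `p`-th connecting map. -/
theorem mayerVietoris_finrank (hdd : ∀ v, d (d v) = 0)
    (hS : ∀ p, ∀ v ∈ S p, d v ∈ S (p + 1)) (hT : ∀ p, ∀ v ∈ T p, d v ∈ T (p + 1))
    (hS0 : S 0 = ⊥) (I J : ℕ → Submodule K V) (hI : ∀ p, I p = S p ⊓ T p)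
    (hJS : ∀ p, S p ≤ J p) (hJT : ∀ p, T p ≤ J p)
    (c : V →ₗ[K] V) (hcS : ∀ p, ∀ v ∈ J p, c v ∈ S p) (hcT : ∀ p, ∀ v ∈ J p, v - c v ∈ T p)
    (fS : ∀ p, FiniteDimensional K (Coh d S p)) (fT : ∀ p, FiniteDimensional K (Coh d T p))
    (fJ : ∀ p, FiniteDimensional K (Coh d J p)) :
    (∀ p, FiniteDimensional K (Coh d I p)) ∧ ∃ r : ℕ → ℕ,
      (∀ p, r p ≤ Module.finrank K (Coh d J p)) ∧
      (∀ p, Module.finrank K (Coh d J p) ≤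
        r p + (Module.finrank K (Coh d S p) + Module.finrank K (Coh d T p))) ∧
      (Module.finrank K (Coh d S 0) + Module.finrank K (Coh d T 0) + r 0 =
        Module.finrank K (Coh d J 0) + Module.finrank K (Coh d I 0)) ∧
      ∀ p, Module.finrank K (Coh d S (p + 1)) + Module.finrank K (Coh d T (p + 1)) + r (p + 1)
          + r p =
        Module.finrank K (Coh d J (p + 1)) + Module.finrank K (Coh d I (p + 1)) := by
  have hIS : ∀ p, I p ≤ S p := fun p => (hI p).le.trans inf_le_left
  have hIT : ∀ p, I p ≤ T p := fun p => (hI p).le.trans inf_le_right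
  let α : ∀ p, Coh d I p →ₗ[K] Coh d S p × Coh d T p := fun p =>
    (inclMap d hIS p).prod (inclMap d hIT p)
  let β : ∀ p, Coh d S p × Coh d T p →ₗ[K] Coh d J p := fun p =>
    (inclMap d hJS p).coprod (- inclMap d hJT p)
  have hmemI : ∀ p v, v ∈ S p → v ∈ T p → v ∈ I p := fun p v h1 h2 => by
    rw [hI]; exact ⟨h1, h2⟩
  -- the connecting map takes a cocycle of `J` to the differential of its `S`-part
  let δ : ∀ p, Coh d J p →ₗ[K] Coh d I (p + 1) := fun p =>
    subquotMap (d ∘ₗ c)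
      (fun z hz => ⟨hmemI _ _ (hS _ _ (hcS _ _ hz.1)) (by
          have h2 := hT _ _ (hcT _ _ hz.1)
          have h3 : d z = 0 := hz.2
          rw [map_sub, h3, zero_sub] at h2
          exact neg_mem_iff.1 h2), hdd _⟩)
      (by
        rintro _ ⟨v, hv, rfl⟩
        -- `c (d v) - d (c v)` lies in both `S` and `T`
        refine ⟨c (d v) - d (c v), ?_, by simp [hdd]⟩
        have hv' : v ∈ J p := hv
        have hdv : d v ∈ J (p + 1) := by
          have : d v = d (c v) + d (v - c v) := by rw [← map_add]; congr 1; abel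
          rw [this]
          exact add_mem (hJS _ (hS _ _ (hcS _ _ hv'))) (hJT _ (hT _ _ (hcT _ _ hv')))
        refine hmemI _ _ (sub_mem (hcS _ _ hdv) (hS _ _ (hcS _ _ hv'))) ?_
        have := sub_mem (hT _ _ (hcT _ _ hv')) (hcT _ _ hdv)
        rw [map_sub] at this
        have e : d v - d (c v) - (d v - c (d v)) = c (d v) - d (c v) := by abel
        rwa [e] at this)
  have exβ : ∀ p, LinearMap.ker (β p) = LinearMap.range (α p) := by
    intro p
    ext ⟨x, y⟩
    induction x using Submodule.Quotient.induction_on with | H x => ?_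
    induction y using Submodule.Quotient.induction_on with | H y => ?_
    constructor
    · intro h
      have h1 : (Submodule.Quotient.mk ⟨x.1, ⟨hJS _ x.2.1, x.2.2⟩⟩ : Coh d J p) -
        Submodule.Quotient.mk ⟨y.1, ⟨hJT _ y.2.1, y.2.2⟩⟩ = 0 := by
          rw [sub_eq_add_neg]; exact h
      rw [sub_eq_zero, subquot_mk_eq] at h1
      obtain ⟨v, hv, hvd⟩ := h1
      have hvd : d v = x.1 - y.1 := hvd
      have e : x.1 - d (c v) = y.1 + d (v - c v) := by
        rw [map_sub, hvd]; abel
      have hw : x.1 - d (c v) ∈ I (p + 1) ⊓ LinearMap.ker d :=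
        ⟨hmemI _ _ (sub_mem x.2.1 (hS _ _ (hcS _ _ hv)))
          (by rw [e]; exact add_mem y.2.1 (hT _ _ (hcT _ _ hv))),
          by
            have h3 : d x.1 = 0 := x.2.2
            simp [hdd, h3]⟩
      refine ⟨Submodule.Quotient.mk ⟨_, hw⟩, ?_⟩
      refine Prod.ext ?_ ?_
      · refine (subquot_mk_eq _ _).2 ⟨- c v, neg_mem (hcS _ _ hv), ?_⟩
        change d (-c v) = x.1 - d (c v) - x.1
        rw [map_neg]; abel
      · refine (subquot_mk_eq _ _).2 ⟨v - c v, hcT _ _ hv, ?_⟩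
        change d (v - c v) = x.1 - d (c v) - y.1
        rw [e]; abel
    · rintro ⟨w, hw⟩
      rw [← hw]
      induction w using Submodule.Quotient.induction_on with | H w => ?_
      change (Submodule.Quotient.mk _ : Coh d J p) + - Submodule.Quotient.mk _ = 0
      exact add_neg_cancel _
  have exδ : ∀ p, LinearMap.ker (δ p) = LinearMap.range (β p) := by
    intro p
    ext z
    induction z using Submodule.Quotient.induction_on with | H z => ?_
    constructor
    · intro h
      obtain ⟨w, hw, hwd⟩ := (subquot_mk_eq_zero _).1 h
      have hwd : d w = d (c z.1) := hwd
      have hz3 : d z.1 = 0 := z.2.2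
      have hw' : w ∈ I (p + 1) := hw
      refine ⟨(Submodule.Quotient.mk ⟨c z.1 - w, sub_mem (hcS _ _ z.2.1) (hIS _ hw'), ?_⟩,
        Submodule.Quotient.mk ⟨-(z.1 - c z.1 + w),
          neg_mem (add_mem (hcT _ _ z.2.1) (hIT _ hw')), ?_⟩), ?_⟩
      · simp [hwd]
      · simp [hwd, hz3]
      · change (Submodule.Quotient.mk _ : Coh d J p) + - Submodule.Quotient.mk _ = _
        rw [← sub_eq_add_neg, ← Submodule.Quotient.mk_sub, subquot_mk_eq]
        have e : c z.1 - w - -(z.1 - c z.1 + w) - z.1 = 0 := by abel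
        change c z.1 - w - -(z.1 - c z.1 + w) - z.1 ∈ _
        rw [e]
        exact zero_mem _
    · rintro ⟨⟨x, y⟩, hxy⟩
      rw [← hxy]
      induction x using Submodule.Quotient.induction_on with | H x => ?_
      induction y using Submodule.Quotient.induction_on with | H y => ?_
      change δ p ((Submodule.Quotient.mk _ : Coh d J p) + - Submodule.Quotient.mk _) = 0
      rw [← sub_eq_add_neg, ← Submodule.Quotient.mk_sub]
      refine (subquot_mk_eq_zero _).2 ?_
      have hx3 : d x.1 = 0 := x.2.2
      have hxy' : x.1 - y.1 ∈ J (p + 1) := sub_mem (hJS _ x.2.1) (hJT _ y.2.1)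
      refine ⟨c (x.1 - y.1) - x.1, hmemI _ _ (sub_mem (hcS _ _ hxy') x.2.1) ?_, ?_⟩
      · have := neg_mem (add_mem (hcT _ _ hxy') y.2.1)
        convert this using 1; abel
      · rw [map_sub, hx3, sub_zero]; rfl
  have exα : ∀ p, LinearMap.ker (α (p + 1)) = LinearMap.range (δ p) := by
    intro p
    ext z
    induction z using Submodule.Quotient.induction_on with | H z => ?_
    constructor
    · intro h
      obtain ⟨s, hs, hsz⟩ := (subquot_mk_eq_zero _).1 (congrArg Prod.fst h)
      obtain ⟨t, ht, htz⟩ := (subquot_mk_eq_zero _).1 (congrArg Prod.snd h)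
      have hs : s ∈ S (p + 1) := hs
      have ht : t ∈ T (p + 1) := ht
      have hsz : d s = z.1 := hsz
      have htz : d t = z.1 := htz
      have hst : s - t ∈ J (p + 1) := sub_mem (hJS _ hs) (hJT _ ht)
      refine ⟨Submodule.Quotient.mk ⟨s - t, hst, by simp [hsz, htz]⟩, ?_⟩
      refine (subquot_mk_eq _ _).2 ⟨c (s - t) - s, hmemI _ _ (sub_mem (hcS _ _ hst) hs) ?_, ?_⟩
      · have := neg_mem (add_mem (hcT _ _ hst) ht)
        convert this using 1; abel
      · change d (c (s - t) - s) = d (c (s - t)) - z.1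
        rw [map_sub, hsz]
    · rintro ⟨w, hw⟩
      rw [← hw]
      induction w using Submodule.Quotient.induction_on with | H w => ?_
      have hw3 : d w.1 = 0 := w.2.2
      refine Prod.ext ((subquot_mk_eq_zero _).2 ⟨c w.1, hcS _ _ w.2.1, rfl⟩)
        ((subquot_mk_eq_zero _).2 ⟨-(w.1 - c w.1), neg_mem (hcT _ _ w.2.1), ?_⟩)
      change d (-(w.1 - c w.1)) = d (c w.1)
      simp [hw3]
  have exα0 : LinearMap.ker (α 0) = ⊥ := by
    refine LinearMap.ker_eq_bot'.2 fun z h => ?_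
    induction z using Submodule.Quotient.induction_on with | H z => ?_
    obtain ⟨s, hs, hsz⟩ := (subquot_mk_eq_zero _).1 (congrArg Prod.fst h)
    have hs : s ∈ S 0 := hs
    rw [hS0, Submodule.mem_bot] at hs
    refine (subquot_mk_eq_zero _).2 ⟨0, zero_mem _, ?_⟩
    rw [map_zero]
    rw [hs, map_zero] at hsz
    exact hsz
  have fI : ∀ p, FiniteDimensional K (Coh d I p) := by
    intro p
    have : FiniteDimensional K (LinearMap.ker (α p)) := by
      cases p with
      | zero => rw [exα0]; infer_instance
      | succ p => rw [exα]; infer_instance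
    have h2 : FiniteDimensional K (Coh d I p ⧸ LinearMap.ker (α p)) :=
      Module.Finite.equiv (α p).quotKerEquivRange.symm
    exact Module.Finite.of_submodule_quotient (LinearMap.ker (α p))
  refine ⟨fI, fun p => Module.finrank K (LinearMap.range (δ p)),
    fun p => LinearMap.finrank_range_le _, fun p => ?_, ?_, fun p => ?_⟩
  · have h2 := (β p).finrank_range_le
    have h3 := (δ p).finrank_range_add_finrank_ker
    rw [Module.finrank_prod] at h2
    rw [exδ] at h3
    dsimp only
    omega
  · have h1 := (α 0).finrank_range_add_finrank_ker
    have h2 := (β 0).finrank_range_add_finrank_ker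
    have h3 := (δ 0).finrank_range_add_finrank_ker
    rw [exα0, finrank_bot] at h1
    rw [exβ, Module.finrank_prod] at h2
    rw [exδ] at h3
    dsimp only
    omega
  · have h1 := (α (p + 1)).finrank_range_add_finrank_ker
    have h2 := (β (p + 1)).finrank_range_add_finrank_ker
    have h3 := (δ (p + 1)).finrank_range_add_finrank_ker
    rw [exα] at h1
    rw [exβ, Module.finrank_prod] at h2
    rw [exδ] at h3
    dsimp only
    omega

end MayerVietoris

end SubquotientCohomology

/-! ### Alexander-Spanier cohomology of subsets of metric spaces -/

namespace AlexanderSpanier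

open SubquotientCohomology Set

variable {E F G : Type*}

/-- The coboundary of an inhomogeneous `ℤ/2`-cochain, i.e. of a function on finite lists of points:
`(dφ)(x₁, …, xₙ)` is the sum of the values of `φ` on the lists with one entry removed. -/
def coboundaryFun : (List E → ZMod 2) → List E → ZMod 2
  | _, [] => 0
  | φ, x :: l => φ l + coboundaryFun (fun l' => φ (x :: l')) l

lemma coboundaryFun_add (φ ψ : List E → ZMod 2) (l : List E) :
    coboundaryFun (φ + ψ) l = coboundaryFun φ l + coboundaryFun ψ l := by
  induction l generalizing φ ψ with
  | nil => simp [coboundaryFun]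
  | cons x l ih =>
    have := ih (fun l' => φ (x :: l')) (fun l' => ψ (x :: l'))
    simp only [coboundaryFun, Pi.add_apply]
    rw [show (fun l' => φ (x :: l') + ψ (x :: l')) =
      (fun l' => φ (x :: l')) + (fun l' => ψ (x :: l')) from rfl, this]
    ring

lemma coboundaryFun_smul (a : ZMod 2) (φ : List E → ZMod 2) (l : List E) :
    coboundaryFun (a • φ) l = a * coboundaryFun φ l := by
  induction l generalizing φ with
  | nil => simp [coboundaryFun]
  | cons x l ih =>
    have := ih (fun l' => φ (x :: l'))
    simp only [coboundaryFun, Pi.smul_apply, smul_eq_mul]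
    rw [show (fun l' => a * φ (x :: l')) = a • (fun l' => φ (x :: l')) from rfl, this]
    ring

/-- The coboundary as a linear map. -/
def cobd (E : Type*) : (List E → ZMod 2) →ₗ[ZMod 2] (List E → ZMod 2) where
  toFun := coboundaryFun
  map_add' φ ψ := funext fun l => coboundaryFun_add φ ψ l
  map_smul' a φ := funext fun l => coboundaryFun_smul a φ l

lemma cobd_nil (φ : List E → ZMod 2) : cobd E φ [] = 0 := rfl

lemma cobd_cons (φ : List E → ZMod 2) (x : E) (l : List E) :
    cobd E φ (x :: l) = φ l + cobd E (fun l' => φ (x :: l')) l := rfl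

lemma cobd_cobd (φ : List E → ZMod 2) : cobd E (cobd E φ) = 0 := by
  funext l
  induction l generalizing φ with
  | nil => rfl
  | cons x l ih =>
    have h : (fun l' => cobd E φ (x :: l')) = φ + cobd E (fun l' => φ (x :: l')) := rfl
    rw [cobd_cons, h, map_add, Pi.add_apply, ih, ← add_assoc, CharTwo.add_self_eq_zero, zero_add]
    rfl

/-- The coboundary at `l` only involves sublists of `l` with one entry less. -/
lemma cobd_eq_zero (φ : List E → ZMod 2) (l : List E)
    (h : ∀ l', l'.length + 1 = l.length → l' ⊆ l → φ l' = 0) : cobd E φ l = 0 := by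
  induction l generalizing φ with
  | nil => rfl
  | cons x l ih =>
    rw [cobd_cons, h l (by simp) (List.subset_cons_self _ _), zero_add]
    exact ih _ fun l' h1 h2 => h _ (by simpa using h1) (List.cons_subset_cons x h2)

/-- The pullback of a cochain along a map of sets. -/
def pull (f : E → F) : (List F → ZMod 2) →ₗ[ZMod 2] (List E → ZMod 2) :=
  LinearMap.funLeft _ _ (List.map f)

lemma pull_apply (f : E → F) (φ : List F → ZMod 2) (l : List E) : pull f φ l = φ (l.map f) := rfl

lemma pull_id (φ : List E → ZMod 2) : pull id φ = φ := by
  funext l; simp [pull_apply]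

lemma pull_pull (f : E → F) (g : F → G) (φ : List G → ZMod 2) :
    pull f (pull g φ) = pull (g ∘ f) φ := by
  funext l; simp [pull_apply]

lemma cobd_pull (f : E → F) (φ : List F → ZMod 2) : cobd E (pull f φ) = pull f (cobd F φ) := by
  funext l
  induction l generalizing φ with
  | nil => rfl
  | cons x l ih => exact congrArg (φ (l.map f) + ·) (ih fun l' => φ (f x :: l'))

/-- The prism operator of two maps `f` and `g`, a chain homotopy between the pullbacks:
`(x₁, …, xₙ)` is sent to the sum of the lists `(f x₁, …, f xᵢ, g xᵢ, …, g xₙ)`. -/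
def prism (f g : E → F) : (List F → ZMod 2) → List E → ZMod 2
  | _, [] => 0
  | φ, x :: l => φ (f x :: g x :: l.map g) + prism f g (fun l' => φ (f x :: l')) l

lemma prism_add (f g : E → F) (φ ψ : List F → ZMod 2) (l : List E) :
    prism f g (φ + ψ) l = prism f g φ l + prism f g ψ l := by
  induction l generalizing φ ψ with
  | nil => simp [prism]
  | cons x l ih =>
    have := ih (fun l' => φ (f x :: l')) (fun l' => ψ (f x :: l'))
    simp only [prism, Pi.add_apply]
    rw [show (fun l' => φ (f x :: l') + ψ (f x :: l')) =
      (fun l' => φ (f x :: l')) + (fun l' => ψ (f x :: l')) from rfl, this]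
    ring

lemma prism_zero (f g : E → F) (l : List E) : prism f g 0 l = 0 := by
  induction l with
  | nil => rfl
  | cons x l ih => exact (zero_add _).trans ih

lemma cobd_prism (f g : E → F) (φ : List F → ZMod 2) (l : List E) :
    cobd E (prism f g φ) l + prism f g (cobd F φ) l = pull f φ l + pull g φ l := by
  induction l generalizing φ with
  | nil => simp [cobd_nil, prism, pull_apply, CharTwo.add_self_eq_zero]
  | cons x l ih =>
    have h1 : (fun l' => prism f g φ (x :: l')) =
      pull g (fun l' => φ (f x :: g x :: l')) + prism f g (fun l' => φ (f x :: l')) := rfl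
    have h2 : (fun l' => cobd F φ (f x :: l')) = φ + cobd F (fun l' => φ (f x :: l')) := rfl
    have h3 : prism f g (cobd F φ) (x :: l) = (φ (g x :: l.map g) + (φ (f x :: l.map g)
      + cobd F (fun l' => φ (f x :: g x :: l')) (l.map g)))
      + prism f g (fun l' => cobd F φ (f x :: l')) l := rfl
    have h4 := ih (fun l' => φ (f x :: l'))
    rw [cobd_cons, h1, map_add, Pi.add_apply, h3, h2, prism_add, cobd_pull]
    simp only [pull_apply, List.map_cons] at h4 ⊢
    clear h1 h2 h3 ih
    generalize prism f g φ l = a at *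
    generalize cobd F (fun l' => φ (f x :: g x :: l')) (l.map g) = b at *
    generalize cobd E (prism f g fun l' => φ (f x :: l')) l = c at *
    generalize prism f g (cobd F fun l' => φ (f x :: l')) l = e at *
    generalize φ (f x :: l.map g) = k at *
    generalize φ (g x :: l.map g) = m at *
    generalize φ (f x :: l.map f) = n at *
    revert h4
    revert a b c e k m n
    decide

lemma prism_eq_zero (f g : E → F) (φ : List F → ZMod 2) (l : List E)
    (h : ∀ l' : List F, l'.length = l.length + 1 → (∀ a ∈ l', ∃ x ∈ l, a = f x ∨ a = g x) →
      φ l' = 0) : prism f g φ l = 0 := by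
  induction l generalizing φ with
  | nil => rfl
  | cons x l ih =>
    have h1 : φ (f x :: g x :: l.map g) = 0 := by
      refine h _ (by simp) ?_
      simp only [List.mem_cons, List.mem_map]
      rintro a (rfl | rfl | ⟨y, hy, rfl⟩)
      · exact ⟨x, Or.inl rfl, Or.inl rfl⟩
      · exact ⟨x, Or.inl rfl, Or.inr rfl⟩
      · exact ⟨y, Or.inr hy, Or.inr rfl⟩
    change φ (f x :: g x :: l.map g) + prism f g (fun l' => φ (f x :: l')) l = 0
    rw [h1, zero_add]
    refine ih _ fun l' hl hm => h _ (by simp [hl]) ?_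
    intro a ha
    rcases List.mem_cons.1 ha with rfl | ha
    · exact ⟨x, by simp, Or.inl rfl⟩
    · obtain ⟨y, hy, hya⟩ := hm a ha
      exact ⟨y, by simp [hy], hya⟩

lemma add_add_add_cancel_middle (a b c : List E → ZMod 2) : a + b + (b + c) = a + c := by
  rw [add_assoc, ← add_assoc b, CharTwo.add_self_eq_zero, zero_add]

lemma cobd_prism_of_cocycle (f g : E → F) {z : List F → ZMod 2} (hz : cobd F z = 0) :
    cobd E (prism f g z) = pull f z + pull g z := by
  funext l
  have := cobd_prism f g z l
  rwa [hz, prism_zero, add_zero] at this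

section Metric

variable [MetricSpace E] [MetricSpace F] [MetricSpace G]

/-- A list of points of `A` of diameter less than `ε`. -/
def Small (ε : ℝ) (A : Set E) (l : List E) : Prop :=
  (∀ a ∈ l, a ∈ A) ∧ ∀ a ∈ l, ∀ b ∈ l, dist a b < ε

lemma Small.mono {ε δ : ℝ} {A B : Set E} {l : List E} (h : Small ε A l) (hε : ε ≤ δ)
    (hA : A ⊆ B) : Small δ B l :=
  ⟨fun a ha => hA (h.1 a ha), fun a ha b hb => (h.2 a ha b hb).trans_le hε⟩

/-- The cochains on lists of length `p` that vanish on all sufficiently small lists in `A`.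
The cochain complex of all functions on lists of points is exact, so the complex of these
*negligible* cochains computes the (reduced) Alexander-Spanier cohomology of `A`, which is defined by
the quotient, with a shift of the degree. -/
def negligible (A : Set E) (p : ℕ) : Submodule (ZMod 2) (List E → ZMod 2) where
  carrier := {φ | (∀ l, l.length ≠ p → φ l = 0) ∧ ∃ ε > 0, ∀ l, Small ε A l → φ l = 0}
  zero_mem' := ⟨fun _ _ => rfl, 1, one_pos, fun _ _ => rfl⟩
  add_mem' := by
    rintro φ ψ ⟨h1, ε, hε, h2⟩ ⟨h3, δ, hδ, h4⟩
    refine ⟨fun l hl => by simp [h1 l hl, h3 l hl], min ε δ, lt_min hε hδ, fun l hl => ?_⟩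
    simp [h2 l (hl.mono (min_le_left _ _) subset_rfl), h4 l (hl.mono (min_le_right _ _) subset_rfl)]
  smul_mem' := by
    rintro a φ ⟨h1, ε, hε, h2⟩
    exact ⟨fun l hl => by simp [h1 l hl], ε, hε, fun l hl => by simp [h2 l hl]⟩

lemma negligible_anti {A B : Set E} (h : A ⊆ B) (p : ℕ) : negligible B p ≤ negligible A p := by
  rintro φ ⟨h1, ε, hε, h2⟩
  exact ⟨h1, ε, hε, fun l hl => h2 l (hl.mono le_rfl h)⟩

lemma negligible_zero (A : Set E) : negligible A 0 = ⊥ := by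
  rw [eq_bot_iff]
  rintro φ ⟨h1, ε, hε, h2⟩
  refine (Submodule.mem_bot _).2 (funext fun l => ?_)
  rcases l with _ | ⟨x, l⟩
  · exact h2 _ ⟨by simp, by simp⟩
  · exact h1 _ (by simp)

lemma cobd_mem {A : Set E} (p : ℕ) (φ : List E → ZMod 2) (hφ : φ ∈ negligible A p) :
    cobd E φ ∈ negligible A (p + 1) := by
  obtain ⟨h1, ε, hε, h2⟩ := hφ
  refine ⟨fun l hl => cobd_eq_zero _ _ fun l' h _ => h1 _ (by omega), ε, hε, fun l hl =>
    cobd_eq_zero _ _ fun l' _ h => h2 _ ⟨fun a ha => hl.1 a (h ha),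
      fun a ha b hb => hl.2 a (h ha) b (h hb)⟩⟩

lemma pull_mem_of_scale {A : Set E} {B : Set F} {f : E → F} (hf : MapsTo f A B) {p : ℕ}
    {φ : List F → ZMod 2} (h1 : ∀ l, l.length ≠ p → φ l = 0) {ε δ : ℝ} (hδ : 0 < δ)
    (h2 : ∀ l, Small ε B l → φ l = 0)
    (hff : ∀ x ∈ A, ∀ y ∈ A, dist x y < δ → dist (f x) (f y) < ε) :
    pull f φ ∈ negligible A p := by
  refine ⟨fun l hl => h1 _ (by simpa using hl), δ, hδ, fun l hl => h2 _ ⟨?_, ?_⟩⟩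
  · simp only [List.mem_map]
    rintro _ ⟨x, hx, rfl⟩
    exact hf (hl.1 x hx)
  · simp only [List.mem_map]
    rintro _ ⟨x, hx, rfl⟩ _ ⟨y, hy, rfl⟩
    exact hff x (hl.1 x hx) y (hl.1 y hy) (hl.2 x hx y hy)

lemma prism_mem_of_scale {A : Set E} {B : Set F} {f g : E → F} (hf : MapsTo f A B)
    (hg : MapsTo g A B) {p : ℕ} {φ : List F → ZMod 2} (h1 : ∀ l, l.length ≠ p + 1 → φ l = 0)
    {ε δ : ℝ} (hδ : 0 < δ) (h2 : ∀ l, Small ε B l → φ l = 0)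
    (hff : ∀ x ∈ A, ∀ y ∈ A, dist x y < δ → dist (f x) (f y) < ε)
    (hfg : ∀ x ∈ A, ∀ y ∈ A, dist x y < δ → dist (f x) (g y) < ε)
    (hgg : ∀ x ∈ A, ∀ y ∈ A, dist x y < δ → dist (g x) (g y) < ε) :
    prism f g φ ∈ negligible A p := by
  refine ⟨fun l hl => prism_eq_zero _ _ _ _ fun l' h _ => h1 _ (by omega), δ, hδ, fun l hl =>
    prism_eq_zero _ _ _ _ fun l' _ h => h2 _ ⟨fun a ha => ?_, fun a ha b hb => ?_⟩⟩
  · obtain ⟨x, hx, rfl | rfl⟩ := h a ha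
    · exact hf (hl.1 x hx)
    · exact hg (hl.1 x hx)
  · obtain ⟨x, hx, rfl | rfl⟩ := h a ha <;> obtain ⟨y, hy, rfl | rfl⟩ := h b hb
    · exact hff x (hl.1 x hx) y (hl.1 y hy) (hl.2 x hx y hy)
    · exact hfg x (hl.1 x hx) y (hl.1 y hy) (hl.2 x hx y hy)
    · rw [dist_comm]
      exact hfg y (hl.1 y hy) x (hl.1 x hx) (hl.2 y hy x hx)
    · exact hgg x (hl.1 x hx) y (hl.1 y hy) (hl.2 x hx y hy)

lemma pull_mem {A : Set E} {B : Set F} {f : E → F} (hf : MapsTo f A B)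
    (hu : UniformContinuousOn f A) {p : ℕ} {φ : List F → ZMod 2} (hφ : φ ∈ negligible B p) :
    pull f φ ∈ negligible A p := by
  obtain ⟨h1, ε, hε, h2⟩ := hφ
  obtain ⟨δ, hδ, h⟩ := Metric.uniformContinuousOn_iff.1 hu ε hε
  exact pull_mem_of_scale hf h1 hδ h2 h

/-! ### Homotopy invariance -/

/-- The maps `f, g : A → B` induce the same map on cohomology. -/
def Cohomologous (A : Set E) (B : Set F) (f g : E → F) : Prop :=
  ∀ p, ∀ z ∈ negligible B (p + 1), cobd F z = 0 →
    ∃ w ∈ negligible A p, cobd E w = pull f z + pull g z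

lemma Cohomologous.trans {A : Set E} {B : Set F} {f g h : E → F} (h1 : Cohomologous A B f g)
    (h2 : Cohomologous A B g h) : Cohomologous A B f h := by
  intro p z hz hdz
  obtain ⟨v, hv, hvz⟩ := h1 p z hz hdz
  obtain ⟨w, hw, hwz⟩ := h2 p z hz hdz
  refine ⟨v + w, add_mem hv hw, ?_⟩
  rw [map_add, hvz, hwz, add_add_add_cancel_middle]

lemma Cohomologous.of_eqOn {A : Set E} {B : Set F} {f g : E → F} (hf : MapsTo f A B)
    (hu : UniformContinuousOn f A) (h : EqOn f g A) : Cohomologous A B f g := by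
  rintro p z ⟨h1, ε, hε, h2⟩ hdz
  obtain ⟨δ, hδ, hfδ⟩ := Metric.uniformContinuousOn_iff.1 hu ε hε
  refine ⟨prism f g z, prism_mem_of_scale hf (hf.congr h) h1 hδ h2 hfδ ?_ ?_,
    cobd_prism_of_cocycle f g hdz⟩
  · intro x hx y hy hxy
    rw [← h hy]; exact hfδ x hx y hy hxy
  · intro x hx y hy hxy
    rw [← h hx, ← h hy]; exact hfδ x hx y hy hxy

lemma Cohomologous.of_homotopy {A : Set E} {B : Set F} (hA : IsCompact A) (H : E × ℝ → F)
    (hH : ContinuousOn H (A ×ˢ Icc 0 1)) (hm : MapsTo H (A ×ˢ Icc 0 1) B) :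
    Cohomologous A B (fun x => H (x, 0)) (fun x => H (x, 1)) := by
  rintro p z ⟨h1, ε, hε, h2⟩ hdz
  have hu := (hA.prod (isCompact_Icc (a := (0 : ℝ)) (b := 1))).uniformContinuousOn_of_continuous hH
  obtain ⟨δ, hδ, hHδ⟩ := Metric.uniformContinuousOn_iff.1 hu ε hε
  obtain ⟨n, hn⟩ := exists_nat_one_div_lt hδ
  have hn0 : (0 : ℝ) < n + 1 := by positivity
  have hmem : ∀ k : ℕ, k ≤ n + 1 → (k : ℝ) / (n + 1) ∈ Icc (0 : ℝ) 1 := fun k hk =>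
    ⟨by positivity, (div_le_one hn0).2 (by exact_mod_cast hk)⟩
  have key : ∀ k : ℕ, k ≤ n + 1 → ∃ w ∈ negligible A p,
      cobd E w = pull (fun x => H (x, 0)) z + pull (fun x => H (x, (k : ℝ) / (n + 1))) z := by
    intro k
    induction k with
    | zero =>
      intro _
      refine ⟨0, zero_mem _, ?_⟩
      simp [CharTwo.add_self_eq_zero]
    | succ k ih =>
      intro hk
      obtain ⟨w, hw, hwz⟩ := ih (by omega)
      have m0 := hmem k (by omega)
      have m1 := hmem (k + 1) hk
      have hstep : dist ((k : ℝ) / (n + 1)) (((k + 1 : ℕ) : ℝ) / (n + 1)) < δ := by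
        rw [dist_comm, Real.dist_eq, ← sub_div]
        push_cast
        rw [add_sub_cancel_left, abs_of_pos (by positivity)]
        exact hn
      refine ⟨w + prism (fun x => H (x, (k : ℝ) / (n + 1)))
        (fun x => H (x, ((k + 1 : ℕ) : ℝ) / (n + 1))) z, add_mem hw ?_, ?_⟩
      · refine prism_mem_of_scale (fun x hx => hm (mk_mem_prod hx m0))
          (fun x hx => hm (mk_mem_prod hx m1)) h1 hδ h2
          ?_ ?_ ?_
        · intro x hx y hy hxy
          refine hHδ _ ⟨hx, m0⟩ _ ⟨hy, m0⟩ ?_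
          rw [Prod.dist_eq]; simpa [hδ] using hxy
        · intro x hx y hy hxy
          refine hHδ _ ⟨hx, m0⟩ _ ⟨hy, m1⟩ ?_
          rw [Prod.dist_eq]; exact max_lt hxy hstep
        · intro x hx y hy hxy
          refine hHδ _ ⟨hx, m1⟩ _ ⟨hy, m1⟩ ?_
          rw [Prod.dist_eq]; simpa [hδ] using hxy
      · rw [map_add, cobd_prism_of_cocycle _ _ hdz, hwz, add_add_add_cancel_middle]
  obtain ⟨w, hw, hwz⟩ := key (n + 1) le_rfl
  refine ⟨w, hw, ?_⟩
  rw [hwz]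
  have : ((n + 1 : ℕ) : ℝ) / (n + 1) = 1 := by push_cast; exact div_self hn0.ne'
  rw [this]

/-- The reduced Alexander-Spanier cohomology of `A` with coefficients in `ℤ/2`.  The degree is
normalized such that `p` is the number of points of a simplex of dimension `p - 1`: the cohomology
of the empty set lives in degree `0`, that of an `n`-sphere in degree `n + 1`. -/
abbrev Cohom (A : Set E) (p : ℕ) : Type _ := Coh (cobd E) (negligible A) p

/-- The reduced Betti numbers (see `Cohom` for the normalization of the degree). -/
noncomputable def betti (A : Set E) (p : ℕ) : ℕ := Module.finrank (ZMod 2) (Cohom A p)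

lemma pull_mem_cocycles {A : Set E} {B : Set F} {f : E → F} (hf : MapsTo f A B)
    (hu : UniformContinuousOn f A) (p : ℕ) (z : List F → ZMod 2)
    (hz : z ∈ negligible B p ⊓ LinearMap.ker (cobd F)) :
    pull f z ∈ negligible A p ⊓ LinearMap.ker (cobd E) := by
  have h : cobd F z = 0 := hz.2
  refine ⟨pull_mem hf hu hz.1, ?_⟩
  change cobd E (pull f z) = 0
  rw [cobd_pull, h, map_zero]

lemma pull_mem_coboundaries {A : Set E} {B : Set F} {f : E → F} (hf : MapsTo f A B)
    (hu : UniformContinuousOn f A) (p : ℕ) (z : List F → ZMod 2)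
    (hz : z ∈ (negligible B p).map (cobd F)) : pull f z ∈ (negligible A p).map (cobd E) := by
  obtain ⟨w, hw, rfl⟩ := hz
  exact ⟨pull f w, pull_mem hf hu hw, cobd_pull _ _⟩

lemma nonempty_cohom_equiv {A : Set E} {B : Set F} (hA : IsCompact A) (hB : IsCompact B)
    {f : E → F} {g : F → E} (hf : ContinuousOn f A) (hg : ContinuousOn g B) (hfm : MapsTo f A B)
    (hgm : MapsTo g B A) (hgf : Cohomologous A A (g ∘ f) id) (hfg : Cohomologous B B (f ∘ g) id)
    (p : ℕ) : Nonempty (Cohom A p ≃ₗ[ZMod 2] Cohom B p) := by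
  have uf := hA.uniformContinuousOn_of_continuous hf
  have ug := hB.uniformContinuousOn_of_continuous hg
  refine nonempty_subquot_equiv (pull g) (pull_mem_cocycles hgm ug (p + 1))
    (pull_mem_coboundaries hgm ug p) (pull f) (pull_mem_cocycles hfm uf (p + 1))
    (pull_mem_coboundaries hfm uf p) ?_ ?_
  · intro z hz
    obtain ⟨w, hw, hwz⟩ := hgf p z hz.1 hz.2
    exact ⟨w, hw, by rw [hwz, pull_pull, pull_id, CharTwo.sub_eq_add]⟩
  · intro z hz
    obtain ⟨w, hw, hwz⟩ := hfg p z hz.1 hz.2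
    exact ⟨w, hw, by rw [hwz, pull_pull, pull_id, CharTwo.sub_eq_add]⟩

/-- Two maps that are joined by a homotopy are cohomologous; the homotopy needs to extend them on
`A` only. -/
lemma Cohomologous.of_homotopy_eqOn {A : Set E} {B : Set F} (hA : IsCompact A) (H : E × ℝ → F)
    (hH : ContinuousOn H (A ×ˢ Icc 0 1)) (hm : MapsTo H (A ×ˢ Icc 0 1) B) {f g : E → F}
    (hf : ∀ x ∈ A, H (x, 0) = f x) (hg : ∀ x ∈ A, H (x, 1) = g x) : Cohomologous A B f g := by
  have c : ∀ t ∈ Icc (0 : ℝ) 1, UniformContinuousOn (fun x => H (x, t)) A := fun t ht =>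
    hA.uniformContinuousOn_of_continuous
      (hH.comp (by fun_prop) fun x hx => ⟨hx, ht⟩)
  have i0 : (0 : ℝ) ∈ Icc (0 : ℝ) 1 := by simp
  have i1 : (1 : ℝ) ∈ Icc (0 : ℝ) 1 := by simp
  have mf : MapsTo f A B := fun x hx => hf x hx ▸ hm ⟨hx, i0⟩
  refine (Cohomologous.of_eqOn mf ((c 0 i0).congr hf) (fun x hx => (hf x hx).symm)).trans
    ((Cohomologous.of_homotopy hA H hH hm).trans
      (Cohomologous.of_eqOn (fun x hx => hm ⟨hx, i1⟩) (c 1 i1) hg))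

lemma subsingleton_cohom_of_contraction {A : Set E} (hA : IsCompact A) (H : E × ℝ → E)
    (hH : ContinuousOn H (A ×ˢ Icc 0 1)) (hm : MapsTo H (A ×ˢ Icc 0 1) A) (e : E) (he : e ∈ A)
    (h0 : ∀ x ∈ A, H (x, 0) = x) (h1 : ∀ x ∈ A, H (x, 1) = e) (p : ℕ) :
    Subsingleton (Cohom A p) := by
  have hc : Cohomologous A A id fun _ => e := Cohomologous.of_homotopy_eqOn hA H hH hm h0 h1
  refine subsingleton_of_forall_eq 0 fun z => ?_
  induction z using Submodule.Quotient.induction_on with | H z => ?_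
  obtain ⟨w, hw, hwz⟩ := hc p z.1 z.2.1 z.2.2
  refine (subquot_mk_eq_zero _).2 ⟨w, hw, ?_⟩
  rw [hwz, pull_id]
  -- the pullback to a point vanishes, since a constant list is small
  have : pull (fun _ : E => e) z.1 = 0 := by
    obtain ⟨_, ε, hε, h⟩ := z.2.1
    funext l
    refine h _ ⟨?_, ?_⟩ <;> simp only [List.mem_map]
    · rintro _ ⟨x, hx, rfl⟩; exact he
    · rintro _ ⟨x, hx, rfl⟩ _ ⟨y, hy, rfl⟩; simpa using hε
  rw [this, add_zero]

/-! ### The Mayer-Vietoris sequence -/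

lemma exists_scale_inter {A B : Set E} (hA : IsCompact A) (hB : IsCompact B) {η : ℝ} (hη : 0 < η) :
    ∃ δ > 0, ∀ a ∈ A, ∀ b ∈ B, dist a b < δ → ∃ c ∈ A ∩ B, dist a c < η := by
  set K : Set (E × E) := (A ×ˢ B) ∩ ⋂ c ∈ A ∩ B, {q | η ≤ dist q.1 c} with hK
  have hKc : IsCompact K := by
    refine (hA.prod hB).inter_right (isClosed_biInter fun c _ => ?_)
    exact isClosed_le continuous_const (by fun_prop)
  rcases K.eq_empty_or_nonempty with h0 | hne
  · refine ⟨1, one_pos, fun a ha b hb _ => ?_⟩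
    by_contra! h
    have : (a, b) ∈ K := ⟨⟨ha, hb⟩, by simpa using h⟩
    simp [h0] at this
  · obtain ⟨q, hq, hmin⟩ := hKc.exists_isMinOn hne (f := fun q : E × E => dist q.1 q.2)
      (by fun_prop)
    refine ⟨dist q.1 q.2, dist_pos.2 fun h => ?_, fun a ha b hb hab => ?_⟩
    · have h1 : q.1 ∈ A ∩ B := ⟨hq.1.1, h ▸ hq.1.2⟩
      have h2 := mem_iInter₂.1 hq.2 q.1 h1
      simp only [mem_ofPred_eq, dist_self] at h2
      linarith
    · by_contra! h
      have : (a, b) ∈ K := ⟨⟨ha, hb⟩, by simpa using h⟩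
      exact absurd (hmin this) (not_le.2 hab)

/-- A discontinuous retraction onto the intersection: it moves points by less than `ε`, preserves
`A` and `B`, and maps every small list in `A ∪ B` that is neither in `A` nor in `B` into
`A ∩ B`. -/
lemma exists_coarse_retraction {A B : Set E} (hA : IsCompact A) (hB : IsCompact B) {ε : ℝ}
    (hε : 0 < ε) : ∃ r : E → E, MapsTo r A A ∧ MapsTo r B B ∧ (∀ x, dist x (r x) < ε) ∧
      ∃ δ > 0, ∀ l, Small δ (A ∪ B) l → (∀ a ∈ l.map r, a ∈ A) ∨ ∀ a ∈ l.map r, a ∈ B := by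
  classical
  obtain ⟨δ₁, hδ₁, h1⟩ := exists_scale_inter hA hB hε
  obtain ⟨δ₂, hδ₂, h2⟩ := exists_scale_inter hB hA hε
  let r : E → E := fun x => if h : ∃ c ∈ A ∩ B, dist x c < ε then h.choose else x
  have hr : ∀ x, (∃ c ∈ A ∩ B, dist x c < ε) → r x ∈ A ∩ B := fun x h => by
    simp only [r, dif_pos h]; exact h.choose_spec.1
  have hr' : ∀ x, (¬ ∃ c ∈ A ∩ B, dist x c < ε) → r x = x := fun x h => by
    simp only [r, dif_neg h]
  have hrA : MapsTo r A A := fun x hx => by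
    by_cases h : ∃ c ∈ A ∩ B, dist x c < ε
    · exact (hr x h).1
    · rwa [hr' x h]
  have hrB : MapsTo r B B := fun x hx => by
    by_cases h : ∃ c ∈ A ∩ B, dist x c < ε
    · exact (hr x h).2
    · rwa [hr' x h]
  refine ⟨r, hrA, hrB, fun x => ?_, min δ₁ δ₂, lt_min hδ₁ hδ₂, fun l hl => ?_⟩
  · by_cases h : ∃ c ∈ A ∩ B, dist x c < ε
    · simp only [r, dif_pos h]; exact h.choose_spec.2
    · rw [hr' x h, dist_self]; exact hε
  · by_cases hlA : ∀ a ∈ l, a ∈ A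
    · left
      simp only [List.mem_map]
      rintro _ ⟨x, hx, rfl⟩; exact hrA (hlA x hx)
    by_cases hlB : ∀ a ∈ l, a ∈ B
    · right
      simp only [List.mem_map]
      rintro _ ⟨x, hx, rfl⟩; exact hrB (hlB x hx)
    left
    push Not at hlA hlB
    obtain ⟨b, hb, hbA⟩ := hlA
    obtain ⟨a, ha, haB⟩ := hlB
    have hb' : b ∈ B := (hl.1 b hb).resolve_left hbA
    have ha' : a ∈ A := (hl.1 a ha).resolve_right haB
    simp only [List.mem_map]
    rintro _ ⟨x, hx, rfl⟩
    refine (hr x ?_).1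
    rcases hl.1 x hx with hxA | hxB
    · exact h1 x hxA b hb' ((hl.2 x hx b hb).trans_le (min_le_left _ _))
    · obtain ⟨c, hc, h⟩ := h2 x hxB a ha' ((hl.2 x hx a ha).trans_le (min_le_right _ _))
      exact ⟨c, ⟨hc.2, hc.1⟩, h⟩

/-- For compact sets, the cochains that are negligible on `A` and on `B` have the same cohomology as
those that are negligible on `A ∪ B`. -/
lemma nonempty_union_equiv {A B : Set E} (hA : IsCompact A) (hB : IsCompact B) (p : ℕ) :
    Nonempty (Cohom (A ∪ B) p ≃ₗ[ZMod 2]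
      Coh (cobd E) (fun p => negligible A p ⊓ negligible B p) p) := by
  have hle : ∀ p, negligible (A ∪ B) p ≤ negligible A p ⊓ negligible B p := fun p =>
    le_inf (negligible_anti subset_union_left p) (negligible_anti subset_union_right p)
  -- the chain homotopy for a coarse retraction at a given scale
  have key : ∀ ε : ℝ, 0 < ε → ∃ r : E → E,
      (∀ q (φ : List E → ZMod 2), (∀ l, l.length ≠ q → φ l = 0) →
        (∀ l, Small ε A l → φ l = 0) → (∀ l, Small ε B l → φ l = 0) →
        pull r φ ∈ negligible (A ∪ B) q) ∧
      (∀ q (φ : List E → ZMod 2) (C : Set E), C = A ∨ C = B ∨ C = A ∪ B →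
        (∀ l, l.length ≠ q + 1 → φ l = 0) →
        (∀ l, Small ε C l → φ l = 0) → prism r id φ ∈ negligible C q) := by
    intro ε hε
    obtain ⟨r, hrA, hrB, hr, δ, hδ, h⟩ := exists_coarse_retraction hA hB (ε := ε / 3) (by linarith)
    have d1 : ∀ x y, dist x y < ε / 3 → dist (r x) (r y) < ε := fun x y hxy => by
      have := dist_triangle4 (r x) x y (r y)
      have h1 := hr x
      have h2 := hr y
      rw [dist_comm] at h1
      linarith
    have d2 : ∀ x y, dist x y < ε / 3 → dist (r x) y < ε := fun x y hxy => by
      have := dist_triangle (r x) x y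
      have h1 := hr x
      rw [dist_comm] at h1
      linarith
    refine ⟨r, fun q φ h1 h2 h3 => ⟨fun l hl => h1 _ (by simpa using hl), min δ (ε / 3),
      lt_min hδ (by linarith), fun l hl => ?_⟩, ?_⟩
    · have hs : ∀ a ∈ l.map r, ∀ b ∈ l.map r, dist a b < ε := by
        simp only [List.mem_map]
        rintro _ ⟨x, hx, rfl⟩ _ ⟨y, hy, rfl⟩
        exact d1 x y ((hl.2 x hx y hy).trans_le (min_le_right _ _))
      rcases h l (hl.mono (min_le_left _ _) subset_rfl) with h | h
      · exact h2 _ ⟨h, hs⟩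
      · exact h3 _ ⟨h, hs⟩
    · intro q φ C hC h1 h2
      have hrC : MapsTo r C C := by
        rcases hC with rfl | rfl | rfl
        exacts [hrA, hrB, hrA.union_union hrB]
      exact prism_mem_of_scale hrC (mapsTo_id _) h1 (δ := ε / 3) (by linarith) h2
        (fun x _ y _ => d1 x y) (fun x _ y _ => d2 x y)
        (fun x _ y _ hxy => by simp only [id]; linarith)
  refine ⟨LinearEquiv.ofBijective (inclMap (cobd E) hle p) ⟨?_, ?_⟩⟩
  · rw [← LinearMap.ker_eq_bot, LinearMap.ker_eq_bot']
    intro z hz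
    induction z using Submodule.Quotient.induction_on with | H z => ?_
    obtain ⟨w, ⟨hwA, hwB⟩, hwz⟩ := (subquot_mk_eq_zero _).1 hz
    have hwz : cobd E w = z.1 := hwz
    obtain ⟨w1, ε₁, hε₁, w2⟩ := hwA
    obtain ⟨-, ε₂, hε₂, w3⟩ := hwB
    obtain ⟨z1, ε₃, hε₃, z2⟩ := z.2.1
    obtain ⟨r, k1, k2⟩ := key (min ε₁ (min ε₂ ε₃)) (lt_min hε₁ (lt_min hε₂ hε₃))
    refine (subquot_mk_eq_zero _).2 ⟨pull r w + prism r id z.1, add_mem (k1 _ _ w1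
      (fun l hl => w2 l (hl.mono (min_le_left _ _) subset_rfl))
      (fun l hl => w3 l (hl.mono ((min_le_right _ _).trans (min_le_left _ _)) subset_rfl)))
      (k2 _ _ _ (Or.inr (Or.inr rfl)) z1
      (fun l hl => z2 l (hl.mono ((min_le_right _ _).trans (min_le_right _ _)) subset_rfl))), ?_⟩
    rw [map_add, cobd_pull, hwz, cobd_prism_of_cocycle _ _ z.2.2, ← add_assoc,
      CharTwo.add_self_eq_zero, zero_add, pull_id]
  · intro z
    induction z using Submodule.Quotient.induction_on with | H z => ?_
    obtain ⟨z1, ε₁, hε₁, z2⟩ := z.2.1.1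
    obtain ⟨-, ε₂, hε₂, z3⟩ := z.2.1.2
    obtain ⟨r, k1, k2⟩ := key (min ε₁ ε₂) (lt_min hε₁ hε₂)
    have z2' : ∀ l, Small (min ε₁ ε₂) A l → z.1 l = 0 := fun l hl =>
      z2 l (hl.mono (min_le_left _ _) subset_rfl)
    have z3' : ∀ l, Small (min ε₁ ε₂) B l → z.1 l = 0 := fun l hl =>
      z3 l (hl.mono (min_le_right _ _) subset_rfl)
    have hd : cobd E z.1 = 0 := z.2.2
    refine ⟨Submodule.Quotient.mk ⟨pull r z.1, k1 _ _ z1 z2' z3', by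
      change cobd E (pull r z.1) = 0
      rw [cobd_pull, hd, map_zero]⟩, ?_⟩
    refine (subquot_mk_eq _ _).2 ⟨prism r id z.1, ⟨k2 _ _ _ (Or.inl rfl) z1 z2',
      k2 _ _ _ (Or.inr (Or.inl rfl)) z1 z3'⟩, ?_⟩
    rw [cobd_prism_of_cocycle _ _ hd, pull_id, CharTwo.sub_eq_add]
    rfl

/-- The numerical content of the Mayer-Vietoris sequence of two compact sets: `r p` is the rank of
the connecting map from the cohomology of `A ∩ B` in degree `p` to that of `A ∪ B`. -/
theorem mayerVietoris {A B : Set E} (hA : IsCompact A) (hB : IsCompact B)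
    (fA : ∀ p, FiniteDimensional (ZMod 2) (Cohom A p))
    (fB : ∀ p, FiniteDimensional (ZMod 2) (Cohom B p))
    (fI : ∀ p, FiniteDimensional (ZMod 2) (Cohom (A ∩ B) p)) :
    (∀ p, FiniteDimensional (ZMod 2) (Cohom (A ∪ B) p)) ∧ ∃ r : ℕ → ℕ,
      (∀ p, r p ≤ betti (A ∩ B) p) ∧ (∀ p, betti (A ∩ B) p ≤ r p + (betti A p + betti B p)) ∧
      (betti A 0 + betti B 0 + r 0 = betti (A ∩ B) 0 + betti (A ∪ B) 0) ∧
      ∀ p, betti A (p + 1) + betti B (p + 1) + r (p + 1) + r p =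
        betti (A ∩ B) (p + 1) + betti (A ∪ B) (p + 1) := by
  classical
  -- the part of a cochain that lives on the lists outside `A`
  let c : (List E → ZMod 2) →ₗ[ZMod 2] (List E → ZMod 2) :=
    { toFun := fun φ l => if ∀ a ∈ l, a ∈ A then 0 else φ l
      map_add' := fun φ ψ => by funext l; dsimp only [Pi.add_apply]; split_ifs <;> simp
      map_smul' := fun a φ => by funext l; by_cases h : ∀ a ∈ l, a ∈ A <;> simp [h] }
  have c1 : ∀ φ l, (∀ a ∈ l, a ∈ A) → c φ l = 0 := fun φ l h => if_pos h
  have c2 : ∀ φ l, (¬ ∀ a ∈ l, a ∈ A) → c φ l = φ l := fun φ l h => if_neg h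
  obtain ⟨h1, r, h2, h2', h3, h4⟩ := mayerVietoris_finrank (d := cobd E) (S := negligible A)
    (T := negligible B) cobd_cobd cobd_mem cobd_mem (negligible_zero A)
    (fun p => negligible A p ⊓ negligible B p) (negligible (A ∩ B)) (fun _ => rfl)
    (fun p => negligible_anti inter_subset_left p) (fun p => negligible_anti inter_subset_right p) c
    (by
      rintro p φ ⟨h1, -⟩
      refine ⟨fun l hl => ?_, 1, one_pos, fun l hl => c1 _ _ hl.1⟩
      by_cases h : ∀ a ∈ l, a ∈ A
      · exact c1 _ _ h
      · rw [c2 _ _ h, h1 l hl])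
    (by
      rintro p φ ⟨h1, ε, hε, h2⟩
      refine ⟨fun l hl => ?_, ε, hε, fun l hl => ?_⟩ <;> rw [Pi.sub_apply] <;>
        by_cases h : ∀ a ∈ l, a ∈ A
      · rw [c1 _ _ h, h1 l hl, sub_zero]
      · rw [c2 _ _ h, sub_self]
      · rw [c1 _ _ h, sub_zero]
        exact h2 l ⟨fun a ha => ⟨h a ha, hl.1 a ha⟩, hl.2⟩
      · rw [c2 _ _ h, sub_self])
    fA fB fI
  have e : ∀ p, betti (A ∪ B) p =
      Module.finrank (ZMod 2) (Coh (cobd E) (fun p => negligible A p ⊓ negligible B p) p) :=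
    fun p => (nonempty_union_equiv hA hB p).some.finrank_eq
  refine ⟨fun p => ?_, r, h2, h2', ?_, fun p => ?_⟩
  · have := h1 p
    exact Module.Finite.equiv (nonempty_union_equiv hA hB p).some.symm
  · rw [e]; exact h3
  · rw [e]; exact h4 p

/-! ### The Euler characteristic -/

/-- `A` has finite-dimensional cohomology, and the alternating sum of its reduced Betti numbers
is `e`. -/
structure HasEuler (A : Set E) (e : ℤ) : Prop where
  finite : ∀ p, FiniteDimensional (ZMod 2) (Cohom A p)
  sum : ∃ n, ∀ m, n ≤ m → betti A m = 0 ∧ ∑ p ∈ Finset.range m, (-1 : ℤ) ^ p * betti A p = e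

lemma HasEuler.unique {A : Set E} {B : Set F} {a b : ℤ} (ha : HasEuler A a) (hb : HasEuler B b)
    (h : ∀ p, betti A p = betti B p) : a = b := by
  obtain ⟨n, hn⟩ := ha.sum
  obtain ⟨m, hm⟩ := hb.sum
  rw [← (hn (max n m) (le_max_left _ _)).2, ← (hm (max n m) (le_max_right _ _)).2]
  exact Finset.sum_congr rfl fun p _ => by rw [h]

lemma hasEuler_of_betti {A : Set E} (fA : ∀ p, FiniteDimensional (ZMod 2) (Cohom A p)) (n : ℕ)
    (h : ∀ p, betti A p = if p = n then 1 else 0) : HasEuler A ((-1) ^ n) := by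
  refine ⟨fA, n + 1, fun m hm => ⟨by rw [h, if_neg (by omega)], ?_⟩⟩
  rw [Finset.sum_eq_single n]
  · simp [h]
  · intro p _ hp; simp [h, hp]
  · intro hn; exact absurd (Finset.mem_range.2 (by omega)) hn

lemma hasEuler_of_acyclic {A : Set E} (h : ∀ p, Subsingleton (Cohom A p)) : HasEuler A 0 := by
  have hb : ∀ p, betti A p = 0 := fun p => Module.finrank_zero_of_subsingleton
  exact ⟨fun p => inferInstance, 0, fun m _ => ⟨hb m, by simp [hb]⟩⟩

theorem HasEuler.union {A B : Set E} (hA : IsCompact A) (hB : IsCompact B) {a b c : ℤ}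
    (ha : HasEuler A a) (hb : HasEuler B b) (hc : HasEuler (A ∩ B) c) :
    HasEuler (A ∪ B) (a + b - c) := by
  obtain ⟨hf, r, h1, -, h2, h3⟩ := mayerVietoris hA hB ha.finite hb.finite hc.finite
  obtain ⟨n₁, hn₁⟩ := ha.sum
  obtain ⟨n₂, hn₂⟩ := hb.sum
  obtain ⟨n₃, hn₃⟩ := hc.sum
  have tel : ∀ m, ∑ p ∈ Finset.range (m + 1), (-1 : ℤ) ^ p * betti (A ∪ B) p =
      ∑ p ∈ Finset.range (m + 1), (-1 : ℤ) ^ p * betti A p +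
      ∑ p ∈ Finset.range (m + 1), (-1 : ℤ) ^ p * betti B p -
      ∑ p ∈ Finset.range (m + 1), (-1 : ℤ) ^ p * betti (A ∩ B) p + (-1) ^ m * r m := by
    intro m
    induction m with
    | zero => simp; omega
    | succ m ih =>
      rw [Finset.sum_range_succ _ (m + 1), Finset.sum_range_succ _ (m + 1),
        Finset.sum_range_succ _ (m + 1), Finset.sum_range_succ _ (m + 1), ih]
      have := h3 m
      zify at this
      rw [pow_succ]
      linear_combination (-1) ^ m * this
  refine ⟨hf, max n₁ (max n₂ n₃) + 1, fun m hm => ?_⟩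
  obtain ⟨m, rfl⟩ : ∃ k, m = k + 1 := ⟨m - 1, by omega⟩
  have r0 : ∀ k, n₃ ≤ k → r k = 0 := fun k hk => by
    have := h1 k
    rw [(hn₃ k hk).1] at this
    omega
  constructor
  · have := h3 m
    rw [(hn₁ (m + 1) (by omega)).1, (hn₂ (m + 1) (by omega)).1, r0 _ (by omega),
      r0 _ (by omega)] at this
    omega
  · rw [tel, (hn₁ (m + 1) (by omega)).2, (hn₂ (m + 1) (by omega)).2,
      (hn₃ (m + 1) (by omega)).2, r0 _ (by omega)]
    simp

/-- The empty set has one-dimensional reduced cohomology, in the lowest degree. -/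
lemma cohom_empty [Nonempty E] (p : ℕ) : FiniteDimensional (ZMod 2) (Cohom (∅ : Set E) p) ∧
    betti (∅ : Set E) p = if p = 0 then 1 else 0 := by
  classical
  obtain ⟨e⟩ := ‹Nonempty E›
  have hcone : ∀ z : List E → ZMod 2, cobd E z = 0 → cobd E (fun l => z (e :: l)) = z := by
    intro z hz
    funext l
    have := congrFun hz (e :: l)
    rw [cobd_cons, Pi.zero_apply, CharTwo.add_eq_zero] at this
    exact this.symm
  rcases p with _ | p
  · let u : List E → ZMod 2 := fun l => if l = [] then 1 else 0
    have hu : cobd E u [e] = 1 := by simp [cobd_cons, cobd_nil, u]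
    have hv : cobd E u ∈ negligible (∅ : Set E) 1 ⊓ LinearMap.ker (cobd E) := by
      refine ⟨⟨fun l hl => cobd_eq_zero _ _ fun l' h1 _ => ?_, 1, one_pos, fun l hl => ?_⟩,
        cobd_cobd _⟩
      · exact if_neg (by rintro rfl; exact hl (by simpa using h1.symm))
      · rcases l with _ | ⟨x, l⟩
        · rfl
        · exact absurd (hl.1 x (by simp)) (by simp)
    have h1 : Module.finrank (ZMod 2) (Cohom (∅ : Set E) 0) = 1 := by
      refine (finrank_eq_one_iff_of_nonzero' (Submodule.Quotient.mk ⟨cobd E u, hv⟩) ?_).2 ?_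
      · intro h
        obtain ⟨w, hw, hwu⟩ := (subquot_mk_eq_zero _).1 h
        have hw : w ∈ negligible (∅ : Set E) 0 := hw
        rw [negligible_zero, Submodule.mem_bot] at hw
        rw [hw, map_zero] at hwu
        have := congrFun hwu [e]
        change 0 = cobd E u [e] at this
        rw [hu] at this
        exact zero_ne_one this
      · intro z
        induction z using Submodule.Quotient.induction_on with | H z => ?_
        refine ⟨z.1 [e], ?_⟩
        rw [← Submodule.Quotient.mk_smul]
        congr 1
        ext1
        change z.1 [e] • cobd E u = z.1
        rw [← map_smul]
        conv_rhs => rw [← hcone z.1 z.2.2]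
        congr 1
        funext l
        by_cases hl : l = []
        · simp [u, hl]
        · simp only [u, Pi.smul_apply, if_neg hl, smul_zero]
          exact (z.2.1.1 _ (by simpa using hl)).symm
    exact ⟨Module.finite_of_finrank_eq_succ h1, by rw [if_pos rfl]; exact h1⟩
  · have : Subsingleton (Cohom (∅ : Set E) (p + 1)) := by
      refine subsingleton_of_forall_eq 0 fun z => ?_
      induction z using Submodule.Quotient.induction_on with | H z => ?_
      refine (subquot_mk_eq_zero _).2 ⟨fun l => z.1 (e :: l), ⟨fun l hl => z.2.1.1 _ (by simpa),
        1, one_pos, fun l hl => ?_⟩, hcone _ z.2.2⟩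
      rcases l with _ | ⟨x, l⟩
      · exact z.2.1.1 _ (by simp)
      · exact absurd (hl.1 x (by simp)) (by simp)
    exact ⟨inferInstance, by rw [if_neg (by omega)]; exact Module.finrank_zero_of_subsingleton⟩

end Metric

end AlexanderSpanier

namespace AlexanderSpanier

open SubquotientCohomology Set Filter Topology

/-! ### The cohomology of spheres -/

lemma subsingleton_cohom_of_starConvex {V : Type*} [NormedAddCommGroup V] [NormedSpace ℝ V]
    {A : Set V} (hA : IsCompact A) {e : V} (he : e ∈ A) (hs : StarConvex ℝ e A) (p : ℕ) :
    Subsingleton (Cohom A p) := by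
  refine subsingleton_cohom_of_contraction hA (fun q => q.2 • e + (1 - q.2) • q.1)
    (by fun_prop) ?_ e he (fun x _ => by simp) (fun x _ => by simp) p
  rintro ⟨x, u⟩ ⟨hx, hu⟩
  exact hs hx hu.1 (by linarith [hu.2]) (by ring)

lemma isClosed_forall_eq_zero {ι : Type*} (s : Set ι) : IsClosed {t : ι → ℝ | ∀ i ∈ s, t i = 0} := by
  simp only [ofPred_forall]
  exact isClosed_biInter fun i _ => isClosed_eq (continuous_apply i) continuous_const

lemma isClosed_exists_eq_zero {ι : Type*} (s : Finset ι) : IsClosed {t : ι → ℝ | ∃ i ∈ s, t i = 0} := by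
  have : {t : ι → ℝ | ∃ i ∈ s, t i = 0} = ⋃ i ∈ s, {t : ι → ℝ | t i = 0} := by ext; simp
  rw [this]
  exact isClosed_biUnion_finset fun i _ => isClosed_eq (continuous_apply i) continuous_const

section Sphere

variable {ι : Type*} [Fintype ι]

/-- The boundary of the face of the standard simplex that is spanned by the vertices in `s`. -/
def simplexBoundary (s : Finset ι) : Set (ι → ℝ) :=
  {t | t ∈ stdSimplex ℝ ι ∧ (∀ i ∉ s, t i = 0) ∧ ∃ i ∈ s, t i = 0}

lemma isCompact_simplexBoundary (s : Finset ι) : IsCompact (simplexBoundary s) :=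
  (isCompact_stdSimplex ℝ ι).inter_right
    ((isClosed_forall_eq_zero {i | i ∉ s}).inter (isClosed_exists_eq_zero s))

/-- The boundary of a simplex with `n` vertices is a sphere of dimension `n - 2`.  It is the union of
a facet and of the cone, with apex the opposite vertex, over the boundary of this facet. -/
theorem betti_simplexBoundary (s : Finset ι) (hs : s.Nonempty) :
    (∀ p, FiniteDimensional (ZMod 2) (Cohom (simplexBoundary s) p)) ∧
      ∀ p, betti (simplexBoundary s) p = if p + 1 = s.card then 1 else 0 := by
  classical
  induction hs using Finset.Nonempty.cons_induction with
  | singleton a =>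
    have h0 : simplexBoundary ({a} : Finset ι) = ∅ := by
      rw [eq_empty_iff_forall_notMem]
      rintro t ⟨⟨-, h1⟩, h2, i, hi, h3⟩
      rw [Finset.mem_singleton] at hi
      subst hi
      rw [Finset.sum_eq_zero] at h1
      · exact zero_ne_one h1
      · intro j _
        by_cases hj : j = i
        · rw [hj, h3]
        · exact h2 j (by simpa using hj)
    rw [h0]
    exact ⟨fun p => (cohom_empty p).1, fun p => by rw [(cohom_empty p).2]; simp⟩
  | cons a s ha hs ih =>
    set A : Set (ι → ℝ) := {t | t ∈ stdSimplex ℝ ι ∧ ∀ i ∈ {i | i ∉ s}, t i = 0} with hA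
    set B : Set (ι → ℝ) := {t | t ∈ stdSimplex ℝ ι ∧
      (∀ i ∈ {i | i ∉ Finset.cons a s ha}, t i = 0) ∧ ∃ i ∈ s, t i = 0} with hB
    have cA : IsCompact A := (isCompact_stdSimplex ℝ ι).inter_right (isClosed_forall_eq_zero _)
    have cB : IsCompact B := (isCompact_stdSimplex ℝ ι).inter_right
      ((isClosed_forall_eq_zero _).inter (isClosed_exists_eq_zero s))
    have hU : A ∪ B = simplexBoundary (Finset.cons a s ha) := by
      ext t
      simp only [simplexBoundary, hA, hB, mem_union, mem_ofPred_eq, Finset.mem_cons, not_or]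
      constructor
      · rintro (⟨h1, h2⟩ | ⟨h1, h2, i, hi, h3⟩)
        · exact ⟨h1, fun i hi => h2 i hi.2, a, Or.inl rfl, h2 a ha⟩
        · exact ⟨h1, h2, i, Or.inr hi, h3⟩
      · rintro ⟨h1, h2, i, rfl | hi, h3⟩
        · refine Or.inl ⟨h1, fun j hj => ?_⟩
          by_cases hji : j = i
          · rw [hji, h3]
          · exact h2 j ⟨hji, hj⟩
        · exact Or.inr ⟨h1, h2, i, hi, h3⟩
    have hI : A ∩ B = simplexBoundary s := by
      ext t
      simp only [simplexBoundary, hA, hB, mem_inter_iff, mem_ofPred_eq, Finset.mem_cons, not_or]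
      constructor
      · rintro ⟨⟨h1, h2⟩, -, -, h3⟩
        exact ⟨h1, h2, h3⟩
      · rintro ⟨h1, h2, h3⟩
        exact ⟨⟨h1, h2⟩, h1, fun i hi => h2 i hi.2, h3⟩
    obtain ⟨b, hb⟩ := hs
    have hab : a ≠ b := fun h => ha (h ▸ hb)
    have sA : ∀ p, Subsingleton (Cohom A p) := by
      have h1 : ∀ i, i ∉ s → (Pi.single b 1 : ι → ℝ) i = 0 := fun i hi =>
        Pi.single_eq_of_ne (fun h : i = b => hi (h.symm ▸ hb)) 1
      refine subsingleton_cohom_of_starConvex cA (e := Pi.single b 1)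
        ⟨single_mem_stdSimplex ℝ b, fun i hi => h1 i hi⟩ ?_
      intro t ht x y hx hy hxy
      refine ⟨convex_stdSimplex ℝ ι (single_mem_stdSimplex ℝ b) ht.1 hx hy hxy, fun i hi => ?_⟩
      simp [h1 i hi, ht.2 i hi]
    have sB : ∀ p, Subsingleton (Cohom B p) := by
      have h1 : ∀ i, i ≠ a → (Pi.single a 1 : ι → ℝ) i = 0 := fun i hi => Pi.single_eq_of_ne hi 1
      have h2 : ∀ i, i ∉ Finset.cons a s ha → i ≠ a := fun i hi h => hi (by simp [h])
      have h3 : ∀ i ∈ s, i ≠ a := fun i hi h => ha (h ▸ hi)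
      refine subsingleton_cohom_of_starConvex cB (e := Pi.single a 1)
        ⟨single_mem_stdSimplex ℝ a, fun i hi => h1 i (h2 i hi), b, hb, h1 b hab.symm⟩ ?_
      rintro t ⟨ht1, ht2, j, hj, htj⟩ x y hx hy hxy
      refine ⟨convex_stdSimplex ℝ ι (single_mem_stdSimplex ℝ a) ht1 hx hy hxy, fun i hi => ?_,
        j, hj, ?_⟩
      · simp [h1 i (h2 i hi), ht2 i hi]
      · simp [h1 j (h3 j hj), htj]
    rw [← hI] at ih
    obtain ⟨hf, r, r1, r2, r3, r4⟩ := mayerVietoris cA cB (fun p => inferInstance)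
      (fun p => inferInstance) ih.1
    have bA : ∀ p, betti A p = 0 := fun p => Module.finrank_zero_of_subsingleton
    have bB : ∀ p, betti B p = 0 := fun p => Module.finrank_zero_of_subsingleton
    have hr : ∀ p, r p = betti (A ∩ B) p := fun p => by
      have := r1 p
      have := r2 p
      rw [bA, bB] at this
      omega
    rw [hU] at hf r3 r4
    refine ⟨hf, fun p => ?_⟩
    rw [Finset.card_cons]
    have hc : 0 < s.card := Finset.card_pos.2 ⟨b, hb⟩
    rcases p with _ | p
    · rw [bA, bB, hr] at r3
      rw [if_neg (by omega)]
      omega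
    · have := r4 p
      rw [bA, bB, hr, hr] at this
      have h5 := ih.2 p
      simp only [add_left_inj] at h5 ⊢
      omega

end Sphere

/-! ### Cone neighbourhoods -/

/-- A conical neighbourhood `W` of a point `x`: a "norm" `N : W → [0, 1)` that vanishes at `x` only,
and a rescaling `y ↦ scale y s` for `0 < s < 1 / N y` that multiplies the norm by `s`. -/
structure ConeNhd (X : Type*) [MetricSpace X] (x : X) where
  W : Set X
  N : X → ℝ
  scale : X → ℝ → X
  isOpen_W : IsOpen W
  mem_W : x ∈ W
  N_center : N x = 0
  N_nonneg : ∀ y ∈ W, 0 ≤ N y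
  N_lt_one : ∀ y ∈ W, N y < 1
  eq_center : ∀ y ∈ W, N y = 0 → y = x
  continuousOn_N : ContinuousOn N W
  scale_mem : ∀ y ∈ W, ∀ s, 0 < s → s * N y < 1 → scale y s ∈ W
  N_scale : ∀ y ∈ W, ∀ s, 0 < s → s * N y < 1 → N (scale y s) = s * N y
  scale_one : ∀ y ∈ W, scale y 1 = y
  scale_scale : ∀ y ∈ W, ∀ s s', 0 < s → 0 < s' → s * N y < 1 → s' * (s * N y) < 1 →
    scale (scale y s) s' = scale y (s' * s)
  continuousOn_scale : ContinuousOn (fun q : X × ℝ => scale q.1 q.2)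
    {q | q.1 ∈ W ∧ 0 < q.2 ∧ q.2 * N q.1 < 1}
  isCompact_half : IsCompact {y | y ∈ W ∧ N y ≤ 1 / 2}

namespace ConeNhd

variable {X Y : Type*} [MetricSpace X] [MetricSpace Y] {x : X} {y : Y}

/-- The link of a conical neighbourhood: the points of norm `1 / 2`. -/
def link (C : ConeNhd X x) : Set X := {y | y ∈ C.W ∧ C.N y = 1 / 2}

lemma isCompact_link (C : ConeNhd X x) : IsCompact C.link := by
  have h1 : {y | y ∈ C.W ∧ C.N y ≤ 1 / 2} ∩ C.N ⁻¹' {1 / 2} = C.link := by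
    ext z
    simp only [link, mem_inter_iff, mem_ofPred_eq, mem_preimage, mem_singleton_iff]
    exact ⟨fun h => ⟨h.1.1, h.2⟩, fun h => ⟨⟨h.1, h.2.le⟩, h.2⟩⟩
  rw [← h1]
  refine C.isCompact_half.of_isClosed_subset ?_ inter_subset_left
  exact (C.continuousOn_N.mono fun z hz => hz.1).preimage_isClosed_of_isClosed
    C.isCompact_half.isClosed isClosed_singleton

/-- The points of small norm form a neighbourhood basis. -/
lemma exists_radius (C : ConeNhd X x) {U : Set X} (hU : U ∈ 𝓝 x) :
    ∃ ε, 0 < ε ∧ ε < 1 ∧ ∀ z ∈ C.W, C.N z < ε → z ∈ U := by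
  obtain ⟨O, hOU, hO, hxO⟩ := mem_nhds_iff.1 hU
  have hK : IsCompact ({y | y ∈ C.W ∧ C.N y ≤ 1 / 2} \ O) := C.isCompact_half.diff hO
  rcases ({y | y ∈ C.W ∧ C.N y ≤ 1 / 2} \ O).eq_empty_or_nonempty with h0 | hne
  · refine ⟨1 / 2, by norm_num, by norm_num, fun z hz hN => ?_⟩
    by_contra h
    have : z ∈ {y | y ∈ C.W ∧ C.N y ≤ 1 / 2} \ O := ⟨⟨hz, hN.le⟩, fun h' => h (hOU h')⟩
    rw [h0] at this
    exact this
  · obtain ⟨q, hq, hmin⟩ := hK.exists_isMinOn hne (C.continuousOn_N.mono fun z hz => hz.1.1)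
    have hq0 : 0 < C.N q := (C.N_nonneg q hq.1.1).lt_of_ne fun h =>
      hq.2 (C.eq_center q hq.1.1 h.symm ▸ hxO)
    refine ⟨min (1 / 2) (C.N q), lt_min (by norm_num) hq0,
      (min_le_left _ _).trans_lt (by norm_num), fun z hz hN => ?_⟩
    by_contra h
    have : z ∈ {y | y ∈ C.W ∧ C.N y ≤ 1 / 2} \ O :=
      ⟨⟨hz, hN.le.trans (min_le_left _ _)⟩, fun h' => h (hOU h')⟩
    exact absurd (hmin this) (not_le.2 (hN.trans_le (min_le_right _ _)))

lemma setOf_N_lt_mem_nhds (C : ConeNhd X x) {ε : ℝ} (hε : 0 < ε) :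
    {z | z ∈ C.W ∧ C.N z < ε} ∈ 𝓝 x := by
  have hc : ContinuousAt C.N x := C.continuousOn_N.continuousAt (C.isOpen_W.mem_nhds C.mem_W)
  refine inter_mem (C.isOpen_W.mem_nhds C.mem_W)
    (hc.preimage_mem_nhds (t := Iio ε) ?_)
  rw [C.N_center]
  exact Iio_mem_nhds hε

/-- The radial projection of the punctured neighbourhood to the link. -/
noncomputable def proj (C : ConeNhd X x) (z : X) : X := C.scale z (1 / (2 * C.N z))

lemma N_pos (C : ConeNhd X x) {z : X} (hz : z ∈ C.W) (h : z ≠ x) : 0 < C.N z :=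
  (C.N_nonneg z hz).lt_of_ne fun h' => h (C.eq_center z hz h'.symm)

lemma proj_mem (C : ConeNhd X x) {z : X} (hz : z ∈ C.W) (h : z ≠ x) : C.proj z ∈ C.link := by
  have h0 := C.N_pos hz h
  have e : 1 / (2 * C.N z) * C.N z = 1 / 2 := by field_simp
  have h1 : 1 / (2 * C.N z) * C.N z < 1 := by rw [e]; norm_num
  exact ⟨C.scale_mem z hz _ (by positivity) h1, by
    rw [proj, C.N_scale z hz _ (by positivity) h1, e]⟩

lemma continuousOn_proj (C : ConeNhd X x) : ContinuousOn C.proj (C.W \ {x}) := by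
  have hN : ∀ z ∈ C.W \ {x}, 2 * C.N z ≠ 0 := fun z hz => by
    have := C.N_pos hz.1 hz.2
    positivity
  have h : ContinuousOn (fun z => (z, 1 / (2 * C.N z))) (C.W \ {x}) := continuousOn_id.prodMk
    (continuousOn_const.div (continuousOn_const.mul (C.continuousOn_N.mono sdiff_subset)) hN)
  refine C.continuousOn_scale.comp h ?_
  intro z hz
  have h0 := C.N_pos hz.1 hz.2
  refine ⟨hz.1, by simp only; positivity, ?_⟩
  have e : 1 / (2 * C.N z) * C.N z = 1 / 2 := by field_simp
  simp only
  rw [e]; norm_num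

lemma proj_scale (C : ConeNhd X x) {z : X} (hz : z ∈ C.W) (h : z ≠ x) {s : ℝ} (hs : 0 < s)
    (hs1 : s * C.N z < 1) : C.proj (C.scale z s) = C.proj z := by
  have h0 := C.N_pos hz h
  rw [proj, C.N_scale z hz s hs hs1, C.scale_scale z hz s _ hs (by positivity) hs1]
  · rw [proj]; congr 1; field_simp
  · have e : 1 / (2 * (s * C.N z)) * (s * C.N z) = 1 / 2 := by field_simp
    rw [e]; norm_num

lemma proj_of_mem_link (C : ConeNhd X x) {z : X} (hz : z ∈ C.link) : C.proj z = z := by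
  rw [proj, hz.2, show (1 : ℝ) / (2 * (1 / 2)) = 1 by norm_num, C.scale_one z hz.1]

lemma ne_center_of_pos (C : ConeNhd X x) {z : X} (h : 0 < C.N z) : z ≠ x := by
  rintro rfl; rw [C.N_center] at h; exact lt_irrefl _ h

lemma link_ne (C : ConeNhd X x) {z : X} (hz : z ∈ C.link) : z ≠ x :=
  C.ne_center_of_pos (by rw [hz.2]; norm_num)

/-- The map of links that is induced by a local homeomorphism `φ`: shrink the link by the factor
`a`, apply `φ` and project. -/
noncomputable def linkMap (C : ConeNhd X x) (D : ConeNhd Y y) (φ : X → Y) (a : ℝ) (z : X) : Y :=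
  D.proj (φ (C.scale z a))

variable {C : ConeNhd X x} {D : ConeNhd Y y} {φ : X → Y} {a : ℝ}

lemma linkMap_aux (ha : 0 < a) (ha1 : a < 2) {z : X} (hz : z ∈ C.link) :
    C.scale z a ∈ C.W ∧ C.N (C.scale z a) = a / 2 := by
  have h1 : a * C.N z < 1 := by rw [hz.2]; linarith
  exact ⟨C.scale_mem z hz.1 a ha h1, by rw [C.N_scale z hz.1 a ha h1, hz.2]; ring⟩

lemma linkMap_mem (ha : 0 < a) (ha1 : a < 2)
    (h : ∀ z ∈ C.W, 0 < C.N z → C.N z ≤ a / 2 → φ z ∈ D.W ∧ φ z ≠ y) :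
    MapsTo (linkMap C D φ a) C.link D.link := by
  intro z hz
  obtain ⟨h1, h2⟩ := linkMap_aux ha ha1 hz
  obtain ⟨h3, h4⟩ := h _ h1 (by rw [h2]; linarith) h2.le
  exact D.proj_mem h3 h4

lemma linkMap_continuousOn (ha : 0 < a) (ha1 : a < 2)
    (h : ∀ z ∈ C.W, 0 < C.N z → C.N z ≤ a / 2 → φ z ∈ D.W ∧ φ z ≠ y)
    (hφ : ContinuousOn φ {z | z ∈ C.W ∧ C.N z ≤ a / 2}) :
    ContinuousOn (linkMap C D φ a) C.link := by
  refine D.continuousOn_proj.comp (t := D.W \ {y}) (hφ.comp (t := {z | z ∈ C.W ∧ C.N z ≤ a / 2})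
    (C.continuousOn_scale.comp (f := fun z => (z, a)) (by fun_prop) ?_) ?_) ?_
  · intro z hz
    refine ⟨hz.1, ha, ?_⟩
    simp only
    rw [hz.2]; linarith
  · intro z hz
    obtain ⟨h1, h2⟩ := linkMap_aux ha ha1 hz
    exact ⟨h1, h2.le⟩
  · intro z hz
    obtain ⟨h1, h2⟩ := linkMap_aux ha ha1 hz
    exact h _ h1 (by rw [h2]; linarith) h2.le

/-- One half of the homotopy equivalence of the links of two conical neighbourhoods: going to the
other link and back is homotopic to the identity, by a radial homotopy in the other
neighbourhood. -/
lemma linkMap_comp_cohomologous {ψ : Y → X} {b R : ℝ} (ha : 0 < a) (ha1 : a < 2) (hb : 0 < b)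
    (hbR : b / 2 < R) (hR : R ≤ 1)
    (hφ : ContinuousOn φ {z | z ∈ C.W ∧ C.N z ≤ a / 2})
    (hψ : ContinuousOn ψ {z | z ∈ D.W ∧ D.N z < R})
    (h1 : ∀ z ∈ C.W, 0 < C.N z → C.N z ≤ a / 2 → φ z ∈ D.W ∧ φ z ≠ y ∧ D.N (φ z) < R ∧
      ψ (φ z) = z)
    (h2 : ∀ z ∈ D.W, 0 < D.N z → D.N z < R → ψ z ∈ C.W ∧ ψ z ≠ x) :
    Cohomologous C.link C.link (linkMap D C ψ b ∘ linkMap C D φ a) id := by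
  -- at time `u` the point `q = φ (scale z a)` is scaled by a factor between `b / (2 N q)` and `1`
  let q : X → Y := fun z => φ (C.scale z a)
  let s : X × ℝ → ℝ := fun w => (1 - w.2) * (b / (2 * D.N (q w.1))) + w.2
  have hq : ∀ z ∈ C.link, q z ∈ D.W ∧ q z ≠ y ∧ D.N (q z) < R ∧ ψ (q z) = C.scale z a := by
    intro z hz
    obtain ⟨k1, k2⟩ := linkMap_aux ha ha1 hz
    exact h1 _ k1 (by rw [k2]; linarith) k2.le
  have hs : ∀ w ∈ C.link ×ˢ Icc (0 : ℝ) 1, 0 < s w ∧ s w * D.N (q w.1) < R := by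
    rintro ⟨z, u⟩ ⟨hz, hu⟩
    obtain ⟨k1, k2, k3, k4⟩ := hq z hz
    have k0 := D.N_pos k1 k2
    have e : s (z, u) * D.N (q z) = (1 - u) * (b / 2) + u * D.N (q z) := by
      simp only [s]; field_simp
    have hu1 : (0 : ℝ) ≤ 1 - u := by linarith [hu.2]
    have hu0 : (0 : ℝ) ≤ u := hu.1
    constructor
    · rcases hu0.eq_or_lt with h | h
      · simp only [s, ← h]
        have : 0 < b / (2 * D.N (q z)) := by positivity
        linarith
      · have : 0 ≤ b / (2 * D.N (q z)) := by positivity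
        simp only [s]
        have := mul_nonneg hu1 this
        linarith
    · simp only at e ⊢
      rw [e]
      rcases hu0.eq_or_lt with h | h
      · rw [← h]; linarith
      · nlinarith [mul_lt_mul_of_pos_left k3 h]
  have hqc : ContinuousOn q C.link := by
    refine hφ.comp (C.continuousOn_scale.comp (f := fun z => (z, a)) (by fun_prop) ?_) ?_
    · intro z hz
      refine ⟨hz.1, ha, ?_⟩
      simp only
      rw [hz.2]; linarith
    · intro z hz
      obtain ⟨k1, k2⟩ := linkMap_aux ha ha1 hz
      exact ⟨k1, k2.le⟩
  have hqc' : ContinuousOn (fun w : X × ℝ => q w.1) (C.link ×ˢ Icc (0 : ℝ) 1) :=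
    hqc.comp continuousOn_fst fun w hw => hw.1
  have hNc : ContinuousOn (fun w : X × ℝ => D.N (q w.1)) (C.link ×ˢ Icc (0 : ℝ) 1) :=
    D.continuousOn_N.comp hqc' fun w hw => (hq w.1 hw.1).1
  have hsc : ContinuousOn s (C.link ×ˢ Icc (0 : ℝ) 1) := by
    refine ((continuousOn_const.sub continuousOn_snd).mul (continuousOn_const.div
      (continuousOn_const.mul hNc) fun w hw => ?_)).add continuousOn_snd
    exact (mul_pos two_pos (D.N_pos (hq w.1 hw.1).1 (hq w.1 hw.1).2.1)).ne'
  have hmid : ∀ w ∈ C.link ×ˢ Icc (0 : ℝ) 1,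
      D.scale (q w.1) (s w) ∈ D.W ∧ 0 < D.N (D.scale (q w.1) (s w)) ∧
        D.N (D.scale (q w.1) (s w)) < R := by
    intro w hw
    obtain ⟨k1, k2, k3, k4⟩ := hq w.1 hw.1
    obtain ⟨m1, m2⟩ := hs w hw
    have k0 := D.N_pos k1 k2
    rw [D.N_scale _ k1 _ m1 (m2.trans_le hR)]
    exact ⟨D.scale_mem _ k1 _ m1 (m2.trans_le hR), by positivity, m2⟩
  refine Cohomologous.of_homotopy_eqOn C.isCompact_link
    (fun w => C.proj (ψ (D.scale (q w.1) (s w)))) ?_ ?_ ?_ ?_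
  · have g1 : ContinuousOn (fun w : X × ℝ => (q w.1, s w)) (C.link ×ˢ Icc (0 : ℝ) 1) :=
      hqc'.prodMk hsc
    have g2 : ContinuousOn (fun w : X × ℝ => D.scale (q w.1) (s w)) (C.link ×ˢ Icc (0 : ℝ) 1) :=
      D.continuousOn_scale.comp g1 fun w hw =>
        ⟨(hq w.1 hw.1).1, (hs w hw).1, (hs w hw).2.trans_le hR⟩
    have g3 : ContinuousOn (fun w : X × ℝ => ψ (D.scale (q w.1) (s w)))
        (C.link ×ˢ Icc (0 : ℝ) 1) :=
      hψ.comp g2 fun w hw => ⟨(hmid w hw).1, (hmid w hw).2.2⟩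
    exact C.continuousOn_proj.comp g3 fun w hw =>
      h2 _ (hmid w hw).1 (hmid w hw).2.1 (hmid w hw).2.2
  · intro w hw
    obtain ⟨k1, k2⟩ := h2 _ (hmid w hw).1 (hmid w hw).2.1 (hmid w hw).2.2
    exact C.proj_mem k1 k2
  · intro z hz
    obtain ⟨k1, k2, k3, k4⟩ := hq z hz
    have k0 := D.N_pos k1 k2
    have e : 1 / (2 * D.N (q z)) * D.N (q z) = 1 / 2 := by field_simp
    simp only [s, sub_zero, one_mul, add_zero, Function.comp_apply]
    change _ = C.proj (ψ (D.scale (D.scale (q z) (1 / (2 * D.N (q z)))) b))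
    rw [D.scale_scale _ k1 _ _ (by positivity) hb (by rw [e]; norm_num)
      (by rw [e]; linarith)]
    congr 3
    ring
  · intro z hz
    obtain ⟨k1, k2, k3, k4⟩ := hq z hz
    simp only [s, sub_self, zero_mul, zero_add, id]
    rw [D.scale_one _ k1, k4, C.proj_scale hz.1 (C.link_ne hz) ha (by rw [hz.2]; linarith),
      C.proj_of_mem_link hz]

/-- The Betti numbers of the link of a conical neighbourhood only depend on the local topology. -/
theorem betti_link_eq (C : ConeNhd X x) (D : ConeNhd Y y) (φ : OpenPartialHomeomorph X Y)
    (hx : x ∈ φ.source) (hxy : φ x = y) (p : ℕ) : betti C.link p = betti D.link p := by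
  have hy : y ∈ φ.target := hxy ▸ φ.map_source hx
  have hyx : φ.symm y = x := by rw [← hxy, φ.left_inv hx]
  have inj1 : ∀ z ∈ φ.source, z ≠ x → φ z ≠ y := fun z hz h h' =>
    h (φ.injOn hz hx (h'.trans hxy.symm))
  have inj2 : ∀ z ∈ φ.target, z ≠ y → φ.symm z ≠ x := fun z hz h h' =>
    h (φ.symm.injOn hz hy (h'.trans hyx.symm))
  have n1 : φ.target ∩ φ.symm ⁻¹' C.W ∈ 𝓝 y := by
    refine inter_mem (φ.open_target.mem_nhds hy) ((φ.continuousAt_symm hy).preimage_mem_nhds ?_)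
    rw [hyx]; exact C.isOpen_W.mem_nhds C.mem_W
  obtain ⟨R, hR0, hR1, hR⟩ := D.exists_radius n1
  have n2 : φ.source ∩ φ ⁻¹' {w | w ∈ D.W ∧ D.N w < R} ∈ 𝓝 x := by
    refine inter_mem (φ.open_source.mem_nhds hx) ((φ.continuousAt hx).preimage_mem_nhds ?_)
    rw [hxy]; exact D.setOf_N_lt_mem_nhds hR0
  obtain ⟨ε, hε0, hε1, hε⟩ := C.exists_radius n2
  have n3 : φ.target ∩ φ.symm ⁻¹' {w | w ∈ C.W ∧ C.N w < ε} ∈ 𝓝 y := by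
    refine inter_mem (φ.open_target.mem_nhds hy) ((φ.continuousAt_symm hy).preimage_mem_nhds ?_)
    rw [hyx]; exact C.setOf_N_lt_mem_nhds hε0
  obtain ⟨r', hr'0, hr'1, hr'⟩ := D.exists_radius n3
  obtain ⟨r, hr0, hrr', hrR⟩ : ∃ r, 0 < r ∧ r ≤ r' ∧ r ≤ R :=
    ⟨min r' R, lt_min hr'0 hR0, min_le_left _ _, min_le_right _ _⟩
  have a1 : ∀ z ∈ C.W, 0 < C.N z → C.N z < ε → φ z ∈ D.W ∧ φ z ≠ y ∧ D.N (φ z) < R ∧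
      φ.symm (φ z) = z := fun z hz h0 h => by
    obtain ⟨k1, k2, k3⟩ := hε z hz h
    exact ⟨k2, inj1 z k1 (C.ne_center_of_pos h0), k3, φ.left_inv k1⟩
  have a2 : ∀ z ∈ D.W, 0 < D.N z → D.N z < R → φ.symm z ∈ C.W ∧ φ.symm z ≠ x :=
    fun z hz h0 h => by
    obtain ⟨k1, k2⟩ := hR z hz h
    exact ⟨k2, inj2 z k1 (D.ne_center_of_pos h0)⟩
  have a3 : ∀ z ∈ D.W, 0 < D.N z → D.N z < r → φ.symm z ∈ C.W ∧ φ.symm z ≠ x ∧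
      C.N (φ.symm z) < ε ∧ φ (φ.symm z) = z := fun z hz h0 h => by
    obtain ⟨k1, k2, k3⟩ := hr' z hz (h.trans_le hrr')
    exact ⟨k2, inj2 z k1 (D.ne_center_of_pos h0), k3, φ.right_inv k1⟩
  have cφ : ContinuousOn φ {z | z ∈ C.W ∧ C.N z < ε} :=
    φ.continuousOn.mono fun z hz => (hε z hz.1 hz.2).1
  have cψ : ContinuousOn φ.symm {z | z ∈ D.W ∧ D.N z < R} :=
    φ.symm.continuousOn.mono fun z hz => (hR z hz.1 hz.2).1
  have cφ' : ContinuousOn φ {z | z ∈ C.W ∧ C.N z ≤ ε / 2} :=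
    cφ.mono fun z hz => ⟨hz.1, hz.2.trans_lt (by linarith)⟩
  have cψ' : ContinuousOn φ.symm {z | z ∈ D.W ∧ D.N z ≤ r / 2} :=
    cψ.mono fun z hz => ⟨hz.1, hz.2.trans_lt (by linarith)⟩
  have b1 : ∀ z ∈ C.W, 0 < C.N z → C.N z ≤ ε / 2 → φ z ∈ D.W ∧ φ z ≠ y ∧ D.N (φ z) < R ∧
      φ.symm (φ z) = z := fun z hz h0 h => a1 z hz h0 (by linarith)
  have b3 : ∀ z ∈ D.W, 0 < D.N z → D.N z ≤ r / 2 → φ.symm z ∈ C.W ∧ φ.symm z ≠ x ∧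
      C.N (φ.symm z) < ε ∧ φ (φ.symm z) = z := fun z hz h0 h => a3 z hz h0 (by linarith)
  have c1 : ∀ z ∈ C.W, 0 < C.N z → C.N z ≤ ε / 2 → φ z ∈ D.W ∧ φ z ≠ y := fun z hz h0 h =>
    ⟨(b1 z hz h0 h).1, (b1 z hz h0 h).2.1⟩
  have c3 : ∀ z ∈ D.W, 0 < D.N z → D.N z ≤ r / 2 → φ.symm z ∈ C.W ∧ φ.symm z ≠ x :=
    fun z hz h0 h => ⟨(b3 z hz h0 h).1, (b3 z hz h0 h).2.1⟩
  obtain ⟨e⟩ := nonempty_cohom_equiv C.isCompact_link D.isCompact_link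
    (linkMap_continuousOn hε0 (by linarith) c1 cφ') (linkMap_continuousOn hr0 (by linarith) c3 cψ')
    (linkMap_mem hε0 (by linarith) c1) (linkMap_mem hr0 (by linarith) c3)
    (linkMap_comp_cohomologous hε0 (by linarith) hr0 (by linarith) hR1.le cφ' cψ b1 a2)
    (linkMap_comp_cohomologous hr0 (by linarith) hε0 (by linarith) hε1.le cψ' cφ b3
      fun z hz h0 h => ⟨(a1 z hz h0 h).1, (a1 z hz h0 h).2.1⟩) p
  exact e.finrank_eq

end ConeNhd

end AlexanderSpanier

/-! ### Links in Euclidean spaces -/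

namespace AlexanderSpanier

open SubquotientCohomology Set Filter Topology

lemma nonempty_cohom_equiv_of_inverse {E F : Type*} [MetricSpace E] [MetricSpace F] {A : Set E}
    {B : Set F} (hA : IsCompact A) (hB : IsCompact B) {f : E → F} {g : F → E}
    (hf : ContinuousOn f A) (hg : ContinuousOn g B) (hfm : MapsTo f A B) (hgm : MapsTo g B A)
    (hgf : ∀ x ∈ A, g (f x) = x) (hfg : ∀ y ∈ B, f (g y) = y) (p : ℕ) :
    Nonempty (Cohom A p ≃ₗ[ZMod 2] Cohom B p) := by
  refine nonempty_cohom_equiv hA hB hf hg hfm hgm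
    (Cohomologous.of_eqOn (hgm.comp hfm) ?_ hgf) (Cohomologous.of_eqOn (hfm.comp hgm) ?_ hfg) p
  · exact hA.uniformContinuousOn_of_continuous (hg.comp hf hfm)
  · exact hB.uniformContinuousOn_of_continuous (hf.comp hg hgm)

section Euclidean

variable {n : ℕ}

/-- The coordinates of a vector together with minus their sum: an isomorphism of `ℝⁿ` with the
vectors in `ℝⁿ⁺¹` of coordinate sum zero. -/
noncomputable def augCoord (z : EuclideanSpace ℝ (Fin n)) : Fin (n + 1) → ℝ :=
  Fin.cons (-∑ i, z i) fun i => z i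

lemma sum_augCoord (z : EuclideanSpace ℝ (Fin n)) : ∑ i, augCoord z i = 0 := by
  simp [augCoord, Fin.sum_univ_succ]

lemma augCoord_smul (s : ℝ) (z : EuclideanSpace ℝ (Fin n)) (i : Fin (n + 1)) :
    augCoord (s • z) i = s * augCoord z i := by
  refine Fin.cases ?_ (fun j => ?_) i
  · simp [augCoord, Finset.mul_sum]
  · simp [augCoord]

lemma continuous_augCoord : Continuous (augCoord (n := n)) := by
  refine continuous_pi fun i => ?_
  refine Fin.cases ?_ (fun j => ?_) i <;> simp only [augCoord, Fin.cons_zero, Fin.cons_succ] <;>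
    fun_prop

/-- The gauge of the simplex with barycentre `0` in `ℝⁿ` on which all `augCoord`s are at
least `-1`. -/
noncomputable def simplexGauge (z : EuclideanSpace ℝ (Fin n)) : ℝ :=
  Finset.univ.sup' Finset.univ_nonempty fun i => - augCoord z i

lemma continuous_simplexGauge : Continuous (simplexGauge (n := n)) :=
  Continuous.finset_sup'_apply _ fun i _ =>
    ((continuous_apply i).comp continuous_augCoord).neg

lemma neg_augCoord_le (z : EuclideanSpace ℝ (Fin n)) (i : Fin (n + 1)) :
    - augCoord z i ≤ simplexGauge z :=
  Finset.le_sup' (fun i => - augCoord z i) (Finset.mem_univ i)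

lemma exists_simplexGauge_eq (z : EuclideanSpace ℝ (Fin n)) :
    ∃ i, simplexGauge z = - augCoord z i := by
  obtain ⟨i, -, h⟩ := Finset.exists_mem_eq_sup' Finset.univ_nonempty fun i => - augCoord z i
  exact ⟨i, h⟩

lemma simplexGauge_smul {s : ℝ} (hs : 0 ≤ s) (z : EuclideanSpace ℝ (Fin n)) :
    simplexGauge (s • z) = s * simplexGauge z := by
  apply le_antisymm
  · obtain ⟨i, hi⟩ := exists_simplexGauge_eq (s • z)
    rw [hi, augCoord_smul, ← mul_neg]
    exact mul_le_mul_of_nonneg_left (neg_augCoord_le z i) hs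
  · obtain ⟨i, hi⟩ := exists_simplexGauge_eq z
    rw [hi, mul_neg, ← augCoord_smul]
    exact neg_augCoord_le _ i

lemma simplexGauge_nonneg (z : EuclideanSpace ℝ (Fin n)) : 0 ≤ simplexGauge z := by
  by_contra! h
  have : 0 < ∑ i, augCoord z i :=
    Finset.sum_pos (fun i _ => by linarith [neg_augCoord_le z i]) Finset.univ_nonempty
  rw [sum_augCoord] at this
  exact lt_irrefl _ this

lemma eq_zero_of_simplexGauge (z : EuclideanSpace ℝ (Fin n)) (h : simplexGauge z = 0) : z = 0 := by
  have h1 : ∀ i, 0 ≤ augCoord z i := fun i => by linarith [neg_augCoord_le z i]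
  have h2 := (Finset.sum_eq_zero_iff_of_nonneg fun i _ => h1 i).1 (sum_augCoord z)
  ext i
  exact h2 i.succ (Finset.mem_univ _)

/-- Barycentric coordinates with respect to the simplex of gauge `1 / 2` around `c`. -/
noncomputable def toBary (c y : EuclideanSpace ℝ (Fin n)) : Fin (n + 1) → ℝ :=
  fun i => (2 * augCoord (y - c) i + 1) / (n + 1)

/-- The point with given barycentric coordinates. -/
noncomputable def ofBary (c : EuclideanSpace ℝ (Fin n)) (t : Fin (n + 1) → ℝ) :
    EuclideanSpace ℝ (Fin n) :=
  c + WithLp.toLp 2 fun i : Fin n => ((n + 1) * t i.succ - 1) / 2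

lemma continuous_toBary (c : EuclideanSpace ℝ (Fin n)) : Continuous (toBary c) :=
  continuous_pi fun i => ((continuous_const.mul ((continuous_apply i).comp
    (continuous_augCoord.comp (continuous_id.sub continuous_const)))).add
      continuous_const).div_const _

lemma continuous_ofBary (c : EuclideanSpace ℝ (Fin n)) : Continuous (ofBary c) := by
  unfold ofBary
  fun_prop

lemma ofBary_toBary (c y : EuclideanSpace ℝ (Fin n)) : ofBary c (toBary c y) = y := by
  have : (n + 1 : ℝ) ≠ 0 := by positivity
  ext i
  simp only [ofBary, toBary, augCoord, Fin.cons_succ, PiLp.add_apply, PiLp.sub_apply]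
  field_simp
  ring

lemma toBary_ofBary (c : EuclideanSpace ℝ (Fin n)) {t : Fin (n + 1) → ℝ} (ht : ∑ i, t i = 1) :
    toBary c (ofBary c t) = t := by
  have : (n + 1 : ℝ) ≠ 0 := by positivity
  funext i
  refine Fin.cases ?_ (fun j => ?_) i
  · simp only [ofBary, toBary, augCoord, Fin.cons_zero, add_sub_cancel_left]
    rw [Fin.sum_univ_succ] at ht
    rw [← Finset.sum_div, Finset.sum_sub_distrib, ← Finset.mul_sum]
    rw [show ∑ i : Fin n, t i.succ = 1 - t 0 by linarith]
    simp only [Finset.sum_const, Finset.card_univ, Fintype.card_fin, nsmul_eq_mul, mul_one]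
    field_simp
    ring
  · simp only [ofBary, toBary, augCoord, Fin.cons_succ, add_sub_cancel_left]
    field_simp
    ring

lemma sum_toBary (c y : EuclideanSpace ℝ (Fin n)) : ∑ i, toBary c y i = 1 := by
  have : (n + 1 : ℝ) ≠ 0 := by positivity
  simp only [toBary, ← Finset.sum_div, Finset.sum_add_distrib, ← Finset.mul_sum, sum_augCoord]
  simp [div_self this]

lemma toBary_mem_iff (c y : EuclideanSpace ℝ (Fin n)) :
    toBary c y ∈ stdSimplex ℝ (Fin (n + 1)) ↔ simplexGauge (y - c) ≤ 1 / 2 := by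
  have h0 : (0 : ℝ) < n + 1 := by positivity
  constructor
  · intro h
    obtain ⟨i, hi⟩ := exists_simplexGauge_eq (y - c)
    have := mul_nonneg (h.1 i) h0.le
    simp only [toBary] at this
    rw [div_mul_cancel₀ _ h0.ne'] at this
    rw [hi]; linarith
  · intro h
    refine ⟨fun i => ?_, sum_toBary c y⟩
    simp only [toBary]
    refine div_nonneg ?_ h0.le
    linarith [neg_augCoord_le (y - c) i]

lemma toBary_mem_boundary_iff (c y : EuclideanSpace ℝ (Fin n)) :
    toBary c y ∈ simplexBoundary Finset.univ ↔ simplexGauge (y - c) = 1 / 2 := by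
  have h0 : (n + 1 : ℝ) ≠ 0 := by positivity
  have h1 : ∀ i, toBary c y i = 0 ↔ - augCoord (y - c) i = 1 / 2 := fun i => by
    simp only [toBary, div_eq_zero_iff, h0, or_false]
    constructor <;> intro h <;> linarith
  constructor
  · rintro ⟨h2, -, i, -, hi⟩
    refine le_antisymm ((toBary_mem_iff c y).1 h2) ?_
    rw [← (h1 i).1 hi]
    exact neg_augCoord_le _ i
  · intro h
    obtain ⟨i, hi⟩ := exists_simplexGauge_eq (y - c)
    exact ⟨(toBary_mem_iff c y).2 h.le, by simp, i, by simp, (h1 i).2 (by rw [← hi, h])⟩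

/-- Every point of a Euclidean space has a conical neighbourhood, a simplex. -/
noncomputable def euclideanCone (c : EuclideanSpace ℝ (Fin n)) :
    ConeNhd (EuclideanSpace ℝ (Fin n)) c where
  W := {y | simplexGauge (y - c) < 1}
  N y := simplexGauge (y - c)
  scale y s := c + s • (y - c)
  isOpen_W := isOpen_lt (continuous_simplexGauge.comp (by fun_prop)) continuous_const
  mem_W := by
    have := simplexGauge_smul (n := n) le_rfl 0
    simp at this
    simp [this]
  N_center := by
    have := simplexGauge_smul (n := n) le_rfl 0
    simp at this
    simp [this]
  N_nonneg y _ := simplexGauge_nonneg _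
  N_lt_one y hy := hy
  eq_center y _ h := sub_eq_zero.1 (eq_zero_of_simplexGauge _ h)
  continuousOn_N := (continuous_simplexGauge.comp (by fun_prop)).continuousOn
  scale_mem y _ s hs h := by
    change simplexGauge (c + s • (y - c) - c) < 1
    rwa [add_sub_cancel_left, simplexGauge_smul hs.le]
  N_scale y _ s hs h := by rw [add_sub_cancel_left, simplexGauge_smul hs.le]
  scale_one y _ := by simp
  scale_scale y _ s s' _ _ _ _ := by rw [add_sub_cancel_left, smul_smul]
  continuousOn_scale := by fun_prop
  isCompact_half := by
    have : {y | y ∈ {y | simplexGauge (y - c) < 1} ∧ simplexGauge (y - c) ≤ 1 / 2} =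
        ofBary c '' stdSimplex ℝ (Fin (n + 1)) := by
      ext y
      constructor
      · rintro ⟨-, h⟩
        exact ⟨toBary c y, (toBary_mem_iff c y).2 h, ofBary_toBary c y⟩
      · rintro ⟨t, ht, rfl⟩
        have h : simplexGauge (ofBary c t - c) ≤ 1 / 2 := by
          rw [← toBary_mem_iff, toBary_ofBary c ht.2]; exact ht
        exact ⟨h.trans_lt (by norm_num), h⟩
    rw [this]
    exact (isCompact_stdSimplex ℝ _).image (continuous_ofBary c)

lemma euclideanCone_link (c : EuclideanSpace ℝ (Fin n)) :
    (∀ p, FiniteDimensional (ZMod 2) (Cohom (euclideanCone c).link p)) ∧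
      ∀ p, betti (euclideanCone c).link p = if p = n then 1 else 0 := by
  have hlink : ∀ y, y ∈ (euclideanCone c).link ↔ simplexGauge (y - c) = 1 / 2 := fun y =>
    ⟨fun h => h.2, fun h => ⟨h.trans_lt (by norm_num), h⟩⟩
  have e := nonempty_cohom_equiv_of_inverse (euclideanCone c).isCompact_link
    (isCompact_simplexBoundary (Finset.univ : Finset (Fin (n + 1))))
    (continuous_toBary c).continuousOn (continuous_ofBary c).continuousOn
    (fun y hy => (toBary_mem_boundary_iff c y).2 ((hlink y).1 hy))
    (fun t ht => (hlink _).2 (by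
      rw [← toBary_mem_boundary_iff, toBary_ofBary c ht.1.2]; exact ht))
    (fun y _ => ofBary_toBary c y) (fun t ht => toBary_ofBary c ht.1.2)
  obtain ⟨h1, h2⟩ := betti_simplexBoundary (Finset.univ : Finset (Fin (n + 1)))
    Finset.univ_nonempty
  refine ⟨fun p => ?_, fun p => ?_⟩
  · have := h1 p
    exact Module.Finite.equiv (e p).some.symm
  · have := h2 p
    rw [Finset.card_univ, Fintype.card_fin] at this
    simp only [add_left_inj] at this
    rw [← this]
    exact (e p).some.finrank_eq

end Euclidean

end AlexanderSpanier

/-! ### Faces and points of the realization -/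

namespace SimplicialPoset

open Set

section Combinatorics

variable {P : Type*} [PartialOrder P] [OrderBot P]

/-- The vertices of the face `x` are in bijection with the points of the finite set whose subsets
are the faces of `x`. -/
lemma exists_vertex_labelling (hP : IsSimplicialPoset P) (x : P) :
    ∃ (n : ℕ) (e : Iic x ≃o Finset (Fin n)) (a : Fin n → P), Function.Injective a ∧
      (∀ i, IsAtom (a i) ∧ a i ≤ x) ∧ (∀ v, IsAtom v → v ≤ x → ∃ i, a i = v) ∧
      ∀ (y : Iic x) i, a i ≤ y.1 ↔ i ∈ e y := by
  obtain ⟨n, ⟨e⟩⟩ := hP.boolean x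
  refine ⟨n, e, fun i => (e.symm {i}).1, ?_, ?_, ?_, ?_⟩
  · intro i j h
    simpa using e.symm.injective (Subtype.ext h)
  · intro i
    refine ⟨?_, (e.symm {i}).2⟩
    have h1 : IsAtom (e.symm {i}) := (OrderIso.isAtom_iff e.symm _).2 (Finset.isAtom_singleton i)
    refine ⟨fun h => h1.1 (Subtype.ext h), fun b hb => ?_⟩
    have := h1.2 ⟨b, hb.le.trans (e.symm {i}).2⟩ hb
    exact congrArg Subtype.val this
  · intro v hv hvx
    have h1 : IsAtom (⟨v, hvx⟩ : Iic x) :=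
      ⟨fun h => hv.1 (congrArg Subtype.val h), fun b hb => Subtype.ext (hv.2 b.1 hb)⟩
    obtain ⟨i, hi⟩ := Finset.isAtom_iff.1 ((OrderIso.isAtom_iff e _).2 h1)
    exact ⟨i, by simp only [← hi, e.symm_apply_apply]⟩
  · intro y i
    rw [← Finset.singleton_subset_iff, ← e.symm_apply_le]
    rfl

/-- In an isomorphism of a lower interval with a Boolean lattice, the cardinality corresponds to the
number of vertices. -/
lemma card_vert_eq {x : P} {n : ℕ} {e : Iic x ≃o Finset (Fin n)} {a : Fin n → P}
    (ha : Function.Injective a) (ha1 : ∀ i, IsAtom (a i) ∧ a i ≤ x)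
    (ha2 : ∀ v, IsAtom v → v ≤ x → ∃ i, a i = v) (he : ∀ (y : Iic x) i, a i ≤ y.1 ↔ i ∈ e y)
    (y : Iic x) : Nat.card (Vert y.1) = (e y).card := by
  have f : (e y) ≃ Vert y.1 := Equiv.ofBijective
    (fun i => (⟨a i.1, (ha1 i.1).1, (he y i.1).2 i.2⟩ : Vert y.1)) (by
      constructor
      · intro i j h
        exact Subtype.ext (ha (congrArg (fun w : Vert y.1 => w.1) h))
      · rintro ⟨v, hv, hvy⟩
        obtain ⟨i, rfl⟩ := ha2 v hv (hvy.trans y.2)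
        exact ⟨⟨i, (he y i).1 hvy⟩, rfl⟩)
  rw [← Nat.card_congr f, Nat.card_eq_fintype_card, Fintype.card_coe]

/-- Faces of a common face are compared by their vertices. -/
lemma le_of_vertices (hP : IsSimplicialPoset P) {x y z : P} (hy : y ≤ x) (hz : z ≤ x)
    (h : ∀ v, IsAtom v → v ≤ y → v ≤ z) : y ≤ z := by
  obtain ⟨n, e, a, -, ha, -, he⟩ := exists_vertex_labelling hP x
  have : e ⟨y, hy⟩ ≤ e ⟨z, hz⟩ := fun i hi => (he _ i).1 (h _ (ha i).1 ((he ⟨y, hy⟩ i).2 hi))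
  exact e.le_iff_le.1 this

/-- Every set of vertices of a face spans a face of it. -/
lemma exists_face (hP : IsSimplicialPoset P) (x : P) (s : Set P) :
    ∃ y ≤ x, ∀ v, IsAtom v → (v ≤ y ↔ v ≤ x ∧ v ∈ s) := by
  classical
  obtain ⟨n, e, a, -, ha, ha', he⟩ := exists_vertex_labelling hP x
  let y := e.symm {i | a i ∈ s}
  refine ⟨y.1, y.2, fun v hv => ⟨fun h => ⟨h.trans y.2, ?_⟩, fun h => ?_⟩⟩
  · obtain ⟨i, rfl⟩ := ha' v hv (h.trans y.2)
    have := (he y i).1 h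
    simpa [y] using this
  · obtain ⟨i, rfl⟩ := ha' v hv h.1
    exact (he y i).2 (by simpa [y] using h.2)

open Classical in
/-- The alternating sum over a nontrivial interval vanishes, since it is a Boolean lattice. -/
lemma sum_Icc_neg_one_pow [Fintype P] (hP : IsSimplicialPoset P) {x y : P} (h : x < y) :
    ∑ z : P with x ≤ z ∧ z ≤ y, (-1 : ℤ) ^ Nat.card (Vert z) = 0 := by
  obtain ⟨n, e, a, h1, h2, h3, h4⟩ := exists_vertex_labelling hP y
  have hc := card_vert_eq h1 h2 h3 h4
  set A := e ⟨x, h.le⟩ with hA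
  have hne : (Finset.univ \ A).Nonempty := by
    rw [Finset.sdiff_nonempty]
    intro hu
    have : e ⟨y, le_rfl⟩ ≤ e ⟨x, h.le⟩ := (Finset.subset_univ _).trans hu
    exact h.not_ge (e.le_iff_le.1 this)
  have key := Finset.sum_powerset_neg_one_pow_card_of_nonempty hne
  have key2 : ∑ z : P with x ≤ z ∧ z ≤ y, (-1 : ℤ) ^ Nat.card (Vert z) =
      ∑ B ∈ (Finset.univ \ A).powerset, (-1 : ℤ) ^ A.card * (-1) ^ B.card := by
    symm
    refine Finset.sum_bij (fun B _ => (e.symm (A ∪ B)).1) ?_ ?_ ?_ ?_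
    · intro B _
      refine Finset.mem_filter.2 ⟨Finset.mem_univ _, ?_, (e.symm (A ∪ B)).2⟩
      have : (⟨x, h.le⟩ : Iic y) ≤ e.symm (A ∪ B) := by
        rw [← e.le_iff_le, e.apply_symm_apply]
        exact Finset.subset_union_left
      exact this
    · intro B hB C hC hBC
      have h5 : A ∪ B = A ∪ C := e.symm.injective (Subtype.ext hBC)
      have h6 : ∀ D ∈ (Finset.univ \ A).powerset, (A ∪ D) \ A = D := fun D hD => by
        rw [Finset.union_sdiff_left, Finset.sdiff_eq_self_iff_disjoint]
        exact (Finset.disjoint_of_subset_left (Finset.mem_powerset.1 hD) Finset.sdiff_disjoint)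
      rw [← h6 B hB, h5, h6 C hC]
    · intro z hz
      obtain ⟨-, hxz, hzy⟩ := Finset.mem_filter.1 hz
      have hAz : A ⊆ e ⟨z, hzy⟩ := e.le_iff_le.2 (show (⟨x, h.le⟩ : Iic y) ≤ ⟨z, hzy⟩ from hxz)
      refine ⟨e ⟨z, hzy⟩ \ A, Finset.mem_powerset.2 (Finset.sdiff_subset_sdiff
        (Finset.subset_univ _) subset_rfl), ?_⟩
      rw [Finset.union_sdiff_of_subset hAz, e.symm_apply_apply]
    · intro B hB
      rw [hc, e.apply_symm_apply, Finset.card_union_of_disjoint, pow_add]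
      exact (Finset.disjoint_of_subset_left (Finset.mem_powerset.1 hB) Finset.sdiff_disjoint).symm
  rw [← Finset.mul_sum, key, mul_zero] at key2
  exact key2

lemma exists_vertex (hP : IsSimplicialPoset P) {x : P} (hx : x ≠ ⊥) : ∃ v, IsAtom v ∧ v ≤ x := by
  by_contra! h
  exact hx (le_bot_iff.1 (le_of_vertices hP le_rfl bot_le fun v hv hvx => absurd hvx (h v hv)))

end Combinatorics

lemma Vert.ext {P : Type*} [PartialOrder P] [OrderBot P] {x : P} {v w : Vert x}
    (h : v.1 = w.1) : v = w := Subtype.ext h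

section Points

variable {P : Type*} [PartialOrder P] [OrderBot P] [Finite P]

open Classical in
/-- The inclusion of a face extends the barycentric coordinates by zero. -/
lemma map_incl_apply {x y : P} (h : x ≤ y) (t : stdSimplex ℝ (Vert x)) (v : Vert y) :
    stdSimplex.map (Vert.incl h) t v = if h' : v.1 ≤ x then t ⟨v.1, v.2.1, h'⟩ else 0 := by
  rw [stdSimplex.map_coe, FunOnFinite.linearMap_apply_apply]
  split_ifs with h'
  · refine Finset.sum_eq_single (⟨v.1, v.2.1, h'⟩ : Vert x) ?_ ?_
    · intro b hb hne
      have h2 : Vert.incl h b = v := (Finset.mem_filter.1 hb).2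
      exact (hne (Vert.ext (show b.1 = v.1 from congrArg Subtype.val h2))).elim
    · intro hn
      have h2 : Vert.incl h (⟨v.1, v.2.1, h'⟩ : Vert x) = v := Vert.ext rfl
      exact (hn (Finset.mem_filter.2 ⟨Finset.mem_univ (α := Vert x) _, h2⟩)).elim
  · refine Finset.sum_eq_zero fun b hb => absurd ?_ h'
    have := congrArg Subtype.val (Finset.mem_filter.1 hb).2
    exact this ▸ b.2.2

open Classical in
/-- The barycentric coordinates of a point of the realization, which vanish outside its
carrier. -/
noncomputable def coord (p : Realization P) (v : P) : ℝ :=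
  Quot.lift (fun q : Σ x : P, stdSimplex ℝ (Vert x) =>
    if h : IsAtom v ∧ v ≤ q.1 then q.2 ⟨v, h⟩ else 0) (by
      rintro ⟨x, t⟩ ⟨y, u⟩ ⟨h, hu⟩
      simp only at h hu ⊢
      subst hu
      by_cases hv : IsAtom v
      · by_cases hx : v ≤ x
        · rw [dif_pos ⟨hv, hx⟩, dif_pos ⟨hv, hx.trans h⟩]
          exact ((map_incl_apply h t ⟨v, hv, hx.trans h⟩).trans (dif_pos hx)).symm
        · rw [dif_neg fun h' => hx h'.2]
          split_ifs with h'
          · exact ((map_incl_apply h t ⟨v, h'⟩).trans (dif_neg hx)).symm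
          · rfl
      · rw [dif_neg fun h' => hv h'.1, dif_neg fun h' => hv h'.1]) p

lemma coord_toRealization {x : P} (t : stdSimplex ℝ (Vert x)) (v : Vert x) :
    coord (toRealization x t) v.1 = t v := dif_pos v.2

lemma coord_toRealization_of_not {x : P} (t : stdSimplex ℝ (Vert x)) {v : P}
    (h : ¬ (IsAtom v ∧ v ≤ x)) : coord (toRealization x t) v = 0 := dif_neg h

lemma exists_rep (p : Realization P) : ∃ x t, toRealization x t = p := by
  obtain ⟨⟨x, t⟩, rfl⟩ := Quot.exists_rep p
  exact ⟨x, t, rfl⟩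

lemma coord_nonneg (p : Realization P) (v : P) : 0 ≤ coord p v := by
  obtain ⟨x, t, rfl⟩ := exists_rep p
  by_cases h : IsAtom v ∧ v ≤ x
  · exact (coord_toRealization t ⟨v, h⟩).symm ▸ t.2.1 _
  · rw [coord_toRealization_of_not t h]

lemma coord_of_not_isAtom (p : Realization P) {v : P} (h : ¬ IsAtom v) : coord p v = 0 := by
  obtain ⟨x, t, rfl⟩ := exists_rep p
  exact coord_toRealization_of_not t fun h' => h h'.1

lemma continuous_toRealization (x : P) : Continuous (toRealization x) :=
  continuous_quot_mk.comp continuous_sigmaMk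

lemma continuous_coord (v : P) : Continuous fun p : Realization P => coord p v := by
  classical
  refine continuous_quot_lift _ (continuous_sigma fun x => ?_)
  by_cases h : IsAtom v ∧ v ≤ x
  · simp only [dif_pos h]
    exact (continuous_apply (⟨v, h⟩ : Vert x)).comp continuous_subtype_val
  · simp only [dif_neg h]
    exact continuous_const

lemma toRealization_map {x y : P} (h : x ≤ y) (t : stdSimplex ℝ (Vert x)) :
    toRealization y (stdSimplex.map (Vert.incl h) t) = toRealization x t :=
  (Quot.sound ⟨h, rfl⟩).symm

/-- The carrier of a point: the face that contains it in its interior. -/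
noncomputable def carrier (hP : IsSimplicialPoset P) (p : Realization P) : P :=
  Quot.lift (fun q : Σ x : P, stdSimplex ℝ (Vert x) =>
    (exists_face hP q.1 {v | 0 < coord (toRealization q.1 q.2) v}).choose) (by
      rintro ⟨x, t⟩ ⟨y, u⟩ ⟨h, hu⟩
      simp only at h hu ⊢
      subst hu
      have h1 := (exists_face hP x {v | 0 < coord (toRealization x t) v}).choose_spec
      have h2 := (exists_face hP y {v | 0 < coord (toRealization y
        (stdSimplex.map (Vert.incl h) t)) v}).choose_spec
      have key : ∀ v, IsAtom v → (v ≤ x ∧ 0 < coord (toRealization x t) v ↔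
          v ≤ y ∧ 0 < coord (toRealization y (stdSimplex.map (Vert.incl h) t)) v) := by
        intro v hv
        rw [toRealization_map]
        refine ⟨fun h' => ⟨h'.1.trans h, h'.2⟩, fun h' => ⟨?_, h'.2⟩⟩
        by_contra hn
        exact h'.2.ne' (coord_toRealization_of_not t fun h3 => hn h3.2)
      refine le_antisymm (le_of_vertices hP (h1.1.trans h) h2.1 fun v hv hvx => ?_)
        (le_of_vertices hP h2.1 (h1.1.trans h) fun v hv hvx => ?_)
      · exact (h2.2 v hv).2 ((key v hv).1 ((h1.2 v hv).1 hvx))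
      · exact (h1.2 v hv).2 ((key v hv).2 ((h2.2 v hv).1 hvx))) p

variable (hP : IsSimplicialPoset P)

include hP

lemma carrier_le {x : P} (t : stdSimplex ℝ (Vert x)) : carrier hP (toRealization x t) ≤ x :=
  (exists_face hP x {v | 0 < coord (toRealization x t) v}).choose_spec.1

lemma le_carrier_iff (p : Realization P) {v : P} (hv : IsAtom v) :
    v ≤ carrier hP p ↔ 0 < coord p v := by
  obtain ⟨x, t, rfl⟩ := exists_rep p
  refine ((exists_face hP x {v | 0 < coord (toRealization x t) v}).choose_spec.2 v hv).trans
    ⟨fun h => h.2, fun h => ⟨?_, h⟩⟩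
  by_contra hn
  exact h.ne' (coord_toRealization_of_not t fun h3 => hn h3.2)

lemma coord_eq_zero {p : Realization P} {y v : P} (hy : carrier hP p ≤ y) (hv : ¬ v ≤ y) :
    coord p v = 0 := by
  by_cases ha : IsAtom v
  · by_contra h
    exact hv (((le_carrier_iff hP p ha).2 ((coord_nonneg p v).lt_of_ne (Ne.symm h))).trans hy)
  · exact coord_of_not_isAtom p ha

/-- A point lies in every closed face that contains its carrier. -/
lemma exists_rep_of_carrier_le {p : Realization P} {y : P} (hy : carrier hP p ≤ y) :
    ∃ t : stdSimplex ℝ (Vert y), toRealization y t = p ∧ ∀ v : Vert y, t v = coord p v.1 := by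
  classical
  -- it suffices to treat the carrier
  suffices h : ∃ t : stdSimplex ℝ (Vert (carrier hP p)), toRealization _ t = p by
    obtain ⟨t, ht⟩ := h
    refine ⟨stdSimplex.map (Vert.incl hy) t, by rw [toRealization_map, ht], fun v => ?_⟩
    rw [← coord_toRealization, toRealization_map, ht]
  obtain ⟨x, t, rfl⟩ := exists_rep p
  set z := carrier hP (toRealization x t) with hz
  have hzx : z ≤ x := carrier_le hP t
  have h0 : ∀ v : Vert x, ¬ v.1 ≤ z → t v = 0 := fun v hv => by
    rw [← coord_toRealization]; exact coord_eq_zero hP le_rfl hv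
  have hs : (fun v : Vert z => t (Vert.incl hzx v)) ∈ stdSimplex ℝ (Vert z) := by
    refine ⟨fun v => t.2.1 _, ?_⟩
    rw [← t.2.2]
    refine Finset.sum_of_injOn (Vert.incl hzx) ?_ ?_ ?_ ?_
    · intro a _ b _ h
      exact Vert.ext (congrArg (fun w : Vert x => w.1) h)
    · intro a _; simp
    · intro v _ hv
      refine h0 v fun h => hv ⟨⟨v.1, v.2.1, h⟩, Finset.mem_coe.2 (Finset.mem_univ _), rfl⟩
    · intro v _; rfl
  refine ⟨⟨_, hs⟩, ?_⟩
  rw [← toRealization_map hzx]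
  congr 1
  ext v
  rw [map_incl_apply]
  split_ifs with h
  · rfl
  · exact (h0 v h).symm

lemma sum_coord {p : Realization P} {y : P} (hy : carrier hP p ≤ y) :
    ∑ v : Vert y, coord p v.1 = 1 := by
  obtain ⟨t, -, ht⟩ := exists_rep_of_carrier_le hP hy
  simp only [← ht]
  exact t.2.2

lemma realization_ext {p q : Realization P} (h1 : carrier hP p = carrier hP q)
    (h2 : ∀ v, coord p v = coord q v) : p = q := by
  obtain ⟨t, ht', ht⟩ := exists_rep_of_carrier_le hP (p := p) le_rfl
  obtain ⟨u, hu, hu'⟩ := exists_rep_of_carrier_le hP h1.symm.le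
  have htu : t = u := by
    ext v
    exact (ht v).trans ((h2 v.1).trans (hu' v).symm)
  exact ht'.symm.trans ((congrArg _ htu).trans hu)

/-- Points of a common closed face are determined by their coordinates. -/
lemma realization_ext_of_le {p q : Realization P} {y : P} (hp : carrier hP p ≤ y)
    (hq : carrier hP q ≤ y) (h : ∀ v, coord p v = coord q v) : p = q := by
  refine realization_ext hP (le_antisymm (le_of_vertices hP hp hq fun v hv => ?_)
    (le_of_vertices hP hq hp fun v hv => ?_)) h <;> simp only [le_carrier_iff hP _ hv, h, imp_self]

lemma isClosed_carrier_le [T2Space (Realization P)] (y : P) :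
    IsClosed {p : Realization P | carrier hP p ≤ y} := by
  have : {p : Realization P | carrier hP p ≤ y} = range (toRealization y) := by
    ext p
    constructor
    · intro h
      obtain ⟨t, ht, -⟩ := exists_rep_of_carrier_le hP h
      exact ⟨t, ht⟩
    · rintro ⟨t, rfl⟩
      exact carrier_le hP t
  rw [this]
  exact (isCompact_range (continuous_toRealization y)).isClosed

lemma isOpen_le_carrier [T2Space (Realization P)] (x : P) :
    IsOpen {p : Realization P | x ≤ carrier hP p} := by
  have : {p : Realization P | x ≤ carrier hP p}ᶜ =
      ⋃ y ∈ {y : P | ¬ x ≤ y}, {p : Realization P | carrier hP p ≤ y} := by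
    ext p
    simp only [mem_compl_iff, mem_ofPred_eq, mem_iUnion, exists_prop]
    exact ⟨fun h => ⟨_, h, le_rfl⟩, fun ⟨y, hy, h⟩ h' => hy (h'.trans h)⟩
  rw [← isClosed_compl_iff, this]
  exact (toFinite _).isClosed_biUnion fun y _ => isClosed_carrier_le hP y

/-- The carrier contains a given face as soon as both lie in a common face and all coordinates at
the vertices of the given face are positive. -/
lemma le_carrier {p : Realization P} {x y : P} (hx : x ≤ y) (hp : carrier hP p ≤ y)
    (h : ∀ v, IsAtom v → v ≤ x → 0 < coord p v) : x ≤ carrier hP p :=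
  le_of_vertices hP hx hp fun v hv hvx => (le_carrier_iff hP p hv).2 (h v hv hvx)

end Points

section Affine

variable {P : Type*} [PartialOrder P] [OrderBot P] [Finite P]

open Classical in
/-- The affine combination `(1 - s) q + s p` of points of the closed face `y`, for `s` in the range
where it still lies in `y` (otherwise the junk value `q`). -/
noncomputable def comb (y : P) (q p : Realization P) (s : ℝ) : Realization P :=
  if h : (fun v : Vert y => (1 - s) * coord q v.1 + s * coord p v.1) ∈ stdSimplex ℝ (Vert y) then
    toRealization y ⟨_, h⟩ else q

variable (hP : IsSimplicialPoset P)

include hP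

lemma comb_mem {y : P} {q p : Realization P} {s : ℝ} (hq : carrier hP q ≤ y)
    (hp : carrier hP p ≤ y) (h0 : ∀ v, IsAtom v → v ≤ y → 0 ≤ (1 - s) * coord q v + s * coord p v) :
    (fun v : Vert y => (1 - s) * coord q v.1 + s * coord p v.1) ∈ stdSimplex ℝ (Vert y) := by
  refine ⟨fun v => h0 v.1 v.2.1 v.2.2, ?_⟩
  rw [Finset.sum_add_distrib, ← Finset.mul_sum, ← Finset.mul_sum, sum_coord hP hq, sum_coord hP hp]
  ring

lemma carrier_comb_le {y : P} {q p : Realization P} {s : ℝ} (hq : carrier hP q ≤ y) :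
    carrier hP (comb y q p s) ≤ y := by
  unfold comb
  split_ifs with h
  · exact carrier_le hP _
  · exact hq

lemma coord_comb {y : P} {q p : Realization P} {s : ℝ} (hq : carrier hP q ≤ y)
    (hp : carrier hP p ≤ y) (h0 : ∀ v, IsAtom v → v ≤ y → 0 ≤ (1 - s) * coord q v + s * coord p v)
    (v : P) : coord (comb y q p s) v = (1 - s) * coord q v + s * coord p v := by
  rw [comb, dif_pos (comb_mem hP hq hp h0)]
  by_cases h : IsAtom v ∧ v ≤ y
  · exact coord_toRealization _ (⟨v, h⟩ : Vert y)
  · rw [coord_toRealization_of_not _ h]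
    by_cases hv : IsAtom v
    · have hy : ¬ v ≤ y := fun h' => h ⟨hv, h'⟩
      rw [coord_eq_zero hP hq hy, coord_eq_zero hP hp hy]; ring
    · rw [coord_of_not_isAtom q hv, coord_of_not_isAtom p hv]; ring

lemma continuousOn_comb (y : P) (q : Realization P) (hq : carrier hP q ≤ y) :
    ContinuousOn (fun w : Realization P × ℝ => comb y q w.1 w.2)
      {w | carrier hP w.1 ≤ y ∧
        ∀ v, IsAtom v → v ≤ y → 0 ≤ (1 - w.2) * coord q v + w.2 * coord w.1 v} := by
  rw [continuousOn_iff_continuous_domRestrict]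
  have hc : Continuous fun w : {w : Realization P × ℝ | carrier hP w.1 ≤ y ∧
      ∀ v, IsAtom v → v ≤ y → 0 ≤ (1 - w.2) * coord q v + w.2 * coord w.1 v} =>
      (⟨_, comb_mem hP hq w.2.1 w.2.2⟩ : stdSimplex ℝ (Vert y)) := by
    refine Continuous.subtype_mk (continuous_pi fun v => ?_) _
    have h1 := (continuous_coord v.1).comp (continuous_fst.comp (continuous_subtype_val
      (p := fun w : Realization P × ℝ => w ∈ {w : Realization P × ℝ | carrier hP w.1 ≤ y ∧
      ∀ v, IsAtom v → v ≤ y → 0 ≤ (1 - w.2) * coord q v + w.2 * coord w.1 v})))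
    have h2 := continuous_snd.comp (continuous_subtype_val
      (p := fun w : Realization P × ℝ => w ∈ {w : Realization P × ℝ | carrier hP w.1 ≤ y ∧
      ∀ v, IsAtom v → v ≤ y → 0 ≤ (1 - w.2) * coord q v + w.2 * coord w.1 v}))
    exact ((continuous_const.sub h2).mul continuous_const).add (h2.mul h1)
  convert (continuous_toRealization y).comp hc using 1
  funext w
  exact dif_pos (comb_mem hP hq w.2.1 w.2.2)

lemma comb_one {y : P} {q p : Realization P} (hq : carrier hP q ≤ y)
    (hp : carrier hP p ≤ y) : comb y q p 1 = p := by
  refine realization_ext_of_le hP (carrier_comb_le hP hq) hp fun v => ?_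
  rw [coord_comb hP hq hp fun v _ _ => by simpa using coord_nonneg p v]
  ring

lemma comb_zero {y : P} {q p : Realization P} (hq : carrier hP q ≤ y)
    (hp : carrier hP p ≤ y) : comb y q p 0 = q := by
  refine realization_ext_of_le hP (carrier_comb_le hP hq) hq fun v => ?_
  rw [coord_comb hP hq hp fun v _ _ => by simpa using coord_nonneg q v]
  ring

end Affine

end SimplicialPoset

/-! ### Open stars of faces -/

namespace SimplicialPoset

open Set Topology AlexanderSpanier

section StarNorm

variable {P : Type*} [PartialOrder P] [OrderBot P] [Finite P] {x : P} [Nonempty (Vert x)]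

/-- The barycentre of a face. -/
noncomputable def bary (x : P) [Nonempty (Vert x)] : Realization P :=
  toRealization x stdSimplex.barycenter

/-- The number of vertices of a face, as a real number. -/
noncomputable def size (x : P) : ℝ := Fintype.card (Vert x)

lemma size_pos (x : P) [Nonempty (Vert x)] : 0 < size x := by
  unfold size
  exact_mod_cast Fintype.card_pos

lemma coord_bary {v : P} (hv : IsAtom v) (hvx : v ≤ x) : coord (bary x) v = (size x)⁻¹ :=
  coord_toRealization _ (⟨v, hv, hvx⟩ : Vert x)

lemma coord_bary_of_not_le {v : P} (hvx : ¬ v ≤ x) : coord (bary x) v = 0 :=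
  coord_toRealization_of_not _ fun h => hvx h.2

lemma carrier_bary (hP : IsSimplicialPoset P) : carrier hP (bary x) = x := by
  refine le_antisymm (carrier_le hP _) (le_carrier hP le_rfl (carrier_le hP _) fun v hv hvx => ?_)
  rw [coord_bary hv hvx]
  exact inv_pos.2 (size_pos x)

/-- The radial function around the barycentre of the face `x`.  It equals `0` at the barycentre and
is less than `1` where all coordinates at the vertices of `x` are positive. -/
noncomputable def starNorm (x : P) [Nonempty (Vert x)] (p : Realization P) : ℝ :=
  Finset.univ.sup' Finset.univ_nonempty fun v : Vert x => 1 - size x * coord p v.1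

lemma continuous_starNorm : Continuous (starNorm x) :=
  Continuous.finset_sup'_apply _ fun v _ =>
    continuous_const.sub (continuous_const.mul (continuous_coord v.1))

lemma le_starNorm (p : Realization P) {v : P} (hv : IsAtom v) (hvx : v ≤ x) :
    1 - size x * coord p v ≤ starNorm x p :=
  Finset.le_sup' (fun v : Vert x => 1 - size x * coord p v.1) (Finset.mem_univ ⟨v, hv, hvx⟩)

lemma exists_starNorm_eq (p : Realization P) :
    ∃ v, IsAtom v ∧ v ≤ x ∧ starNorm x p = 1 - size x * coord p v := by
  obtain ⟨v, -, h⟩ := Finset.exists_mem_eq_sup' Finset.univ_nonempty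
    fun v : Vert x => 1 - size x * coord p v.1
  exact ⟨v.1, v.2.1, v.2.2, h⟩

lemma starNorm_affine {p q : Realization P} {a b : ℝ} (ha : 0 ≤ a)
    (h : ∀ v, IsAtom v → v ≤ x → 1 - size x * coord q v = b + a * (1 - size x * coord p v)) :
    starNorm x q = b + a * starNorm x p := by
  apply le_antisymm
  · obtain ⟨v, hv, hvx, e⟩ := exists_starNorm_eq (x := x) q
    rw [e, h v hv hvx]
    have := mul_le_mul_of_nonneg_left (le_starNorm p hv hvx) ha
    linarith
  · obtain ⟨v, hv, hvx, e⟩ := exists_starNorm_eq (x := x) p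
    rw [e, ← h v hv hvx]
    exact le_starNorm q hv hvx

lemma coord_pos_of_starNorm_lt_one {p : Realization P} (h : starNorm x p < 1) {v : P}
    (hv : IsAtom v) (hvx : v ≤ x) : 0 < coord p v := by
  have h1 := le_starNorm p hv hvx
  have h2 := size_pos x
  by_contra! h3
  have := mul_nonpos_of_nonneg_of_nonpos h2.le h3
  linarith

lemma starNorm_bary : starNorm x (bary x) = 0 := by
  obtain ⟨v, hv, hvx, e⟩ := exists_starNorm_eq (x := x) (bary x)
  rw [e, coord_bary hv hvx, mul_inv_cancel₀ (size_pos x).ne', sub_self]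

variable (hP : IsSimplicialPoset P)

include hP

lemma starNorm_lt_one {p : Realization P} (h : x ≤ carrier hP p) : starNorm x p < 1 := by
  obtain ⟨v, hv, hvx, e⟩ := exists_starNorm_eq (x := x) p
  have h1 := (le_carrier_iff hP p hv).1 (hvx.trans h)
  have := mul_pos (size_pos x) h1
  linarith

/-- If all coordinates of `p` at the vertices of `x` are at least those of the barycentre, then `p`
is the barycentre. -/
lemma eq_bary_of_starNorm_nonpos {p : Realization P} (hp : x ≤ carrier hP p)
    (h : starNorm x p ≤ 0) : p = bary x := by
  have hb : carrier hP (bary x) ≤ carrier hP p := (carrier_bary hP).le.trans hp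
  have h0 : ∀ v, 0 ≤ coord p v - coord (bary x) v := by
    intro v
    by_cases hv : IsAtom v ∧ v ≤ x
    · rw [coord_bary hv.1 hv.2]
      have h1 := (le_starNorm p hv.1 hv.2).trans h
      have h2 := size_pos x
      rw [sub_nonneg, inv_le_iff_one_le_mul₀ h2]
      linarith
    · rw [bary, coord_toRealization_of_not _ hv, sub_zero]
      exact coord_nonneg p v
  have h1 : ∑ v : Vert (carrier hP p), (coord p v.1 - coord (bary x) v.1) = 0 := by
    rw [Finset.sum_sub_distrib, sum_coord hP le_rfl, sum_coord hP hb, sub_self]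
  have h2 := (Finset.sum_eq_zero_iff_of_nonneg fun v _ => h0 _).1 h1
  refine realization_ext_of_le hP le_rfl hb fun v => ?_
  by_cases hv : IsAtom v ∧ v ≤ carrier hP p
  · exact sub_eq_zero.1 (h2 (⟨v, hv⟩ : Vert (carrier hP p)) (Finset.mem_univ _))
  · by_cases ha : IsAtom v
    · have hn : ¬ v ≤ carrier hP p := fun h => hv ⟨ha, h⟩
      rw [coord_eq_zero hP le_rfl hn, coord_eq_zero hP hb hn]
    · rw [coord_of_not_isAtom p ha, coord_of_not_isAtom _ ha]

lemma starNorm_nonneg {p : Realization P} (hp : x ≤ carrier hP p) : 0 ≤ starNorm x p := by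
  by_contra! h
  have := eq_bary_of_starNorm_nonpos hP hp h.le
  rw [this, starNorm_bary] at h
  exact lt_irrefl _ h

/-- Rescaling by the factor `s` around the barycentre of `x`. -/
noncomputable def starScale (x : P) [Nonempty (Vert x)] (p : Realization P) (s : ℝ) :
    Realization P := comb (carrier hP p) (bary x) p s

lemma starScale_pos {p : Realization P} {s : ℝ} (hs : 0 < s) (h : s * starNorm x p < 1) {v : P}
    (hv : IsAtom v) (h' : v ≤ x ∨ v ≤ carrier hP p) :
    0 < (1 - s) * coord (bary x) v + s * coord p v := by
  by_cases hvx : v ≤ x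
  · rw [coord_bary hv hvx]
    have h1 := mul_le_mul_of_nonneg_left (le_starNorm p hv hvx) hs.le
    have h2 := size_pos x
    have h3 : (1 - s) * (size x)⁻¹ + s * coord p v =
        (1 - s * (1 - size x * coord p v)) / size x := by field_simp; ring
    rw [h3]
    exact div_pos (by linarith) h2
  · rw [coord_bary_of_not_le hvx]
    have := (le_carrier_iff hP p hv).1 (h'.resolve_left hvx)
    have := mul_pos hs this
    linarith

lemma starScale_nonneg {p : Realization P} {s : ℝ} (hs : 0 < s) (h : s * starNorm x p < 1) {v : P}
    (hv : IsAtom v) : 0 ≤ (1 - s) * coord (bary x) v + s * coord p v := by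
  by_cases hvx : v ≤ x
  · exact (starScale_pos hP hs h hv (Or.inl hvx)).le
  · rw [coord_bary_of_not_le hvx]
    have := mul_nonneg hs.le (coord_nonneg p v)
    linarith

lemma coord_starScale {p : Realization P} (hp : x ≤ carrier hP p) {s : ℝ} (hs : 0 < s)
    (h : s * starNorm x p < 1) (v : P) :
    coord (starScale hP x p s) v = (1 - s) * coord (bary x) v + s * coord p v :=
  coord_comb hP ((carrier_bary hP).le.trans hp) le_rfl
    (fun _ hv _ => starScale_nonneg hP hs h hv) v

lemma carrier_starScale {p : Realization P} (hp : x ≤ carrier hP p) {s : ℝ} (hs : 0 < s)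
    (h : s * starNorm x p < 1) : carrier hP (starScale hP x p s) = carrier hP p := by
  have h1 : carrier hP (starScale hP x p s) ≤ carrier hP p :=
    carrier_comb_le hP ((carrier_bary hP).le.trans hp)
  refine le_antisymm h1 (le_carrier hP le_rfl h1 fun v hv hvp => ?_)
  rw [coord_starScale hP hp hs h]
  exact starScale_pos hP hs h hv (Or.inr hvp)

lemma starNorm_starScale {p : Realization P} (hp : x ≤ carrier hP p) {s : ℝ} (hs : 0 < s)
    (h : s * starNorm x p < 1) : starNorm x (starScale hP x p s) = s * starNorm x p := by
  rw [starNorm_affine (b := 0) hs.le, zero_add]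
  intro v hv hvx
  rw [coord_starScale hP hp hs h, coord_bary hv hvx]
  have := (size_pos x).ne'
  field_simp
  ring

lemma starScale_starScale {p : Realization P} (hp : x ≤ carrier hP p) {s s' : ℝ} (hs : 0 < s)
    (hs' : 0 < s') (h : s * starNorm x p < 1) (h' : s' * (s * starNorm x p) < 1) :
    starScale hP x (starScale hP x p s) s' = starScale hP x p (s' * s) := by
  have e := carrier_starScale hP hp hs h
  have hp' : x ≤ carrier hP (starScale hP x p s) := hp.trans e.ge
  have h1 : s' * starNorm x (starScale hP x p s) < 1 := by rwa [starNorm_starScale hP hp hs h]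
  have h2 : s' * s * starNorm x p < 1 := by rwa [mul_assoc]
  refine realization_ext hP ?_ fun v => ?_
  · rw [carrier_starScale hP hp' hs' h1, e, carrier_starScale hP hp (mul_pos hs' hs) h2]
  · rw [coord_starScale hP hp' hs' h1, coord_starScale hP hp hs h,
      coord_starScale hP hp (mul_pos hs' hs) h2]
    ring

/-- Continuity can be checked on the closed faces. -/
lemma continuousOn_of_faces [T2Space (Realization P)] {Z : Type*} [TopologicalSpace Z]
    {f : Realization P × ℝ → Z} {D : Set (Realization P × ℝ)}
    (h : ∀ y, ContinuousOn f (D ∩ {w | carrier hP w.1 ≤ y})) : ContinuousOn f D := by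
  rw [continuousOn_iff_continuous_domRestrict]
  let S : P → Set D := fun y => {w | carrier hP w.1.1 ≤ y}
  refine (locallyFinite_of_finite S).continuous ?_ (fun y => ?_) (fun y => ?_)
  · exact eq_univ_of_forall fun w => mem_iUnion.2 ⟨carrier hP w.1.1, le_rfl⟩
  · exact (isClosed_carrier_le hP y).preimage (continuous_fst.comp continuous_subtype_val)
  · exact (h y).comp continuous_subtype_val.continuousOn fun w hw => ⟨w.2, hw⟩

lemma continuousOn_starScale [T2Space (Realization P)] :
    ContinuousOn (fun w : Realization P × ℝ => starScale hP x w.1 w.2)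
      {w | x ≤ carrier hP w.1 ∧ 0 < w.2 ∧ w.2 * starNorm x w.1 < 1} := by
  refine continuousOn_of_faces hP fun y => ?_
  by_cases hxy : x ≤ y
  · have hby : carrier hP (bary x) ≤ y := (carrier_bary hP).le.trans hxy
    refine ((continuousOn_comb hP y (bary x) hby).mono ?_).congr ?_
    · rintro w ⟨⟨h1, h2, h3⟩, h4⟩
      exact ⟨h4, fun v hv _ => starScale_nonneg hP h2 h3 hv⟩
    · rintro w ⟨⟨h1, h2, h3⟩, h4⟩
      have h4 : carrier hP w.1 ≤ y := h4
      refine realization_ext_of_le hP (y := y) ((carrier_starScale hP h1 h2 h3).le.trans h4)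
        (carrier_comb_le hP hby) fun v => ?_
      rw [coord_starScale hP h1 h2 h3,
        coord_comb hP hby h4 fun v hv _ => starScale_nonneg hP h2 h3 hv]
  · convert continuousOn_empty _
    rw [eq_empty_iff_forall_notMem]
    rintro w ⟨⟨h1, -⟩, h4⟩
    exact hxy (h1.trans h4)

/-- The part of the sphere of radius `1 / 2` around the barycentre of `x` that lies in the open
faces in `Q`. -/
def linkPart (x : P) [Nonempty (Vert x)] (Q : Set P) : Set (Realization P) :=
  {p | carrier hP p ∈ Q ∧ starNorm x p = 1 / 2}

lemma le_carrier_of_starNorm {p : Realization P} {y : P} (hxy : x ≤ y) (hp : carrier hP p ≤ y)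
    (h : starNorm x p ≤ 1 / 2) : x ≤ carrier hP p :=
  le_carrier hP hxy hp fun _ hv hvx =>
    coord_pos_of_starNorm_lt_one (h.trans_lt (by norm_num)) hv hvx

lemma isCompact_linkPart [T2Space (Realization P)] [CompactSpace (Realization P)] {Q : Set P}
    (h1 : ∀ y ∈ Q, x ≤ y) (h2 : ∀ y ∈ Q, ∀ z, x ≤ z → z ≤ y → z ∈ Q) :
    IsCompact (linkPart hP x Q) := by
  have : linkPart hP x Q =
      ⋃ y ∈ Q, ({p | carrier hP p ≤ y} ∩ {p | starNorm x p = 1 / 2}) := by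
    ext p
    simp only [linkPart, mem_ofPred_eq, mem_iUnion, exists_prop, mem_inter_iff]
    constructor
    · rintro ⟨h3, h4⟩
      exact ⟨_, h3, le_rfl, h4⟩
    · rintro ⟨y, hy, h3, h4⟩
      exact ⟨h2 y hy _ (le_carrier_of_starNorm hP (h1 y hy) h3 h4.le) h3, h4⟩
  rw [this]
  exact ((toFinite Q).isClosed_biUnion fun y _ => (isClosed_carrier_le hP y).inter
    (isClosed_eq continuous_starNorm continuous_const)).isCompact

lemma isCompact_half_star [T2Space (Realization P)] [CompactSpace (Realization P)] :
    IsCompact {p : Realization P | x ≤ carrier hP p ∧ starNorm x p ≤ 1 / 2} := by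
  have : {p : Realization P | x ≤ carrier hP p ∧ starNorm x p ≤ 1 / 2} =
      ⋃ y ∈ {y : P | x ≤ y}, ({p | carrier hP p ≤ y} ∩ {p | starNorm x p ≤ 1 / 2}) := by
    ext p
    simp only [mem_ofPred_eq, mem_iUnion, exists_prop, mem_inter_iff]
    constructor
    · rintro ⟨h3, h4⟩
      exact ⟨_, h3, le_rfl, h4⟩
    · rintro ⟨y, hy, h3, h4⟩
      exact ⟨le_carrier_of_starNorm hP hy h3 h4, h4⟩
  rw [this]
  exact ((toFinite {y : P | x ≤ y}).isClosed_biUnion fun y _ => (isClosed_carrier_le hP y).inter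
    (isClosed_le continuous_starNorm continuous_const)).isCompact

/-- The parts of the link in the faces properly containing `x` are star-shaped. -/
lemma exists_linkPart_center {y : P} (hxy : x < y) : ∃ q : Realization P,
    q ∈ linkPart hP x (Icc x y) ∧ ∀ p ∈ linkPart hP x (Icc x y), ∀ s ∈ Icc (0 : ℝ) 1,
      comb y q p s ∈ linkPart hP x (Icc x y) := by
  classical
  obtain ⟨u, hu, huy, hux⟩ : ∃ u, IsAtom u ∧ u ≤ y ∧ ¬ u ≤ x := by
    by_contra! h
    exact hxy.not_ge (le_of_vertices hP le_rfl hxy.le fun v hv hvy => h v hv hvy)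
  -- the midpoint of the barycentre and a vertex of `y` outside `x`
  let d : Realization P := toRealization y (stdSimplex.vertex (⟨u, hu, huy⟩ : Vert y))
  have hb : carrier hP (bary x) ≤ y := (carrier_bary hP).le.trans hxy.le
  have hd : carrier hP d ≤ y := carrier_le hP _
  have hdx : ∀ v, IsAtom v → v ≤ x → coord d v = 0 := fun v hv hvx => by
    refine (coord_toRealization _ (⟨v, hv, hvx.trans hxy.le⟩ : Vert y)).trans ?_
    change (Pi.single (⟨u, hu, huy⟩ : Vert y) (1 : ℝ) : Vert y → ℝ) ⟨v, hv, hvx.trans hxy.le⟩ = 0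
    refine Pi.single_eq_of_ne (fun h => hux ?_) 1
    exact (show v = u from congrArg (fun w : Vert y => w.1) h) ▸ hvx
  let q := comb y (bary x) d (1 / 2)
  have hq : carrier hP q ≤ y := carrier_comb_le hP hb
  have hqx : ∀ v, IsAtom v → v ≤ x → coord q v = (size x)⁻¹ / 2 := fun v hv hvx => by
    rw [coord_comb hP hb hd fun v _ _ => by
      have := coord_nonneg (bary x) v; have := coord_nonneg d v; linarith,
      hdx v hv hvx, coord_bary hv hvx]
    ring
  have hn := (size_pos x).ne'
  have mem : ∀ r : Realization P, carrier hP r ≤ y → starNorm x r = 1 / 2 →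
      r ∈ linkPart hP x (Icc x y) := fun r h1 h2 =>
    ⟨⟨le_carrier_of_starNorm hP hxy.le h1 h2.le, h1⟩, h2⟩
  refine ⟨q, mem q hq ?_, fun p hp s hs => mem _ (carrier_comb_le hP hq) ?_⟩
  · rw [starNorm_affine (p := q) (a := 0) (b := 1 / 2) le_rfl, zero_mul, add_zero]
    intro v hv hvx
    rw [hqx v hv hvx]
    field_simp
    ring
  · rw [starNorm_affine (p := p) (a := s) (b := (1 - s) / 2) hs.1, hp.2]
    · ring
    · intro v hv hvx
      rw [coord_comb hP hq hp.1.2, hqx v hv hvx]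
      · field_simp
        ring
      · intro v _ _
        have h1 := mul_nonneg (sub_nonneg.2 hs.2) (coord_nonneg q v)
        have h2 := mul_nonneg hs.1 (coord_nonneg p v)
        linarith

end StarNorm

section Sphere

variable {P : Type*} [PartialOrder P] [OrderBot P] [Finite P] {x : P} [Nonempty (Vert x)]

open Classical in
/-- The inclusion of the closed face `x`, extended to all vectors by a junk value. -/
noncomputable def faceMap (x : P) [Nonempty (Vert x)] (t : Vert x → ℝ) : Realization P :=
  if h : t ∈ stdSimplex ℝ (Vert x) then toRealization x ⟨t, h⟩ else bary x

lemma continuousOn_faceMap : ContinuousOn (faceMap x) (stdSimplex ℝ (Vert x)) := by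
  rw [continuousOn_iff_continuous_domRestrict]
  convert continuous_toRealization x using 1
  funext t
  exact dif_pos t.2

lemma coord_faceMap {t : Vert x → ℝ} (ht : t ∈ stdSimplex ℝ (Vert x)) (v : Vert x) :
    coord (faceMap x t) v.1 = t v := by
  rw [faceMap, dif_pos ht]
  exact coord_toRealization _ v

lemma carrier_faceMap (hP : IsSimplicialPoset P) (t : Vert x → ℝ) :
    carrier hP (faceMap x t) ≤ x := by
  unfold faceMap
  split_ifs
  · exact carrier_le hP _
  · exact carrier_le hP _

/-- Contraction towards the barycentre by the factor `1 / 2`, in barycentric coordinates. -/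
noncomputable def shrink (x : P) (t : Vert x → ℝ) : Vert x → ℝ := fun v => ((size x)⁻¹ + t v) / 2

lemma shrink_mem {t : Vert x → ℝ} (ht : t ∈ stdSimplex ℝ (Vert x)) :
    shrink x t ∈ stdSimplex ℝ (Vert x) := by
  have h := size_pos x
  refine ⟨fun v => ?_, ?_⟩
  · have := ht.1 v
    have := inv_pos.2 h
    simp only [shrink]
    linarith
  · simp only [shrink]
    rw [← Finset.sum_div, Finset.sum_add_distrib, ht.2, Finset.sum_const, nsmul_eq_mul,
      Finset.card_univ]
    change (size x * _ + 1) / 2 = 1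
    rw [mul_inv_cancel₀ h.ne']
    norm_num

end Sphere

end SimplicialPoset

/-! ### Links of faces -/

namespace SimplicialPoset

open Set Topology AlexanderSpanier TopologicalSpace

section Link

variable {P : Type*} [PartialOrder P] [OrderBot P] [Finite P]

/-- A metric that induces the topology of the realization. -/
noncomputable abbrev realizationMetric [MetrizableSpace (Realization P)] :
    MetricSpace (Realization P) := metrizableSpaceMetric (Realization P)

attribute [local instance] realizationMetric

variable {x : P} [Nonempty (Vert x)] [MetrizableSpace (Realization P)]
  [CompactSpace (Realization P)]

variable (hP : IsSimplicialPoset P)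

include hP

/-- The part of the link in the open face `x` itself is a copy of the boundary of this face. -/
lemma betti_linkPart_self : (∀ p, FiniteDimensional (ZMod 2) (Cohom (linkPart hP x {x}) p)) ∧
    ∀ p, betti (linkPart hP x {x}) p = if p + 1 = Nat.card (Vert x) then 1 else 0 := by
  have hs := size_pos x
  have hK : IsCompact (linkPart hP x {x}) :=
    isCompact_linkPart hP (fun y hy => (mem_singleton_iff.1 hy).ge)
      fun y hy z h1 h2 => le_antisymm (h2.trans (mem_singleton_iff.1 hy).le) h1
  have e := nonempty_cohom_equiv_of_inverse (A := linkPart hP x {x})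
    (B := simplexBoundary (Finset.univ : Finset (Vert x))) (f := fun p v => 2 * coord p v.1 - (size x)⁻¹)
    (g := fun t => faceMap x (shrink x t)) hK (isCompact_simplexBoundary _) ?_ ?_ ?_ ?_ ?_ ?_
  · obtain ⟨h1, h2⟩ := betti_simplexBoundary (Finset.univ : Finset (Vert x)) Finset.univ_nonempty
    refine ⟨fun p => Module.Finite.equiv (e p).some.symm, fun p => ?_⟩
    have h3 := h2 p
    rw [Finset.card_univ, ← Nat.card_eq_fintype_card] at h3
    exact (e p).some.finrank_eq.trans h3
  · refine Continuous.continuousOn (continuous_pi fun v => ?_)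
    exact (continuous_const.mul (continuous_coord v.1)).sub continuous_const
  · refine (continuousOn_faceMap (x := x)).comp (Continuous.continuousOn ?_) fun t ht =>
      shrink_mem ht.1
    unfold shrink
    fun_prop
  · rintro p ⟨hp, hN⟩
    rw [mem_singleton_iff] at hp
    refine ⟨⟨fun v => ?_, ?_⟩, fun i hi => absurd (Finset.mem_univ i) hi, ?_⟩
    · have := le_starNorm (x := x) p v.2.1 v.2.2
      rw [hN] at this
      rw [sub_nonneg, inv_le_iff_one_le_mul₀ hs]
      linarith
    · rw [Finset.sum_sub_distrib, ← Finset.mul_sum, sum_coord hP hp.le, Finset.sum_const,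
        nsmul_eq_mul, Finset.card_univ]
      change 2 * 1 - size x * (size x)⁻¹ = 1
      rw [mul_inv_cancel₀ hs.ne']
      norm_num
    · obtain ⟨v, hv, hvx, h⟩ := exists_starNorm_eq (x := x) p
      refine ⟨⟨v, hv, hvx⟩, Finset.mem_univ _, ?_⟩
      rw [hN] at h
      change 2 * coord p v - (size x)⁻¹ = 0
      field_simp
      linarith
  · rintro t ⟨ht, -, i, -, hi⟩
    have h1 := coord_faceMap (shrink_mem ht)
    have hN : starNorm x (faceMap x (shrink x t)) = 1 / 2 := by
      apply le_antisymm
      · obtain ⟨v, hv, hvx, h⟩ := exists_starNorm_eq (x := x) (faceMap x (shrink x t))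
        have h2 := h1 (⟨v, hv, hvx⟩ : Vert x)
        have h3 := mul_nonneg hs.le (ht.1 (⟨v, hv, hvx⟩ : Vert x))
        change coord (faceMap x (shrink x t)) v = ((size x)⁻¹ + t (⟨v, hv, hvx⟩ : Vert x)) / 2 at h2
        rw [h, h2]
        have h4 := mul_inv_cancel₀ hs.ne'
        linarith
      · refine le_trans (le_of_eq ?_) (le_starNorm _ i.2.1 i.2.2)
        rw [h1 i, shrink, hi]
        field_simp
        ring
    refine ⟨?_, hN⟩
    exact le_antisymm (carrier_faceMap hP _)
      (le_carrier_of_starNorm hP le_rfl (carrier_faceMap hP _) hN.le)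
  · rintro p ⟨hp, hN⟩
    rw [mem_singleton_iff] at hp
    have hsh : shrink x (fun v => 2 * coord p v.1 - (size x)⁻¹) = fun v => coord p v.1 := by
      funext v
      simp only [shrink]
      ring
    have hm : (fun v : Vert x => coord p v.1) ∈ stdSimplex ℝ (Vert x) :=
      ⟨fun v => coord_nonneg p v.1, sum_coord hP hp.le⟩
    change faceMap x (shrink x (fun v => 2 * coord p v.1 - (size x)⁻¹)) = p
    rw [hsh]
    refine realization_ext_of_le hP (carrier_faceMap hP _) hp.le fun v => ?_
    by_cases hv : IsAtom v ∧ v ≤ x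
    · exact coord_faceMap hm (⟨v, hv⟩ : Vert x)
    · by_cases ha : IsAtom v
      · have hn : ¬ v ≤ x := fun h => hv ⟨ha, h⟩
        rw [coord_eq_zero hP hp.le hn, coord_eq_zero hP (carrier_faceMap hP _) hn]
      · rw [coord_of_not_isAtom p ha, coord_of_not_isAtom _ ha]
  · rintro t ⟨ht, -⟩
    funext v
    rw [coord_faceMap (shrink_mem ht), shrink]
    ring

lemma hasEuler_linkPart_self : HasEuler (linkPart hP x {x}) (-(-1) ^ Nat.card (Vert x)) := by
  obtain ⟨h1, h2⟩ := betti_linkPart_self (x := x) hP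
  have h3 : 0 < Nat.card (Vert x) := Nat.card_pos
  obtain ⟨n, hn⟩ := Nat.exists_eq_succ_of_ne_zero h3.ne'
  rw [hn, pow_succ, mul_neg_one, neg_neg]
  refine hasEuler_of_betti h1 n fun p => ?_
  rw [h2, hn]
  simp

/-- The part of the link in a face properly containing `x` is contractible. -/
lemma hasEuler_linkPart_Icc {y : P} (hxy : x < y) : HasEuler (linkPart hP x (Icc x y)) 0 := by
  refine hasEuler_of_acyclic fun p => ?_
  obtain ⟨q, hq, h⟩ := exists_linkPart_center hP hxy
  have hK : IsCompact (linkPart hP x (Icc x y)) :=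
    isCompact_linkPart hP (fun z hz => hz.1) fun z hz w h1 h2 => ⟨h1, h2.trans hz.2⟩
  refine subsingleton_cohom_of_contraction hK (fun w => comb y q w.1 (1 - w.2)) ?_ ?_ q hq ?_ ?_ p
  · refine (continuousOn_comb hP y q hq.1.2).comp (f := fun w : Realization P × ℝ => (w.1, 1 - w.2))
      (continuous_fst.prodMk (continuous_const.sub continuous_snd)).continuousOn ?_
    rintro ⟨p, s⟩ ⟨hp, hs⟩
    refine ⟨hp.1.2, fun v _ _ => ?_⟩
    have h1 := mul_nonneg hs.1 (coord_nonneg q v)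
    have h2 := mul_nonneg (sub_nonneg.2 hs.2) (coord_nonneg p v)
    simp only at h1 h2 ⊢
    linarith
  · rintro ⟨p, s⟩ ⟨hp, hs⟩
    exact h p hp (1 - s) ⟨sub_nonneg.2 hs.2, sub_le_self _ hs.1⟩
  · intro p hp
    simp only [sub_zero]
    exact comb_one hP hq.1.2 hp.1.2
  · intro p hp
    simp only [sub_self]
    exact comb_zero hP hq.1.2 hp.1.2

/-- The Euler characteristic of the part of the link in a set of faces above `x`: remove a maximal
face from this set, and use that the link in this face is contractible. -/
theorem hasEuler_linkPart (Q : Finset P) (hne : Q.Nonempty) (h1 : ∀ y ∈ Q, x ≤ y)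
    (h2 : ∀ y ∈ Q, ∀ z, x ≤ z → z ≤ y → z ∈ Q) :
    HasEuler (linkPart hP x Q) (∑ y ∈ Q, -(-1) ^ Nat.card (Vert y)) := by
  classical
  have : Fintype P := Fintype.ofFinite P
  induction Q using Finset.strongInduction with | H Q ih => ?_
  obtain ⟨i, hi⟩ := Q.exists_maximal hne
  have hiQ : i ∈ Q := hi.prop
  have hxi : x ≤ i := h1 i hiQ
  rcases hxi.eq_or_lt with rfl | hlt
  · have : Q = {x} := by
      ext y
      rw [Finset.mem_singleton]
      exact ⟨fun hy => hi.eq_of_ge hy (h1 y hy), fun hy => hy ▸ hiQ⟩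
    rw [this, Finset.sum_singleton, Finset.coe_singleton]
    exact hasEuler_linkPart_self hP
  · set I : Finset P := {z | x ≤ z ∧ z ≤ i} with hI
    have hxQ : x ∈ Q := h2 i hiQ x le_rfl hxi
    have memI : ∀ z, z ∈ I ↔ x ≤ z ∧ z ≤ i := fun z => by simp [hI]
    have hIQ : I ⊆ Q := fun z hz => h2 i hiQ z ((memI z).1 hz).1 ((memI z).1 hz).2
    have hiI : i ∈ I := (memI i).2 ⟨hxi, le_rfl⟩
    have lowQ : ∀ y ∈ Q.erase i, ∀ z, x ≤ z → z ≤ y → z ∈ Q.erase i := by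
      intro y hy z hxz hzy
      refine Finset.mem_erase.2 ⟨?_, h2 y (Finset.mem_of_mem_erase hy) z hxz hzy⟩
      rintro rfl
      exact Finset.ne_of_mem_erase hy (hi.eq_of_ge (Finset.mem_of_mem_erase hy) hzy)
    have lowI : ∀ y ∈ I.erase i, ∀ z, x ≤ z → z ≤ y → z ∈ I.erase i := by
      intro y hy z hxz hzy
      have hyi := ((memI y).1 (Finset.mem_of_mem_erase hy)).2
      refine Finset.mem_erase.2 ⟨?_, (memI z).2 ⟨hxz, hzy.trans hyi⟩⟩
      rintro rfl
      exact Finset.ne_of_mem_erase hy (le_antisymm hyi hzy)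
    have eA := ih (Q.erase i) (Finset.erase_ssubset hiQ) ⟨x, Finset.mem_erase.2 ⟨hlt.ne, hxQ⟩⟩
      (fun y hy => h1 y (Finset.mem_of_mem_erase hy)) lowQ
    have eI := ih (I.erase i) ((Finset.erase_ssubset hiI).trans_subset hIQ)
      ⟨x, Finset.mem_erase.2 ⟨hlt.ne, (memI x).2 ⟨le_rfl, hxi⟩⟩⟩
      (fun y hy => h1 y (hIQ (Finset.mem_of_mem_erase hy))) lowI
    have cA : IsCompact (linkPart hP x (Q.erase i : Finset P)) := isCompact_linkPart hP
      (fun y hy => h1 y (Finset.mem_of_mem_erase hy)) lowQ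
    have cB : IsCompact (linkPart hP x (Icc x i)) :=
      isCompact_linkPart hP (fun z hz => hz.1) fun z hz w h1 h2 => ⟨h1, h2.trans hz.2⟩
    have hinter : linkPart hP x (Q.erase i : Finset P) ∩ linkPart hP x (Icc x i) =
        linkPart hP x (I.erase i : Finset P) := by
      ext p
      simp only [linkPart, mem_inter_iff, mem_ofPred_eq, Finset.mem_coe, Finset.mem_erase, mem_Icc,
        memI]
      constructor
      · rintro ⟨⟨⟨h3, -⟩, h4⟩, h5, -⟩
        exact ⟨⟨h3, h5⟩, h4⟩
      · rintro ⟨⟨h3, h5⟩, h4⟩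
        exact ⟨⟨⟨h3, hIQ ((memI _).2 h5)⟩, h4⟩, h5, h4⟩
    have hunion : linkPart hP x (Q.erase i : Finset P) ∪ linkPart hP x (Icc x i) =
        linkPart hP x Q := by
      ext p
      simp only [linkPart, mem_union, mem_ofPred_eq, Finset.mem_coe, Finset.mem_erase, mem_Icc]
      constructor
      · rintro (⟨⟨-, h3⟩, h4⟩ | ⟨h5, h4⟩)
        · exact ⟨h3, h4⟩
        · exact ⟨hIQ ((memI _).2 h5), h4⟩
      · rintro ⟨h3, h4⟩
        by_cases h : carrier hP p = i
        · exact Or.inr ⟨h.symm ▸ ⟨hxi, le_rfl⟩, h4⟩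
        · exact Or.inl ⟨⟨h, h3⟩, h4⟩
    have key := eA.union cA cB (hasEuler_linkPart_Icc hP hlt) (hinter ▸ eI)
    rw [hunion] at key
    convert key using 1
    have s1 := Finset.sum_erase_add Q (fun y => -(-1 : ℤ) ^ Nat.card (Vert y)) hiQ
    have s2 := Finset.sum_erase_add I (fun y => -(-1 : ℤ) ^ Nat.card (Vert y)) hiI
    have s3 : ∑ y ∈ I, -(-1 : ℤ) ^ Nat.card (Vert y) = 0 := by
      rw [Finset.sum_neg_distrib, neg_eq_zero]
      convert sum_Icc_neg_one_pow hP hlt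
    linarith

/-- The open star of a face is a conical neighbourhood of its barycentre. -/
noncomputable def starCone (x : P) [Nonempty (Vert x)] : ConeNhd (Realization P) (bary x) where
  W := {p | x ≤ carrier hP p}
  N := starNorm x
  scale := starScale hP x
  isOpen_W := isOpen_le_carrier hP x
  mem_W := (carrier_bary hP).ge
  N_center := starNorm_bary
  N_nonneg _ hy := starNorm_nonneg hP hy
  N_lt_one _ hy := starNorm_lt_one hP hy
  eq_center _ hy h := eq_bary_of_starNorm_nonpos hP hy h.le
  continuousOn_N := continuous_starNorm.continuousOn
  scale_mem _ hy _ hs h := LE.le.trans hy (carrier_starScale hP hy hs h).ge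
  N_scale _ hy _ hs h := starNorm_starScale hP hy hs h
  scale_one _ hy := comb_one hP ((carrier_bary hP).le.trans hy) le_rfl
  scale_scale _ hy _ _ hs hs' h h' := starScale_starScale hP hy hs hs' h h'
  continuousOn_scale := continuousOn_starScale hP
  isCompact_half := isCompact_half_star hP

lemma link_starCone : (starCone hP x).link = linkPart hP x {y | x ≤ y} := rfl

omit [CompactSpace (Realization P)] in
/-- In a closed `3`-manifold the link of every face has the Betti numbers of a `2`-sphere. -/
lemma betti_link (hM : IsClosedThreeManifold (Realization P)) (p : ℕ) :
    betti (linkPart hP x {y | x ≤ y}) p = if p = 3 then 1 else 0 := by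
  have := hM.compact
  obtain ⟨hC⟩ := hM.charts
  let φ := chartAt (EuclideanSpace ℝ (Fin 3)) (bary x)
  rw [← link_starCone, ← (euclideanCone_link (φ (bary x))).2 p]
  exact ConeNhd.betti_link_eq (starCone hP x) (euclideanCone (φ (bary x))) φ
    (mem_chart_source _ _) rfl p

end Link

section Manifold

variable {P : Type*} [PartialOrder P] [OrderBot P] [Finite P] {x : P}
  (hP : IsSimplicialPoset P) (hM : IsClosedThreeManifold (Realization P))

include hP hM

open Classical in
/-- The Euler characteristic of the link of a face. -/
theorem sum_link [Fintype P] (hx : x ≠ ⊥) :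
    ∑ y : P with x ≤ y, (-1 : ℤ) ^ Nat.card (Vert y) = 1 := by
  have := hM.compact
  have := hM.hausdorff
  have := hM.secondCountable
  obtain ⟨v, hv, hvx⟩ := exists_vertex hP hx
  have : Nonempty (Vert x) := ⟨⟨v, hv, hvx⟩⟩
  let : MetricSpace (Realization P) := realizationMetric
  have h1 := hasEuler_linkPart (x := x) hP {y | x ≤ y} ⟨x, by simp⟩ (by simp)
    (fun y _ z hz _ => by simpa using hz)
  have h2 := euclideanCone_link (n := 3) 0
  have h3 := h1.unique (hasEuler_of_betti h2.1 3 h2.2) fun p => by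
    rw [h2.2 p, ← betti_link (x := x) hP hM p]
    simp
  rw [Finset.sum_neg_distrib] at h3
  linarith

/-- Every maximal face is a tetrahedron. -/
theorem card_vert_of_isMax (hx : x ≠ ⊥) (hmax : ∀ y, x ≤ y → y = x) : Nat.card (Vert x) = 4 := by
  have := hM.compact
  have := hM.hausdorff
  have := hM.secondCountable
  obtain ⟨v, hv, hvx⟩ := exists_vertex hP hx
  have : Nonempty (Vert x) := ⟨⟨v, hv, hvx⟩⟩
  have h : {y | x ≤ y} = {x} := by
    ext y
    exact ⟨hmax y, fun h => (mem_singleton_iff.1 h).ge⟩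
  have h1 := betti_link (x := x) hP hM 3
  rw [h, (betti_linkPart_self hP).2, if_pos rfl] at h1
  by_contra hne
  rw [if_neg (fun h => hne h.symm)] at h1
  exact zero_ne_one h1

end Manifold

end SimplicialPoset

/-! ### Face numbers -/

namespace SimplicialPoset

open Set

section Counting

variable {P : Type*} [PartialOrder P] [OrderBot P]

/-- The set of vertices of a face. -/
def verts (x : P) : Set P := {v | IsAtom v ∧ v ≤ x}

lemma card_vert (x : P) : Nat.card (Vert x) = (verts x).ncard := rfl

lemma verts_mono {x y : P} (h : x ≤ y) : verts x ⊆ verts y := fun _ hv => ⟨hv.1, hv.2.trans h⟩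

lemma verts_bot : verts (⊥ : P) = ∅ :=
  eq_empty_iff_forall_notMem.2 fun _ hv => hv.1.1 (le_bot_iff.1 hv.2)

lemma verts_atom {v : P} (hv : IsAtom v) : verts v = {v} := by
  ext w
  exact ⟨fun h => (hv.le_iff_eq h.1.1).1 h.2, by rintro rfl; exact ⟨hv, le_rfl⟩⟩

section

variable (hP : IsSimplicialPoset P)

include hP

lemma le_of_verts {x y z : P} (hy : y ≤ x) (hz : z ≤ x) (h : verts y ⊆ verts z) : y ≤ z :=
  le_of_vertices hP hy hz fun _ hv hvy => (h ⟨hv, hvy⟩).2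

lemma eq_of_verts {x y z : P} (hy : y ≤ x) (hz : z ≤ x) (h : verts y = verts z) : y = z :=
  le_antisymm (le_of_verts hP hy hz h.le) (le_of_verts hP hz hy h.ge)

lemma exists_face_verts {x : P} {s : Set P} (hs : s ⊆ verts x) : ∃ y ≤ x, verts y = s := by
  obtain ⟨y, hy, h⟩ := exists_face hP x s
  refine ⟨y, hy, Set.ext fun v => ⟨fun hv => ((h v hv.1).1 hv.2).2, fun hv => ?_⟩⟩
  exact ⟨(hs hv).1, (h v (hs hv).1).2 ⟨(hs hv).2, hv⟩⟩

/-- A face with `n` vertices has `n` choose `r` faces with `r` vertices. -/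
lemma card_faces_le [Finite P] (x : P) (r : ℕ) :
    {y | y ≤ x ∧ Nat.card (Vert y) = r}.ncard = (Nat.card (Vert x)).choose r := by
  have hc : ∀ y : P, (toFinite (verts y)).toFinset.card = Nat.card (Vert y) := fun y =>
    (ncard_eq_toFinset_card _ _).symm
  rw [← hc, ← Finset.card_powersetCard, ← ncard_coe_finset]
  refine Set.ncard_congr (fun y _ => (toFinite (verts y)).toFinset) ?_ ?_ ?_
  · rintro y ⟨h1, h2⟩
    rw [Finset.mem_coe, Finset.mem_powersetCard, hc]
    exact ⟨Finite.toFinset_subset_toFinset.2 (verts_mono h1), h2⟩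
  · rintro y z ⟨h1, -⟩ ⟨h2, -⟩ h
    exact eq_of_verts hP h1 h2 (Finite.toFinset_inj.1 h)
  · intro s hs
    rw [Finset.mem_coe, Finset.mem_powersetCard] at hs
    obtain ⟨y, hy, h⟩ := exists_face_verts hP (x := x) (s := s) fun v hv => by
      simpa using hs.1 hv
    have h' : (toFinite (verts y)).toFinset = s := by
      ext v
      simp [h]
    exact ⟨y, ⟨hy, by rw [← hc, h', hs.2]⟩, h'⟩

lemma card_vert_eq_zero [Finite P] {x : P} : Nat.card (Vert x) = 0 ↔ x = ⊥ := by
  rw [card_vert, ncard_eq_zero (toFinite _), ← verts_bot]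
  exact ⟨fun h => eq_of_verts hP le_rfl bot_le h, fun h => h ▸ rfl⟩

lemma card_vert_lt [Finite P] {x y : P} (h : x < y) : Nat.card (Vert x) < Nat.card (Vert y) := by
  refine (ncard_le_ncard (verts_mono h.le) (toFinite _)).lt_of_ne fun he => h.ne ?_
  exact eq_of_verts hP h.le le_rfl (eq_of_subset_of_ncard_le (verts_mono h.le) he.ge (toFinite _))

lemma isAtom_iff_card_vert [Finite P] {x : P} : IsAtom x ↔ Nat.card (Vert x) = 1 := by
  refine ⟨fun h => by rw [card_vert, verts_atom h, ncard_singleton], fun h => ?_⟩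
  have hx : x ≠ ⊥ := by
    rintro rfl
    rw [card_vert, verts_bot, ncard_empty] at h
    exact zero_ne_one h
  obtain ⟨v, hv, hvx⟩ := exists_vertex hP hx
  rcases hvx.eq_or_lt with rfl | hlt
  · exact hv
  · have := card_vert_lt hP hlt
    rw [h, card_vert, verts_atom hv, ncard_singleton] at this
    exact absurd this (lt_irrefl _)

end

variable [Fintype P]

open Classical in
lemma faceNumber_eq (i : ℕ) : faceNumber P i = Finset.card {x : P | Nat.card (Vert x) = i + 1} := by
  unfold faceNumber Face
  rw [Nat.card_eq_fintype_card, Fintype.card_subtype]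

open Classical in
/-- Grouping the faces by their number of vertices expresses a sum over all faces by the face
numbers. -/
lemma sum_card_vert (h4 : ∀ x : P, Nat.card (Vert x) ≤ 4) (F : ℕ → ℚ)
    (F0 : F 0 = 0) : ∑ x : P, F (Nat.card (Vert x)) = faceNumber P 0 * F 1 + faceNumber P 1 * F 2 +
      faceNumber P 2 * F 3 + faceNumber P 3 * F 4 := by
  have key : ∑ x : P, F (Nat.card (Vert x)) =
      ∑ r ∈ Finset.range 5, (Finset.card {x : P | Nat.card (Vert x) = r} : ℚ) * F r := by
    rw [← Finset.sum_fiberwise_of_maps_to (s := Finset.univ) (t := Finset.range 5)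
      (g := fun x : P => Nat.card (Vert x)) fun x _ => Finset.mem_range.2 (Nat.lt_succ_of_le (h4 x))]
    refine Finset.sum_congr rfl fun r _ => ?_
    rw [← nsmul_eq_mul, ← Finset.sum_const]
    exact Finset.sum_congr rfl fun x hx => by rw [(Finset.mem_filter.1 hx).2]
  rw [key]
  simp only [Finset.sum_range_succ, Finset.sum_range_zero, F0, faceNumber_eq]
  ring

section

variable (hP : IsSimplicialPoset P) (hM : IsClosedThreeManifold (Realization P))

include hP hM

lemma card_vert_le_four (x : P) : Nat.card (Vert x) ≤ 4 := by
  obtain ⟨y, hxy, hy⟩ := Finite.exists_le_maximal (p := fun _ : P => True) (a := x) trivial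
  by_cases h : y = ⊥
  · have : x = ⊥ := le_bot_iff.1 (h ▸ hxy)
    rw [(card_vert_eq_zero hP).2 this]
    exact Nat.zero_le _
  · rw [← card_vert_of_isMax hP hM h fun z hz => hy.eq_of_ge trivial hz]
    exact ncard_le_ncard (verts_mono hxy) (toFinite _)

open Classical in
/-- Every triangle lies in exactly two tetrahedra. -/
lemma card_tetrahedra {x : P} (hx : Nat.card (Vert x) = 3) :
    Finset.card {y : P | x ≤ y ∧ Nat.card (Vert y) = 4} = 2 := by
  have hb : x ≠ ⊥ := fun h => by rw [(card_vert_eq_zero hP).2 h] at hx; omega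
  have h1 := sum_link hP hM hb
  have h2 : (Finset.univ.filter fun y : P => x ≤ y) =
      insert x ({y : P | x ≤ y ∧ Nat.card (Vert y) = 4} : Finset P) := by
    ext y
    simp only [Finset.mem_filter, Finset.mem_univ, true_and, Finset.mem_insert]
    constructor
    · intro h
      rcases h.eq_or_lt with rfl | hlt
      · exact Or.inl rfl
      · have := card_vert_lt hP hlt
        have := card_vert_le_four hP hM y
        exact Or.inr ⟨h, by omega⟩
    · rintro (rfl | h)
      · exact le_rfl
      · exact h.1
  rw [h2, Finset.sum_insert (fun h => by
    have := (Finset.mem_filter.1 h).2.2; omega), hx, Finset.sum_congr rfl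
    (g := fun _ => (1 : ℤ)) fun y hy => by rw [(Finset.mem_filter.1 hy).2.2]; norm_num] at h1
  rw [Finset.sum_const, nsmul_eq_mul, mul_one] at h1
  omega

/-- Double counting of the incidences of triangles and tetrahedra. -/
theorem faceNumber_two : faceNumber P 2 = 2 * faceNumber P 3 := by
  classical
  have h := Finset.sum_card_bipartiteAbove_eq_sum_card_bipartiteBelow (fun x y : P => x ≤ y)
    (s := {x : P | Nat.card (Vert x) = 3}) (t := {x : P | Nat.card (Vert x) = 4})
  rw [Finset.sum_congr rfl (g := fun _ => 2), Finset.sum_congr rfl (s₁ := {x : P | Nat.card (Vert x) = 4})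
    (g := fun _ => 4), Finset.sum_const, Finset.sum_const, ← faceNumber_eq 2, ← faceNumber_eq 3] at h
  · simp only [smul_eq_mul] at h
    omega
  · intro y hy
    have := card_faces_le hP y 3
    rw [(Finset.mem_filter.1 hy).2, Set.ncard_eq_toFinset_card'] at this
    rw [Finset.bipartiteBelow, Finset.filter_filter]
    refine Eq.trans ?_ this
    congr 1
    ext z
    simp [and_comm]
  · intro x hx
    rw [← card_tetrahedra hP hM (Finset.mem_filter.1 hx).2]
    rw [Finset.bipartiteAbove, Finset.filter_filter]
    congr 1
    ext z
    simp [and_comm]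

/-- Summation of the Euler characteristics of the links of the vertices. -/
theorem faceNumber_three : (faceNumber P 3 : ℚ) = faceNumber P 1 - faceNumber P 0 := by
  classical
  have h1 : ∑ v : P with Nat.card (Vert v) = 1, ∑ y : P with v ≤ y, (-1 : ℤ) ^ Nat.card (Vert y) =
      faceNumber P 0 := by
    rw [Finset.sum_congr rfl (g := fun _ => 1), Finset.sum_const, ← faceNumber_eq 0]
    · simp
    · intro v hv
      refine sum_link hP hM fun h => ?_
      have := (Finset.mem_filter.1 hv).2
      rw [(card_vert_eq_zero hP).2 h] at this
      omega
  have h2 : ∑ v : P with Nat.card (Vert v) = 1, ∑ y : P with v ≤ y, (-1 : ℤ) ^ Nat.card (Vert y) =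
      ∑ y : P, (Nat.card (Vert y) : ℤ) * (-1) ^ Nat.card (Vert y) := by
    rw [Finset.sum_comm' (t' := Finset.univ)
      (s' := fun y => {v : P | v ≤ y ∧ Nat.card (Vert v) = 1}) (by intros; simp [and_comm])]
    refine Finset.sum_congr rfl fun y _ => ?_
    have := card_faces_le hP y 1
    rw [Nat.choose_one_right, Set.ncard_eq_toFinset_card'] at this
    rw [Finset.sum_const, nsmul_eq_mul]
    congr 2
    refine Eq.trans ?_ this
    congr 1
    ext z
    simp
  have h3 := sum_card_vert (card_vert_le_four hP hM) (fun r => (r : ℚ) * (-1) ^ r) (by simp)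
  rw [h2] at h1
  have h4 : ∑ y : P, (Nat.card (Vert y) : ℚ) * (-1) ^ Nat.card (Vert y) = faceNumber P 0 := by
    exact_mod_cast h1
  rw [h4] at h3
  have h5 : (faceNumber P 2 : ℚ) = 2 * faceNumber P 3 := by exact_mod_cast faceNumber_two hP hM
  norm_num [h5] at h3
  linarith

end

end Counting

end SimplicialPoset

/-! ### Potentials of cocycles and cells of the normal surface -/

namespace SimplicialPoset

open Set

section Potential

lemma zmod_two_add_eq_one {a b : ZMod 2} : a + b = 1 ↔ (a = 1 ∧ b ≠ 1) ∨ (a ≠ 1 ∧ b = 1) := by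
  revert a b
  decide

variable {P : Type*} [PartialOrder P] [OrderBot P]

lemma ncard_verts_edge (e : Face P 1) : (verts e.1).ncard = 2 := e.2

lemma exists_verts_edge (e : Face P 1) : ∃ v w, v ≠ w ∧ verts e.1 = {v, w} :=
  ncard_eq_two.1 (ncard_verts_edge e)

lemma exists_verts_triangle (t : Face P 2) :
    ∃ a b c, a ≠ b ∧ a ≠ c ∧ b ≠ c ∧ verts t.1 = {a, b, c} :=
  ncard_eq_three.1 t.2

section

variable (hP : IsSimplicialPoset P)

include hP

lemma edge_ext {x : P} {e e' : Face P 1} (h : e.1 ≤ x) (h' : e'.1 ≤ x)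
    (hv : verts e.1 = verts e'.1) : e = e' := Subtype.ext (eq_of_verts hP h h' hv)

lemma exists_edge {x v w : P} (hv : v ∈ verts x) (hw : w ∈ verts x) (hvw : v ≠ w) :
    ∃ e : Face P 1, e.1 ≤ x ∧ verts e.1 = {v, w} := by
  obtain ⟨y, hy, h⟩ := exists_face_verts hP (x := x) (s := {v, w}) (insert_subset hv
    (singleton_subset_iff.2 hw))
  exact ⟨⟨y, by rw [card_vert, h, ncard_pair hvw]⟩, hy, h⟩

variable [Finite P]

/-- The coboundary on a triangle is the sum of the values on its three edges. -/
lemma exists_coboundary_apply {t : Face P 2} {a b c : P} (hab : a ≠ b) (hac : a ≠ c) (hbc : b ≠ c)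
    (ht : verts t.1 = {a, b, c}) : ∃ e₁ e₂ e₃ : Face P 1, e₁.1 ≤ t.1 ∧ e₂.1 ≤ t.1 ∧ e₃.1 ≤ t.1 ∧
      verts e₁.1 = {a, b} ∧ verts e₂.1 = {a, c} ∧ verts e₃.1 = {b, c} ∧
      ∀ ψ, coboundary P 1 ψ t = ψ e₁ + ψ e₂ + ψ e₃ := by
  classical
  have ha : a ∈ verts t.1 := by simp [ht]
  have hb : b ∈ verts t.1 := by simp [ht]
  have hc : c ∈ verts t.1 := by simp [ht]
  obtain ⟨e₁, l₁, h₁⟩ := exists_edge hP ha hb hab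
  obtain ⟨e₂, l₂, h₂⟩ := exists_edge hP ha hc hac
  obtain ⟨e₃, l₃, h₃⟩ := exists_edge hP hb hc hbc
  refine ⟨e₁, e₂, e₃, l₁, l₂, l₃, h₁, h₂, h₃, fun ψ => ?_⟩
  have n12 : e₁ ≠ e₂ := fun h => by
    have : b ∈ verts e₂.1 := by rw [← h, h₁]; simp
    rw [h₂] at this
    rcases this with h | h
    · exact hab h.symm
    · exact hbc h
  have n13 : e₁ ≠ e₃ := fun h => by
    have : a ∈ verts e₃.1 := by rw [← h, h₁]; simp
    rw [h₃] at this
    rcases this with h | h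
    · exact hab h
    · exact hac h
  have n23 : e₂ ≠ e₃ := fun h => by
    have : a ∈ verts e₃.1 := by rw [← h, h₂]; simp
    rw [h₃] at this
    rcases this with h | h
    · exact hab h
    · exact hac h
  have hf : (Finset.univ.filter fun e : Face P 1 => e.1 ≤ t.1) = {e₁, e₂, e₃} := by
    ext e
    simp only [Finset.mem_filter, Finset.mem_univ, true_and, Finset.mem_insert,
      Finset.mem_singleton]
    constructor
    · intro he
      have hsub : verts e.1 ⊆ {a, b, c} := ht ▸ verts_mono he
      have key : ∀ {u v w : P} {e' : Face P 1}, verts e.1 ⊆ {u, v, w} → u ∉ verts e.1 →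
          e'.1 ≤ t.1 → verts e'.1 = {v, w} → e = e' := by
        intro u v w e' h1 h2 h3 h4
        refine edge_ext hP he h3 (eq_of_subset_of_ncard_le (fun z hz => ?_) ?_ (toFinite _))
        · rw [h4]
          exact (h1 hz).resolve_left fun h => h2 (h ▸ hz)
        · rw [ncard_verts_edge, ncard_verts_edge]
      by_cases ma : a ∈ verts e.1
      · by_cases mb : b ∈ verts e.1
        · refine Or.inl (key (u := c) (v := a) (w := b) (fun z hz => ?_) (fun mc => ?_) l₁ h₁)
          · rcases hsub hz with h | h | h <;> rw [h] <;> simp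
          · have h3 : ({a, b, c} : Set P) ⊆ verts e.1 :=
              insert_subset ma (insert_subset mb (singleton_subset_iff.2 mc))
            have := ncard_le_ncard h3 (toFinite _)
            rw [ncard_verts_edge, ncard_eq_three.2 ⟨a, b, c, hab, hac, hbc, rfl⟩] at this
            omega
        · refine Or.inr (Or.inl (key (u := b) (v := a) (w := c) (fun z hz => ?_) mb l₂ h₂))
          rcases hsub hz with h | h | h <;> simp [h]
      · exact Or.inr (Or.inr (key hsub ma l₃ h₃))
    · rintro (rfl | rfl | rfl) <;> assumption
  change ∑ e : Face P 1 with e.1 ≤ t.1, ψ e = _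
  rw [hf, Finset.sum_insert (by simp [n12, n13]), Finset.sum_pair n23, add_assoc]

end

/-- The function `g` is a potential of the cochain `ψ` on the face `x`: on the edges of `x`, `ψ` is
the coboundary of `g`.  Only the values of `g` at the vertices of `x` matter. -/
def IsPotential (ψ : Face P 1 → ZMod 2) (x : P) (g : P → ZMod 2) : Prop :=
  ∀ e : Face P 1, e.1 ≤ x → ∀ v w, v ≠ w → verts e.1 = {v, w} → ψ e = g v + g w

lemma IsPotential.mono {ψ : Face P 1 → ZMod 2} {x y : P} {g : P → ZMod 2}
    (h : IsPotential ψ y g) (hxy : x ≤ y) : IsPotential ψ x g := fun e he => h e (he.trans hxy)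

lemma IsPotential.add {ψ ψ' : Face P 1 → ZMod 2} {x : P} {g g' : P → ZMod 2}
    (h : IsPotential ψ x g) (h' : IsPotential ψ' x g') : IsPotential (ψ + ψ') x (g + g') := by
  intro e he v w hvw hv
  rw [Pi.add_apply, Pi.add_apply, Pi.add_apply, h e he v w hvw hv, h' e he v w hvw hv]
  ring

variable (hP : IsSimplicialPoset P) [Finite P]

include hP

/-- A cocycle has a potential on every face, since simplices have no cohomology. -/
lemma exists_isPotential {ψ : Face P 1 → ZMod 2} (hψ : coboundary P 1 ψ = 0) (x : P) :
    ∃ g, IsPotential ψ x g := by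
  classical
  rcases (verts x).eq_empty_or_nonempty with h0 | ⟨v₀, hv₀⟩
  · refine ⟨0, fun e he v w _ hv => ?_⟩
    have : v ∈ verts x := verts_mono he (hv ▸ mem_insert _ _)
    rw [h0] at this
    exact this.elim
  -- the potential of `v` is the value on the edge from the base vertex `v₀` to `v`
  let g : P → ZMod 2 := fun v =>
    if h : ∃ e : Face P 1, e.1 ≤ x ∧ verts e.1 = {v₀, v} then ψ h.choose else 0
  have hg : ∀ (e : Face P 1) v, e.1 ≤ x → verts e.1 = {v₀, v} → g v = ψ e := by
    intro e v he hv
    have h : ∃ e : Face P 1, e.1 ≤ x ∧ verts e.1 = {v₀, v} := ⟨e, he, hv⟩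
    simp only [g, dif_pos h]
    rw [edge_ext hP h.choose_spec.1 he (h.choose_spec.2.trans hv.symm)]
  have hg0 : g v₀ = 0 := by
    refine dif_neg ?_
    rintro ⟨e, -, he⟩
    have := ncard_verts_edge e
    rw [he, pair_eq_singleton, ncard_singleton] at this
    omega
  refine ⟨g, fun e he v w hvw hv => ?_⟩
  by_cases h1 : v₀ = v
  · subst h1
    rw [hg0, zero_add, hg e w he hv]
  by_cases h2 : v₀ = w
  · subst h2
    rw [hg0, add_zero, hg e v he (by rw [hv, pair_comm])]
  have mv : v ∈ verts x := verts_mono he (hv ▸ mem_insert _ _)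
  have mw : w ∈ verts x := verts_mono he (hv ▸ mem_insert_of_mem _ rfl)
  obtain ⟨t, htx, ht⟩ := exists_face_verts hP (x := x) (s := {v₀, v, w})
    (insert_subset hv₀ (insert_subset mv (singleton_subset_iff.2 mw)))
  obtain ⟨e₁, e₂, e₃, l₁, l₂, l₃, k₁, k₂, k₃, hs⟩ := exists_coboundary_apply hP
    (t := ⟨t, by rw [card_vert, ht]; exact ncard_eq_three.2 ⟨_, _, _, h1, h2, hvw, rfl⟩⟩)
    h1 h2 hvw ht
  have h3 := hs ψ
  rw [hψ] at h3
  have h3 : 0 = ψ e₁ + ψ e₂ + ψ e₃ := h3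
  have he3 : e = e₃ := edge_ext hP he (l₃.trans htx) (hv.trans k₃.symm)
  rw [hg e₁ v (l₁.trans htx) k₁, hg e₂ w (l₂.trans htx) k₂, he3]
  exact (CharTwo.add_eq_zero.1 h3.symm).symm

omit hP [Finite P] in
lemma IsPotential.eq_zero {ψ : Face P 1 → ZMod 2} {x : P} {g : P → ZMod 2}
    (hg : IsPotential ψ x g) (hc : ∀ v ∈ verts x, ∀ w ∈ verts x, g v = g w) {e : Face P 1}
    (he : e.1 ≤ x) : ψ e = 0 := by
  obtain ⟨v, w, hvw, hv⟩ := exists_verts_edge e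
  rw [hg e he v w hvw hv, hc v (verts_mono he (hv ▸ mem_insert _ _)) w
    (verts_mono he (hv ▸ mem_insert_of_mem _ rfl)), CharTwo.add_self_eq_zero]

omit [Finite P] in
/-- A cochain with a potential is nonzero on a face if and only if the potential is not constant. -/
lemma IsPotential.exists_odd_iff {ψ : Face P 1 → ZMod 2} {x : P} {g : P → ZMod 2}
    (hg : IsPotential ψ x g) : (∃ e : Face P 1, e.1 ≤ x ∧ ψ e = 1) ↔
      ∃ v ∈ verts x, ∃ w ∈ verts x, g v = 1 ∧ g w ≠ 1 := by
  constructor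
  · rintro ⟨e, he, h⟩
    obtain ⟨v, w, hvw, hv⟩ := exists_verts_edge e
    have mv : v ∈ verts x := verts_mono he (hv ▸ mem_insert _ _)
    have mw : w ∈ verts x := verts_mono he (hv ▸ mem_insert_of_mem _ rfl)
    rw [hg e he v w hvw hv, zmod_two_add_eq_one] at h
    rcases h with h | h
    · exact ⟨v, mv, w, mw, h⟩
    · exact ⟨w, mw, v, mv, h.symm⟩
  · rintro ⟨v, mv, w, mw, h1, h0⟩
    have hvw : v ≠ w := fun h => h0 (h ▸ h1)
    obtain ⟨e, he, hv⟩ := exists_edge hP mv mw hvw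
    exact ⟨e, he, by rw [hg e he v w hvw hv]; exact zmod_two_add_eq_one.2 (Or.inl ⟨h1, h0⟩)⟩

end Potential

section Cut

variable {ι : Type*} [Fintype ι] (W : Finset ι)

open Classical in
/-- The open cell cut out of an open simplex by the condition that the vertices in `W` have total
weight `1 / 2`. -/
lemma finrank_vectorSpan_cut (hW : W.Nonempty) (hWc : ∃ i, i ∉ W) :
    ({t | t ∈ stdSimplex ℝ ι ∧ ∑ v ∈ W, t v = 1 / 2 ∧ ∀ v, 0 < t v}).Nonempty ∧
    Module.finrank ℝ (vectorSpan ℝ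
      {t | t ∈ stdSimplex ℝ ι ∧ ∑ v ∈ W, t v = 1 / 2 ∧ ∀ v, 0 < t v}) + 2 = Fintype.card ι := by
  obtain ⟨j, hj⟩ := hWc
  have hWc : (Wᶜ).Nonempty := ⟨j, Finset.mem_compl.2 hj⟩
  obtain ⟨i, hi⟩ := hW
  have hW : W.Nonempty := ⟨i, hi⟩
  set C : Set (ι → ℝ) := {t | t ∈ stdSimplex ℝ ι ∧ ∑ v ∈ W, t v = 1 / 2 ∧ ∀ v, 0 < t v} with hC
  have cW : (0 : ℝ) < W.card := by exact_mod_cast hW.card_pos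
  have cWc : (0 : ℝ) < (Wᶜ).card := by exact_mod_cast hWc.card_pos
  have memC : ∀ t, (∀ v, 0 < t v) → ∑ v ∈ W, t v = 1 / 2 → ∑ v ∈ Wᶜ, t v = 1 / 2 → t ∈ C := by
    intro t h1 h2 h3
    refine ⟨⟨fun v => (h1 v).le, ?_⟩, h2, h1⟩
    rw [← Finset.sum_add_sum_compl W, h2, h3]
    norm_num
  have sumC : ∀ t ∈ C, ∑ v ∈ Wᶜ, t v = 1 / 2 := by
    rintro t ⟨h1, h2, -⟩
    have := Finset.sum_add_sum_compl W t
    rw [h1.2, h2] at this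
    linarith
  let t₀ : ι → ℝ := fun v => if v ∈ W then (2 * (W.card : ℝ))⁻¹ else (2 * ((Wᶜ).card : ℝ))⁻¹
  have ht₀ : t₀ ∈ C := by
    refine memC t₀ (fun v => ?_) ?_ ?_
    · simp only [t₀]
      split_ifs <;> positivity
    · rw [Finset.sum_congr rfl fun v hv => if_pos hv, Finset.sum_const, nsmul_eq_mul]
      field_simp
    · rw [Finset.sum_congr rfl fun v hv => if_neg (Finset.mem_compl.1 hv), Finset.sum_const,
        nsmul_eq_mul]
      field_simp
  refine ⟨⟨t₀, ht₀⟩, ?_⟩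
  let L : (ι → ℝ) →ₗ[ℝ] ℝ × ℝ := LinearMap.prod (∑ v ∈ W, LinearMap.proj v)
    (∑ v ∈ Wᶜ, LinearMap.proj v)
  have hL : ∀ t, L t = (∑ v ∈ W, t v, ∑ v ∈ Wᶜ, t v) := fun t => by
    simp [L, LinearMap.prod_apply]
  have hspan : vectorSpan ℝ C = LinearMap.ker L := by
    apply le_antisymm
    · rw [vectorSpan_def, Submodule.span_le]
      rintro _ ⟨t, ht, u, hu, rfl⟩
      change L (t - u) = 0
      rw [map_sub, hL, hL, ht.2.1, hu.2.1,
        sumC t ht, sumC u hu, sub_self]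
    · intro w hw
      rw [LinearMap.mem_ker, hL, Prod.mk_eq_zero] at hw
      have hev : ∀ᶠ ε : ℝ in nhds 0, ∀ v, 0 < t₀ v + ε * w v := by
        rw [Filter.eventually_all]
        intro v
        have hcont : Continuous fun ε : ℝ => t₀ v + ε * w v := by fun_prop
        refine hcont.continuousAt.eventually (lt_mem_nhds ?_)
        simpa using ht₀.2.2 v
      obtain ⟨ε, hε, hε0⟩ := ((hev.filter_mono nhdsWithin_le_nhds).and
        (self_mem_nhdsWithin (s := Ioi (0 : ℝ)))).exists
      have hmem : t₀ + ε • w ∈ C := by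
        refine memC _ hε ?_ ?_
        · simp only [Pi.add_apply, Pi.smul_apply, smul_eq_mul]
          rw [Finset.sum_add_distrib, ← Finset.mul_sum, hw.1, mul_zero, add_zero, ht₀.2.1]
        · simp only [Pi.add_apply, Pi.smul_apply, smul_eq_mul]
          rw [Finset.sum_add_distrib, ← Finset.mul_sum, hw.2, mul_zero, add_zero, sumC t₀ ht₀]
      have h1 : ε • w ∈ vectorSpan ℝ C := by
        have := vsub_mem_vectorSpan ℝ hmem ht₀
        rwa [vsub_eq_sub, add_sub_cancel_left] at this
      exact (Submodule.smul_mem_iff _ (ne_of_gt hε0)).1 h1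
  have hsurj : LinearMap.range L = ⊤ := by
    rw [LinearMap.range_eq_top]
    rintro ⟨a, b⟩
    refine ⟨Pi.single i a + Pi.single j b, ?_⟩
    have hji : j ∈ Wᶜ := Finset.mem_compl.2 hj
    have hii : i ∉ Wᶜ := fun h => Finset.mem_compl.1 h hi
    rw [hL]
    simp [Finset.sum_add_distrib, hi, hj]
  have := LinearMap.finrank_range_add_finrank_ker L
  rw [hsurj, finrank_top, Module.finrank_prod, Module.finrank_self, Module.finrank_pi] at this
  rw [hspan]
  omega

open Classical in
/-- The section of a simplex by the condition that the vertices in `W` have total weight `1 / 2` is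
the convex hull of the midpoints of the edges that join `W` to its complement. -/
lemma convexHull_midpoints (t : ι → ℝ) :
    t ∈ convexHull ℝ {m | ∃ i ∈ W, ∃ j ∉ W, m = fun u => if u = i ∨ u = j then (1 / 2 : ℝ) else 0} ↔
      t ∈ stdSimplex ℝ ι ∧ ∑ v ∈ W, t v = 1 / 2 := by
  constructor
  · intro ht
    have hconv : Convex ℝ {t | t ∈ stdSimplex ℝ ι ∧ ∑ v ∈ W, t v = 1 / 2} := by
      refine (convex_stdSimplex ℝ _).inter ?_
      intro t ht u hu a b _ _ hab
      have ht : ∑ v ∈ W, t v = 1 / 2 := ht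
      have hu : ∑ v ∈ W, u v = 1 / 2 := hu
      change ∑ v ∈ W, (a * t v + b * u v) = 1 / 2
      rw [Finset.sum_add_distrib, ← Finset.mul_sum, ← Finset.mul_sum, ht, hu, ← add_mul, hab,
        one_mul]
    refine convexHull_min ?_ hconv ht
    rintro m ⟨i, hi, j, hj, rfl⟩
    have hij : i ≠ j := fun h => hj (h ▸ hi)
    have hsum : ∀ F : Finset ι, ∑ u ∈ F, (if u = i ∨ u = j then (1 / 2 : ℝ) else 0) =
        (if i ∈ F then 1 / 2 else 0) + (if j ∈ F then 1 / 2 else 0) := by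
      intro F
      rw [← Finset.sum_ite_eq' F i (fun _ => (1 / 2 : ℝ)),
        ← Finset.sum_ite_eq' F j (fun _ => (1 / 2 : ℝ)), ← Finset.sum_add_distrib]
      refine Finset.sum_congr rfl fun u _ => ?_
      by_cases c1 : u = i
      · simp [c1, hij]
      · simp [c1]
    refine ⟨⟨fun u => ?_, ?_⟩, ?_⟩
    · dsimp only
      split_ifs <;> norm_num
    · rw [hsum, if_pos (Finset.mem_univ _), if_pos (Finset.mem_univ _)]
      norm_num
    · rw [hsum, if_pos hi, if_neg hj, add_zero]
  · rintro ⟨ht, hW⟩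
    have hWc : ∑ v ∈ Wᶜ, t v = 1 / 2 := by
      have := Finset.sum_add_sum_compl W t
      rw [ht.2, hW] at this
      linarith
    -- the weights `4 t_v t_w` express `t` by the midpoints of the edges `vw`
    have key : t = ∑ q ∈ W ×ˢ Wᶜ, (4 * t q.1 * t q.2) •
        (fun u : ι => if u = q.1 ∨ u = q.2 then (1 / 2 : ℝ) else 0) := by
      funext u
      rw [Finset.sum_apply, Finset.sum_product]
      simp only [Pi.smul_apply, smul_eq_mul]
      by_cases hu : u ∈ W
      · have hu' : ∀ w ∈ Wᶜ, u ≠ w := fun w hw h => Finset.mem_compl.1 hw (h ▸ hu)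
        rw [Finset.sum_eq_single u]
        · simp only [true_or, if_true]
          rw [← Finset.sum_mul, ← Finset.mul_sum, hWc]
          ring
        · intro v _ hv
          refine Finset.sum_eq_zero fun w hw => ?_
          rw [if_neg, mul_zero]
          rintro (h | h)
          · exact hv h.symm
          · exact hu' w hw h
        · exact fun h => absurd hu h
      · have hu' : ∀ w ∈ W, u ≠ w := fun w hw h => hu (h ▸ hw)
        rw [Finset.sum_comm, Finset.sum_eq_single u]
        · simp only [or_true, if_true]
          rw [← Finset.sum_mul, ← Finset.sum_mul, ← Finset.mul_sum, hW]
          ring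
        · intro v _ hv
          refine Finset.sum_eq_zero fun w hw => ?_
          rw [if_neg, mul_zero]
          rintro (h | h)
          · exact hu' w hw h
          · exact hv h.symm
        · exact fun h => absurd (Finset.mem_compl.2 hu) h
    rw [key]
    refine (convex_convexHull ℝ _).sum_mem (fun q _ => ?_) ?_ fun q hq => subset_convexHull ℝ _ ?_
    · exact mul_nonneg (mul_nonneg (by norm_num) (ht.1 _)) (ht.1 _)
    · rw [Finset.sum_product]
      simp only [← Finset.mul_sum, hWc, ← Finset.sum_mul, hW]
      norm_num
    · obtain ⟨h1, h2⟩ := Finset.mem_product.1 hq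
      exact ⟨q.1, h1, q.2, Finset.mem_compl.1 h2, rfl⟩

end Cut

section Pieces

variable {P : Type*} [PartialOrder P] [OrderBot P] [Finite P]

open Classical in
/-- The vertices of `x` at which the function `g` takes the value `1`. -/
noncomputable def support (x : P) (g : P → ZMod 2) : Finset (Vert x) :=
  Finset.univ.filter fun v => g v.1 = 1

lemma mem_support {x : P} {g : P → ZMod 2} {v : Vert x} : v ∈ support x g ↔ g v.1 = 1 :=
  Finset.mem_filter.trans ⟨fun h => h.2, fun h => ⟨Finset.mem_univ _, h⟩⟩

open Classical in
omit [Finite P] in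
lemma edgeMidpoint_eq {x : P} {e : Face P 1} {v w : Vert x} (he : verts e.1 = {v.1, w.1}) :
    edgeMidpoint x e = fun u => if u = v ∨ u = w then (1 / 2 : ℝ) else 0 := by
  funext u
  have h : u.1 ≤ e.1 ↔ u = v ∨ u = w := by
    have h : u.1 ∈ verts e.1 ↔ u.1 ∈ ({v.1, w.1} : Set P) := by rw [he]
    exact ⟨fun h' => (h.1 ⟨u.2.1, h'⟩).imp Vert.ext Vert.ext, fun h' => (h.2
      (h'.imp (congrArg fun z : Vert x => z.1) (congrArg fun z : Vert x => z.1))).2⟩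
  unfold edgeMidpoint
  simp only [h]

variable (hP : IsSimplicialPoset P)

include hP

/-- The normal piece in a closed simplex consists of the points at which the vertices of potential
`1` have total weight `1 / 2`. -/
theorem mem_normalPiece_iff {ψ : Face P 1 → ZMod 2} {x : P} {g : P → ZMod 2}
    (hg : IsPotential ψ x g) {t : Vert x → ℝ} : t ∈ normalPiece ψ x ↔
      t ∈ stdSimplex ℝ (Vert x) ∧ ∑ v ∈ support x g, t v = 1 / 2 := by
  classical
  rw [← convexHull_midpoints (support x g) t, normalPiece]
  convert Iff.rfl using 3
  ext m
  constructor
  · rintro ⟨i, hi, j, hj, rfl⟩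
    rw [mem_support] at hi hj
    have hij : i.1 ≠ j.1 := fun h => hj (h ▸ hi)
    obtain ⟨e, he, hv⟩ := exists_edge hP (x := x) i.2 j.2 hij
    refine ⟨e, he, ?_, (edgeMidpoint_eq hv).symm⟩
    rw [hg e he _ _ hij hv]
    exact zmod_two_add_eq_one.2 (Or.inl ⟨hi, hj⟩)
  · rintro ⟨e, he, h1, rfl⟩
    obtain ⟨v, w, hvw, hv⟩ := exists_verts_edge e
    have mv : v ∈ verts x := verts_mono he (hv ▸ mem_insert _ _)
    have mw : w ∈ verts x := verts_mono he (hv ▸ mem_insert_of_mem _ rfl)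
    rw [hg e he v w hvw hv, zmod_two_add_eq_one] at h1
    rcases h1 with h1 | h1
    · exact ⟨⟨v, mv⟩, mem_support.2 h1.1, ⟨w, mw⟩, fun h => h1.2 (mem_support.1 h),
        edgeMidpoint_eq (v := ⟨v, mv⟩) (w := ⟨w, mw⟩) hv⟩
    · exact ⟨⟨w, mw⟩, mem_support.2 h1.2, ⟨v, mv⟩, fun h => h1.1 (mem_support.1 h),
        edgeMidpoint_eq (v := ⟨w, mw⟩) (w := ⟨v, mv⟩) (hv.trans (pair_comm _ _))⟩

/-- The intersection of the normal surface with an open simplex is the interior of the normal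
piece. -/
lemma openCell_normalSurface {ψ : Face P 1 → ZMod 2} (hψ : coboundary P 1 ψ = 0) (x : P) :
    openCell (normalSurface ψ) x = {t | t ∈ normalPiece ψ x ∧ ∀ v, 0 < t v} := by
  classical
  ext t
  constructor
  · rintro ⟨ht, hpos, hS⟩
    refine ⟨?_, hpos⟩
    obtain ⟨y, u, hu, hux⟩ := mem_iUnion.1 hS
    obtain ⟨g, hg⟩ := exists_isPotential hP hψ y
    have hcx : carrier hP (toRealization x ⟨t, ht⟩) ≤ x := carrier_le hP _
    have hxc : x ≤ carrier hP (toRealization x ⟨t, ht⟩) := le_carrier hP le_rfl hcx fun v hv hvx => by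
      rw [coord_toRealization ⟨t, ht⟩ (⟨v, hv, hvx⟩ : Vert x)]
      exact hpos _
    have hxy : x ≤ y := hxc.trans (hux ▸ carrier_le hP u)
    have h1 := (mem_normalPiece_iff hP hg).1 hu
    refine (mem_normalPiece_iff hP (hg.mono hxy)).2 ⟨ht, ?_⟩
    rw [← h1.2]
    have hcu : ∀ v : Vert y, u v = coord (toRealization x ⟨t, ht⟩) v.1 := fun v => by
      rw [← hux]
      exact (coord_toRealization u v).symm
    refine Finset.sum_of_injOn (Vert.incl hxy) ?_ ?_ ?_ ?_
    · intro a _ b _ h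
      exact Vert.ext (congrArg (fun w : Vert y => w.1) h)
    · intro a ha
      have ha' : g a.1 = 1 := mem_support.1 (Finset.mem_coe.1 ha)
      exact Finset.mem_coe.2 (mem_support.2 ha')
    · intro v hv hn
      refine (hcu v).trans (coord_toRealization_of_not _ fun h => hn ?_)
      have hv' : g v.1 = 1 := mem_support.1 hv
      exact ⟨⟨v.1, h⟩, Finset.mem_coe.2 (mem_support.2 hv'), rfl⟩
    · intro v _
      exact ((hcu _).trans (coord_toRealization ⟨t, ht⟩ v)).symm
  · rintro ⟨h1, h2⟩
    obtain ⟨g, hg⟩ := exists_isPotential hP hψ x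
    have ht := ((mem_normalPiece_iff hP hg).1 h1).1
    exact ⟨ht, h2, mem_iUnion.2 ⟨x, ⟨t, ht⟩, h1, rfl⟩⟩

end Pieces

section Euler

variable {P : Type*} [PartialOrder P] [OrderBot P] [Fintype P] (hP : IsSimplicialPoset P)

include hP

open Classical in
/-- The cells of the normal surface correspond to the faces on which the cocycle does not vanish. -/
theorem eulerChar_normalSurface {ψ : Face P 1 → ZMod 2} (hψ : coboundary P 1 ψ = 0) :
    eulerChar (normalSurface ψ) =
      ∑ x : P with ∃ e : Face P 1, e.1 ≤ x ∧ ψ e = 1, (-1 : ℤ) ^ Nat.card (Vert x) := by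
  have key : ∀ x : P, ((openCell (normalSurface ψ) x).Nonempty ↔
      ∃ e : Face P 1, e.1 ≤ x ∧ ψ e = 1) ∧ ((∃ e : Face P 1, e.1 ≤ x ∧ ψ e = 1) →
      Module.finrank ℝ (vectorSpan ℝ (openCell (normalSurface ψ) x)) + 2 = Nat.card (Vert x)) := by
    intro x
    obtain ⟨g, hg⟩ := exists_isPotential hP hψ x
    have hcell : openCell (normalSurface ψ) x = {t | t ∈ stdSimplex ℝ (Vert x) ∧
        ∑ v ∈ support x g, t v = 1 / 2 ∧ ∀ v, 0 < t v} := by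
      rw [openCell_normalSurface hP hψ]
      ext t
      simp only [mem_ofPred_eq, mem_normalPiece_iff hP hg, and_assoc]
    have hodd : (∃ e : Face P 1, e.1 ≤ x ∧ ψ e = 1) →
        (support x g).Nonempty ∧ ∃ i, i ∉ support x g := by
      rw [hg.exists_odd_iff hP]
      rintro ⟨v, hv, w, hw, h1, h2⟩
      exact ⟨⟨⟨v, hv⟩, mem_support.2 h1⟩, ⟨w, hw⟩, fun h => h2 (mem_support.1 h)⟩
    refine ⟨⟨?_, fun h => ?_⟩, fun h => ?_⟩
    · rintro ⟨t, ht⟩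
      rw [openCell_normalSurface hP hψ] at ht
      obtain ⟨m, e, he, h1, -⟩ := convexHull_nonempty_iff.1 ⟨t, ht.1⟩
      exact ⟨e, he, h1⟩
    · rw [hcell]
      exact (finrank_vectorSpan_cut _ (hodd h).1 (hodd h).2).1
    · rw [hcell, Nat.card_eq_fintype_card]
      exact (finrank_vectorSpan_cut _ (hodd h).1 (hodd h).2).2
  unfold eulerChar
  refine Finset.sum_congr ?_ fun x hx => ?_
  · ext x
    simp only [Finite.mem_toFinset, mem_ofPred_eq, Finset.mem_filter, Finset.mem_univ, true_and]
    exact (key x).1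
  · have := (key x).2 (by simpa using hx)
    rw [← this, pow_add]
    norm_num

end Euler

end SimplicialPoset

/-! ### Averages over a cohomology class -/

namespace SimplicialPoset

open Set

section Averages

/-- Over the cosets of the image of a homomorphism, sums of a function are proportional to sums over
the source. -/
lemma sum_add_hom {A B : Type*} [AddGroup A] [Fintype A] [AddGroup B] [DecidableEq B] (f : A →+ B)
    (b₀ : B) : ∃ k : ℕ, ∀ F : B → ℚ,
      ∑ a, F (b₀ + f a) = k * ∑ b ∈ Finset.univ.image fun a => b₀ + f a, F b := by
  refine ⟨Finset.card {a | f a = 0}, fun F => ?_⟩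
  rw [Finset.sum_comp F fun a => b₀ + f a, Finset.mul_sum]
  refine Finset.sum_congr rfl fun b hb => ?_
  obtain ⟨a, -, rfl⟩ := Finset.mem_image.1 hb
  simp only [add_right_inj]
  rw [nsmul_eq_mul, AddMonoidHom.card_fiber_eq_of_mem_range f ⟨a, rfl⟩ ⟨0, map_zero f⟩]

open Classical in
/-- The number of functions mod 2 that agree on `S` with a translate of a given function by a
constant. -/
lemma card_constant_translate {V : Type*} [Fintype V] (S : Finset V) (hS : S.Nonempty)
    (g : V → ZMod 2) :
    (Finset.card {φ : V → ZMod 2 | ∀ v ∈ S, ∀ w ∈ S, g v + φ v = g w + φ w} : ℚ) =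
      2 / 2 ^ S.card * 2 ^ Fintype.card V := by
  have key : Finset.card {φ : V → ZMod 2 | ∀ v ∈ S, ∀ w ∈ S, g v + φ v = g w + φ w} =
      ∑ c : ZMod 2, Finset.card
        (Fintype.piFinset fun v => if v ∈ S then {c - g v} else (Finset.univ : Finset (ZMod 2))) := by
    rw [← Finset.card_biUnion]
    · congr 1
      ext φ
      simp only [Finset.mem_filter, Finset.mem_univ, true_and, Finset.mem_biUnion,
        Fintype.mem_piFinset]
      constructor
      · intro h
        obtain ⟨s, hs⟩ := hS
        refine ⟨g s + φ s, fun v => ?_⟩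
        split_ifs with hv
        · rw [Finset.mem_singleton, ← h v hv s hs, add_sub_cancel_left]
        · exact Finset.mem_univ _
      · rintro ⟨c, hc⟩
        have : ∀ v ∈ S, g v + φ v = c := fun v hv => by
          have := hc v
          rw [if_pos hv, Finset.mem_singleton] at this
          rw [this, add_sub_cancel]
        intro v hv w hw
        rw [this v hv, this w hw]
    · intro c _ d _ hcd
      rw [Function.onFun, Finset.disjoint_left]
      intro φ h1 h2
      obtain ⟨s, hs⟩ := hS
      have h3 := Fintype.mem_piFinset.1 h1 s
      have h4 := Fintype.mem_piFinset.1 h2 s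
      rw [if_pos hs, Finset.mem_singleton] at h3 h4
      exact hcd (sub_left_inj.1 (h3.symm.trans h4))
  have h2 : ∀ c : ZMod 2, Finset.card
      (Fintype.piFinset fun v => if v ∈ S then {c - g v} else (Finset.univ : Finset (ZMod 2))) =
      2 ^ (Fintype.card V - S.card) := by
    intro c
    rw [Fintype.card_piFinset, ← Finset.card_compl, ← Finset.prod_mul_prod_compl S,
      Finset.prod_eq_one fun v hv => by rw [if_pos hv, Finset.card_singleton], one_mul,
      Finset.prod_congr rfl (g := fun _ => 2) fun v hv => by
        rw [if_neg (Finset.mem_compl.1 hv), Finset.card_univ, ZMod.card], Finset.prod_const]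
  rw [key, Finset.sum_congr rfl fun c _ => h2 c, Finset.sum_const, Finset.card_univ, ZMod.card]
  have h3 : (2 : ℚ) ^ Fintype.card V = 2 ^ S.card * 2 ^ (Fintype.card V - S.card) := by
    rw [← pow_add, Nat.add_sub_cancel' S.card_le_univ]
  rw [h3, smul_eq_mul]
  push_cast
  field_simp

end Averages

section Cohomology

variable {P : Type*} [PartialOrder P] [OrderBot P] [Finite P]

open Classical in
/-- A `0`-cochain as a function on all faces, with the junk value `0` outside the vertices. -/
noncomputable def extend (φ : Face P 0 → ZMod 2) (v : P) : ZMod 2 :=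
  if h : Nat.card (Vert v) = 0 + 1 then φ ⟨v, h⟩ else 0

omit [Finite P] in
lemma extend_apply (φ : Face P 0 → ZMod 2) (v : Face P 0) : extend φ v.1 = φ v := dif_pos v.2

variable (hP : IsSimplicialPoset P)

include hP

/-- The vertices of a face, as faces of dimension `0`. -/
lemma mem_verts_iff {v x : P} : v ∈ verts x ↔ ∃ u : Face P 0, u.1 = v ∧ u.1 ≤ x := by
  constructor
  · rintro ⟨h1, h2⟩
    exact ⟨⟨v, (isAtom_iff_card_vert hP).1 h1⟩, rfl, h2⟩
  · rintro ⟨u, rfl, h⟩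
    exact ⟨(isAtom_iff_card_vert hP).2 u.2, h⟩

/-- A `0`-cochain is a potential of its coboundary. -/
lemma isPotential_coboundary (φ : Face P 0 → ZMod 2) (x : P) :
    IsPotential (coboundary P 0 φ) x (extend φ) := by
  classical
  intro e he v w hvw hv
  obtain ⟨a, rfl, ha⟩ := (mem_verts_iff hP).1 (hv ▸ mem_insert v {w})
  obtain ⟨b, rfl, hb⟩ := (mem_verts_iff hP).1 (hv ▸ mem_insert_of_mem a.1 (mem_singleton w))
  have hab : a ≠ b := fun h => hvw (congrArg Subtype.val h)
  rw [extend_apply, extend_apply]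
  change ∑ u : Face P 0 with u.1 ≤ e.1, φ u = _
  rw [← Finset.sum_pair hab]
  refine Finset.sum_congr ?_ fun _ _ => rfl
  ext u
  simp only [Finset.mem_filter, Finset.mem_univ, true_and, Finset.mem_insert, Finset.mem_singleton]
  constructor
  · intro h
    have := (mem_verts_iff hP).2 ⟨u, rfl, h⟩
    rw [hv] at this
    exact this.imp Subtype.ext Subtype.ext
  · rintro (rfl | rfl) <;> assumption

lemma coboundary_coboundary (φ : Face P 0 → ZMod 2) : coboundary P 1 (coboundary P 0 φ) = 0 := by
  funext t
  obtain ⟨a, b, c, hab, hac, hbc, ht⟩ := exists_verts_triangle t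
  obtain ⟨e₁, e₂, e₃, l₁, l₂, l₃, k₁, k₂, k₃, h⟩ := exists_coboundary_apply hP hab hac hbc ht
  have hp := isPotential_coboundary hP φ t.1
  rw [h, hp e₁ l₁ a b hab k₁, hp e₂ l₂ a c hac k₂, hp e₃ l₃ b c hbc k₃]
  generalize extend φ a = α
  generalize extend φ b = β
  generalize extend φ c = γ
  change α + β + (α + γ) + (β + γ) = 0
  revert α β γ
  decide

open Classical in
/-- The cocycles in a class are obtained by adding coboundaries; sums over them are
proportional to sums over the `0`-cochains. -/
lemma exists_sum_cocyclesIn (c : Cohomology P) : ∃ ψ : Cocycle P, ∃ k : ℕ,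
    ∀ F : (Face P 1 → ZMod 2) → ℚ,
      ∑ φ : Face P 0 → ZMod 2, F (ψ.1 + coboundary P 0 φ) = k * ∑ ψ ∈ cocyclesIn c, F ψ.1 := by
  classical
  obtain ⟨ψ, rfl⟩ := Submodule.Quotient.mk_surjective _ c
  let δ : (Face P 0 → ZMod 2) →ₗ[ZMod 2] Cocycle P :=
    (coboundary P 0).codRestrict _ fun φ => LinearMap.mem_ker.2 (coboundary_coboundary hP φ)
  obtain ⟨k, hk⟩ := sum_add_hom δ.toAddMonoidHom ψ
  refine ⟨ψ, k, fun F => ?_⟩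
  suffices hset : cocyclesIn (Submodule.Quotient.mk ψ : Cohomology P) =
      Finset.univ.image fun φ => ψ + δ.toAddMonoidHom φ by
    rw [hset]
    exact hk fun ψ => F ψ.1
  ext ψ'
  have hmem : ψ' ∈ cocyclesIn (Submodule.Quotient.mk ψ : Cohomology P) ↔
      (Submodule.Quotient.mk ψ' : Cohomology P) = Submodule.Quotient.mk ψ := Finite.mem_toFinset _
  rw [hmem, Submodule.Quotient.eq, Finset.mem_image]
  constructor
  · rintro ⟨φ, hφ⟩
    refine ⟨φ, Finset.mem_univ _, Subtype.ext ?_⟩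
    change ψ.1 + coboundary P 0 φ = ψ'.1
    rw [hφ]
    exact add_sub_cancel ψ.1 ψ'.1
  · rintro ⟨φ, -, rfl⟩
    refine ⟨φ, ?_⟩
    exact (add_sub_cancel_left ψ.1 (coboundary P 0 φ)).symm

open Classical in
/-- The number of `0`-cochains, out of all `2 ^ f₀`, whose coboundary translates a cocycle to one
that does not vanish on a given face. -/
lemma card_odd {ψ : Face P 1 → ZMod 2} (hψ : coboundary P 1 ψ = 0) (x : P) :
    (Finset.card {φ : Face P 0 → ZMod 2 |
      ∃ e : Face P 1, e.1 ≤ x ∧ (ψ + coboundary P 0 φ) e = 1} : ℚ) =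
      (if Nat.card (Vert x) = 0 then 0 else 1 - 2 / 2 ^ Nat.card (Vert x)) *
        2 ^ Fintype.card (Face P 0) := by
  classical
  obtain ⟨g, hg⟩ := exists_isPotential hP hψ x
  have hpot := fun φ => hg.add (isPotential_coboundary hP φ x)
  set S : Finset (Face P 0) := {u | u.1 ≤ x} with hS
  have memS : ∀ u : Face P 0, u ∈ S ↔ u.1 ≤ x := fun u => by simp [hS]
  have cS : S.card = Nat.card (Vert x) := by
    rw [card_vert, ← ncard_coe_finset]
    refine ncard_congr (fun u _ => u.1) ?_ ?_ ?_
    · intro u hu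
      exact (mem_verts_iff hP).2 ⟨u, rfl, (memS u).1 hu⟩
    · intro u u' _ _ h
      exact Subtype.ext h
    · intro v hv
      obtain ⟨u, rfl, hu⟩ := (mem_verts_iff hP).1 hv
      exact ⟨u, (memS u).2 hu, rfl⟩
  have hodd : ∀ φ : Face P 0 → ZMod 2, (∃ e : Face P 1, e.1 ≤ x ∧ (ψ + coboundary P 0 φ) e = 1) ↔
      ¬ ∀ v ∈ S, ∀ w ∈ S, g v.1 + φ v = g w.1 + φ w := by
    intro φ
    constructor
    · rintro ⟨e, he, h⟩ hc
      refine zero_ne_one (α := ZMod 2) ?_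
      rw [← h]
      refine ((hpot φ).eq_zero (fun v hv w hw => ?_) he).symm
      obtain ⟨a, rfl, ha⟩ := (mem_verts_iff hP).1 hv
      obtain ⟨b, rfl, hb⟩ := (mem_verts_iff hP).1 hw
      have := hc a ((memS a).2 ha) b ((memS b).2 hb)
      rwa [← extend_apply φ a, ← extend_apply φ b] at this
    · intro h
      push Not at h
      obtain ⟨a, ha, b, hb, hab⟩ := h
      rw [← extend_apply φ a, ← extend_apply φ b] at hab
      have ma := (mem_verts_iff hP).2 ⟨a, rfl, (memS a).1 ha⟩
      have mb := (mem_verts_iff hP).2 ⟨b, rfl, (memS b).1 hb⟩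
      have hne : a.1 ≠ b.1 := fun h => hab (by rw [h])
      obtain ⟨e, he, hv⟩ := exists_edge hP ma mb hne
      refine ⟨e, he, ?_⟩
      rw [hpot φ e he a.1 b.1 hne hv, Pi.add_apply, Pi.add_apply]
      have hZ : ∀ α β : ZMod 2, α ≠ β → α + β = 1 := by decide
      exact hZ _ _ hab
  have hf := Finset.card_filter_add_card_filter_not (s := Finset.univ)
    (fun φ : Face P 0 → ZMod 2 => ∀ v ∈ S, ∀ w ∈ S, g v.1 + φ v = g w.1 + φ w)
  rw [Finset.card_univ, Fintype.card_fun, ZMod.card] at hf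
  have hf' : (Finset.card {φ : Face P 0 → ZMod 2 |
      ∃ e : Face P 1, e.1 ≤ x ∧ (ψ + coboundary P 0 φ) e = 1} : ℚ) =
      2 ^ Fintype.card (Face P 0) - Finset.card {φ : Face P 0 → ZMod 2 |
        ∀ v ∈ S, ∀ w ∈ S, g v.1 + φ v = g w.1 + φ w} := by
    rw [Finset.filter_congr fun φ _ => hodd φ, eq_sub_iff_add_eq']
    exact_mod_cast hf
  rw [hf']
  split_ifs with h0
  · have hSe : S = ∅ := Finset.card_eq_zero.1 (cS.trans h0)
    simp [hSe]
  · rw [card_constant_translate S (Finset.card_pos.1 (by omega)) fun u => g u.1, cS]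
    ring

end Cohomology

end SimplicialPoset

open SimplicialPoset

theorem corollary3p2 {P : Type*} [PartialOrder P] [OrderBot P] [Finite P]
    (hP : IsSimplicialPoset P)
    (hM : IsClosedThreeManifold (SimplicialPoset.Realization P))
    (c : SimplicialPoset.Cohomology P) :
    (∑ ψ ∈ SimplicialPoset.cocyclesIn c,
        (SimplicialPoset.eulerChar (SimplicialPoset.normalSurface ψ.1) : ℚ)) /
          (SimplicialPoset.cocyclesIn c).card =
        (5 * (SimplicialPoset.faceNumber P 0 : ℚ) - SimplicialPoset.faceNumber P 1) / 8 ∧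
      (5 * (SimplicialPoset.faceNumber P 0 : ℚ) - SimplicialPoset.faceNumber P 1) / 8 =
        (4 * (SimplicialPoset.faceNumber P 0 : ℚ) - SimplicialPoset.faceNumber P 3) / 8 := by
  classical
  have : Fintype P := Fintype.ofFinite P
  have h3 := faceNumber_three hP hM
  have h2 : (faceNumber P 2 : ℚ) = 2 * faceNumber P 3 := by exact_mod_cast faceNumber_two hP hM
  refine ⟨?_, by rw [h3]; ring⟩
  -- `k` is the number of `0`-cochains that give the same cocycle
  obtain ⟨ψ, k, hk⟩ := exists_sum_cocyclesIn hP c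
  have hψ : coboundary P 1 ψ.1 = 0 := LinearMap.mem_ker.1 ψ.2
  set N : ℚ := 2 ^ Fintype.card (Face P 0) with hN
  have hN0 : N ≠ 0 := by positivity
  have hcard : N = k * (cocyclesIn c).card := by
    have := hk fun _ => 1
    simpa [ZMod.card] using this
  -- the average contribution of a face with `r` vertices
  let F : ℕ → ℚ := fun r => (-1) ^ r * if r = 0 then 0 else 1 - 2 / 2 ^ r
  have hsum : ∑ φ : Face P 0 → ZMod 2, (eulerChar (normalSurface (ψ.1 + coboundary P 0 φ)) : ℚ) =
      N * ∑ x : P, F (Nat.card (Vert x)) := by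
    have hE : ∀ φ : Face P 0 → ZMod 2,
        (eulerChar (normalSurface (ψ.1 + coboundary P 0 φ)) : ℚ) = ∑ x : P,
          if ∃ e : Face P 1, e.1 ≤ x ∧ (ψ.1 + coboundary P 0 φ) e = 1 then
            (-1 : ℚ) ^ Nat.card (Vert x) else 0 := by
      intro φ
      rw [eulerChar_normalSurface hP, ← Finset.sum_filter]
      · push_cast
        rfl
      · rw [map_add, hψ, coboundary_coboundary hP, add_zero]
    rw [Finset.sum_congr rfl fun φ _ => hE φ, Finset.sum_comm, Finset.mul_sum]
    refine Finset.sum_congr rfl fun x _ => ?_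
    rw [← Finset.sum_filter, Finset.sum_const, nsmul_eq_mul, card_odd hP hψ x]
    simp only [F]
    ring
  have hF := sum_card_vert (card_vert_le_four hP hM) F (by simp [F])
  have hk' := hk fun ψ => (eulerChar (normalSurface ψ) : ℚ)
  rw [hsum, hcard, hF, h2, h3] at hk'
  rw [hcard] at hN0
  have hk0 : (k : ℚ) ≠ 0 := left_ne_zero_of_mul hN0
  have hc0 : ((cocyclesIn c).card : ℚ) ≠ 0 := right_ne_zero_of_mul hN0
  rw [mul_assoc] at hk'
  rw [← mul_left_cancel₀ hk0 hk', mul_div_cancel_left₀ _ hc0]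
  norm_num [F]
  ring
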